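/- **Theorem 1 (univariate elliptic beta integral).** For $q,p\in\mathbb C$ with $|q|,|p|<1$ put $(a;q)_\infty=\prod_{j\ge 0}(1-aq^j)$ and $$\Gamma(z)=\Gamma(z;q,p)=\prod_{j,k=0}^\infty\frac{1-z^{-1}q^{j+1}p^{k+1}}{1-zq^jp^k}.$$ Let $t_1,\dots,t_5\in\mathbb C\setminus\{0\}$, $A=\prod_{m=1}^5t_m$, and $$\rho(z)=\frac{\prod_{m=1}^5\Gamma(t_mz)\,\Gamma(t_mz^{-1})\,\Gamma(At_m^{-1})}{\Gamma(z^2)\,\Gamma(z^{-2})\,\Gamma(Az)\,\Gamma(Az^{-1})\prod_{1\le m<s\le 5}\Gamma(t_mt_s)}.$$ Assume that the $z$-independent factors of $\rho$ are finite, that is, for all integers $j,k\ge 0$, $At_m^{-1}q^jp^k\ne 1$ for every $m$ and $t_mt_s\ne q^{j+1}p^{k+1}$ for all $m<s$. Let $$P=\{t_mq^jp^k,\ A^{-1}q^{j+1}p^{k+1}\ :\ m=1,\dots,5,\ j,k=0,1,2,\dots\}.$$ Let $C$ be a positively oriented (piecewise $C^1$, closed) contour separating $P$ from the set $P^{-1}$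 of reciprocals of the nonzero points of $P$: $C$ avoids $0$ and these points, has winding number $1$ about $0$ and about every point of $P$, and winding number $0$ about every point of $P^{-1}$. Then $\rho(z)/z$ is integrable along $C$ and $$\int_C\rho(z)\,\frac{dz}{z}=\frac{4\pi i}{(q;q)_\infty(p;p)_\infty}.$$ -/

import Mathlib

open scoped BigOperators

noncomputable section

namespace EllipticBeta

/-- The infinite product `(a; q)_∞ = ∏_{j ≥ 0} (1 - a q^j)`. -/
def qPoch (a q : ℂ) : ℂ := ∏' j : ℕ, (1 - a * q ^ j)

/-- The standard elliptic gamma function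
`Γ(z; q, p) = ∏_{j,k ≥ 0} (1 - z⁻¹ q^{j+1} p^{k+1}) / (1 - z q^j p^k)`.
The two products converge absolutely for `|q|, |p| < 1`, `z ≠ 0`. -/
def ellGamma (q p z : ℂ) : ℂ :=
  (∏' jk : ℕ × ℕ, (1 - z⁻¹ * q ^ (jk.1 + 1) * p ^ (jk.2 + 1))) /
    ∏' jk : ℕ × ℕ, (1 - z * q ^ jk.1 * p ^ jk.2)

/-- The balancing parameter `A = t₁ t₂ t₃ t₄ t₅`. -/
def bigA (t : Fin 5 → ℂ) : ℂ := ∏ m, t m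

/-- The kernel
`ρ(z, t) = ∏ₘ Γ(tₘ z) Γ(tₘ z⁻¹) Γ(A tₘ⁻¹)`
`  / (Γ(z²) Γ(z⁻²) Γ(A z) Γ(A z⁻¹) ∏_{m < s} Γ(tₘ tₛ))`. -/
def kernel (q p : ℂ) (t : Fin 5 → ℂ) (z : ℂ) : ℂ :=
  (∏ m, (ellGamma q p (t m * z) * ellGamma q p (t m * z⁻¹) * ellGamma q p (bigA t * (t m)⁻¹))) /
    (ellGamma q p (z ^ 2) * ellGamma q p ((z ^ 2)⁻¹) *
      ellGamma q p (bigA t * z) * ellGamma q p (bigA t * z⁻¹) *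
      ∏ m, ∏ s ∈ Finset.Ioi m, ellGamma q p (t m * t s))

/-- The set `{tₘ q^j p^k, A⁻¹ q^{j+1} p^{k+1}}` of points along which the poles of the kernel
converge to zero. -/
def poleSet (q p : ℂ) (t : Fin 5 → ℂ) : Set ℂ :=
  {w | (∃ (m : Fin 5) (j k : ℕ), w = t m * q ^ j * p ^ k) ∨
    ∃ j k : ℕ, w = (bigA t)⁻¹ * q ^ (j + 1) * p ^ (k + 1)}

/-- `γ : [a, b] → ℂ` is a piecewise continuously differentiable closed curve. -/
structure IsPiecewiseC1Loop (γ : ℝ → ℂ) (a b : ℝ) : Prop where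
  lt : a < b
  continuousOn : ContinuousOn γ (Set.Icc a b)
  closed : γ a = γ b
  piecewise : ∃ (n : ℕ) (s : ℕ → ℝ), Monotone s ∧ s 0 = a ∧ s n = b ∧
    ∀ i < n, ContDiffOn ℝ 1 γ (Set.Icc (s i) (s (i + 1)))

/-- The contour integral `∫_γ f(z) dz = ∫_a^b γ'(x) f(γ(x)) dx`. -/
def contourIntegral (f : ℂ → ℂ) (γ : ℝ → ℂ) (a b : ℝ) : ℂ :=
  ∫ x in a..b, deriv γ x * f (γ x)

/-- The winding number of the closed curve `γ` about a point `w` off the curve. -/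
def windingNumber (γ : ℝ → ℂ) (a b : ℝ) (w : ℂ) : ℂ :=
  (2 * Real.pi * Complex.I)⁻¹ * contourIntegral (fun z => (z - w)⁻¹) γ a b

/-- `w` lies inside the curve, which winds around it once in the positive direction. -/
def Encircles (γ : ℝ → ℂ) (a b : ℝ) (w : ℂ) : Prop :=
  w ∉ γ '' Set.Icc a b ∧ windingNumber γ a b w = 1

/-- `w` lies outside the curve. -/
def Excludes (γ : ℝ → ℂ) (a b : ℝ) (w : ℂ) : Prop :=
  w ∉ γ '' Set.Icc a b ∧ windingNumber γ a b w = 0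

/-- A positively oriented contour separating `P`, a set of points converging to the origin
(so that `P` and the origin are inside), from the set `P⁻¹` of reciprocals (which is outside).
The condition `w ≠ 0` only matters for `p q = 0`, when `P` contains the origin itself. -/
structure IsSeparatingContour (P : Set ℂ) (γ : ℝ → ℂ) (a b : ℝ) : Prop where
  loop : IsPiecewiseC1Loop γ a b
  encircles_zero : Encircles γ a b 0
  encircles : ∀ w ∈ P, Encircles γ a b w
  excludes : ∀ w ∈ P, w ≠ 0 → Excludes γ a b w⁻¹

end EllipticBeta

end

/-! The proof is the one by a difference equation in a parameter and a residue computation.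

Write `ρ(z; t₁)` for the kernel, with the other parameters fixed. An identity between theta
functions (`theta_difference_identity`, a consequence of Weierstrass' addition formula
`theta_addition`) gives `ρ(z; q t₁) - ρ(z; t₁) = g(z / q) - g(z)` with an explicit product `g` of
elliptic gamma functions (`certificate`). No pole of `g` lies between a separating contour and its
dilation by `q⁻¹`, so the integral is unchanged under `t₁ ↦ q t₁`
(`IsSeparatingCycle.integral_shift`), and, by the symmetry in `q` and `p`, under `t₁ ↦ p t₁`.

For generic parameters and up to an arbitrarily small change of `p`, some multiple `t₁ q^a p^b` is
arbitrarily close to `t₂⁻¹` (`Generic.exists_near`). As `t₁ t₂ → 1` the points `t₁`, `t₂` approach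
the points `t₂⁻¹`, `t₁⁻¹` on the other side of the contour, while `ρ` tends to zero elsewhere
because of the factor `1 / Γ(t₁ t₂)`. Only the residues at `t₁` and `t₂` survive, each with the
limit `1 / ((q; q)_∞ (p; p)_∞)` (`tendsto_ellInt_of_mul_eq_one`). Continuity of the integral in
the parameters then gives the value for generic parameters (`Generic.ellInt_eq`), and, as these
are dense, for all admissible parameters (`IsSeparatingCycle.integral_regKernel`).

Contours enter only through Cauchy's theorem in its homological form. A *cycle* is here a linear
functional `f ↦ Λ f` on functions continuous on a compact set `K` that is bounded by the supremum
norm and vanishes on the functions `(z - w)⁻²`; this covers piecewise `C¹` loops, circles, dilations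
and linear combinations of these. Cycles with the same winding numbers about the complement
of an open set give the same integral to functions holomorphic there (`IsCycle.eq_of_wind_eq`), and
any countable set that accumulates only at the origin is separated by a cycle from any set
that accumulates only at infinity (`exists_separating_cycle`).

The kernel contains `1 / (Γ(z²) Γ(z⁻²))`, which in Lean takes the junk value zero at the
zeros of `Γ(z²)` and `Γ(z⁻²)`; it is replaced by the product of theta functions to which it is equal
elsewhere (`regKernel`). A contour meets the countably many exceptional points with
velocity zero at almost every time (`ae_deriv_eq_zero_of_mem_countable`), so this does not change
the integral. -/

open Filter Topology Set

namespace EllipticBeta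

/-! ### The double product `(x; q, p)_∞` -/

/-- The double infinite product `(x; q, p)_∞ = ∏_{j,k ≥ 0} (1 - x q^j p^k)`. -/
noncomputable def dPoch (q p x : ℂ) : ℂ := ∏' jk : ℕ × ℕ, (1 - x * q ^ jk.1 * p ^ jk.2)

lemma summable_norm_dPoch {q p : ℂ} (hq : ‖q‖ < 1) (hp : ‖p‖ < 1) (x : ℂ) :
    Summable fun jk : ℕ × ℕ => ‖-(x * q ^ jk.1 * p ^ jk.2)‖ := by
  have h := ((summable_geometric_of_lt_one (norm_nonneg q) hq).mul_of_nonneg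
    (summable_geometric_of_lt_one (norm_nonneg p) hp) (fun _ => by positivity)
    (fun _ => by positivity)).mul_left ‖x‖
  simpa [mul_assoc] using h

lemma multipliable_dPoch {q p : ℂ} (hq : ‖q‖ < 1) (hp : ‖p‖ < 1) (x : ℂ) :
    Multipliable fun jk : ℕ × ℕ => (1 - x * q ^ jk.1 * p ^ jk.2) := by
  simpa [sub_eq_add_neg] using multipliable_one_add_of_summable (summable_norm_dPoch hq hp x)

lemma dPoch_ne_zero {q p x : ℂ} (hq : ‖q‖ < 1) (hp : ‖p‖ < 1)
    (h : ∀ j k : ℕ, x * q ^ j * p ^ k ≠ 1) : dPoch q p x ≠ 0 := by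
  have := tprod_one_add_ne_zero_of_summable (f := fun jk : ℕ × ℕ => -(x * q ^ jk.1 * p ^ jk.2))
    (fun jk => by rw [← sub_eq_add_neg]; exact sub_ne_zero.2 (h jk.1 jk.2).symm)
    (summable_norm_dPoch hq hp x)
  simpa [dPoch, sub_eq_add_neg] using this

lemma dPoch_comm (q p x : ℂ) : dPoch q p x = dPoch p q x := by
  unfold dPoch
  rw [← (Equiv.prodComm ℕ ℕ).tprod_eq]
  exact tprod_congr fun jk => by simp [mul_right_comm]

lemma qPoch_eq_dPoch (a q : ℂ) : qPoch a q = dPoch q 0 a := by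
  unfold qPoch dPoch
  have hinj : Function.Injective fun j : ℕ => (j, (0 : ℕ)) := fun a b h => by simpa using h
  rw [← hinj.tprod_eq]
  · exact tprod_congr fun j => by simp
  · rintro ⟨j, k⟩ h
    rcases Nat.eq_zero_or_pos k with rfl | hk
    · exact ⟨j, rfl⟩
    · simp [hk.ne'] at h

lemma qPoch_ne_zero {a q : ℂ} (hq : ‖q‖ < 1) (h : ∀ j : ℕ, a * q ^ j ≠ 1) : qPoch a q ≠ 0 := by
  rw [qPoch_eq_dPoch]
  refine dPoch_ne_zero hq (by simp) fun j k => ?_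
  rcases Nat.eq_zero_or_pos k with rfl | hk
  · simpa using h j
  · simp [hk.ne']

lemma multipliable_qPoch {q : ℂ} (hq : ‖q‖ < 1) (x : ℂ) :
    Multipliable fun j : ℕ => (1 - x * q ^ j) := by
  have : Summable fun j : ℕ => ‖-(x * q ^ j)‖ := by
    simpa using (summable_geometric_of_lt_one (norm_nonneg q) hq).mul_left ‖x‖
  simpa [sub_eq_add_neg] using multipliable_one_add_of_summable this

lemma hasProd_qPoch_dPoch {q p : ℂ} (hq : ‖q‖ < 1) (hp : ‖p‖ < 1) (x : ℂ) :
    HasProd (fun j : ℕ => qPoch (x * q ^ j) p) (dPoch q p x) := by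
  refine HasProd.prod_fiberwise (f := fun jk : ℕ × ℕ => 1 - x * q ^ jk.1 * p ^ jk.2)
    (multipliable_dPoch hq hp x).hasProd fun j => ?_
  exact (multipliable_qPoch hp (x * q ^ j)).hasProd

/-- `(x; q, p)_∞ = (x; p)_∞ (q x; q, p)_∞`: the factors with `j = 0` are split off. -/
lemma dPoch_eq_qPoch_mul {q p : ℂ} (hq : ‖q‖ < 1) (hp : ‖p‖ < 1) (x : ℂ) :
    dPoch q p x = qPoch x p * dPoch q p (q * x) := by
  have h2 : HasProd (fun j : ℕ => qPoch (x * q ^ (j + 1)) p) (dPoch q p (q * x)) := by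
    convert hasProd_qPoch_dPoch hq hp (q * x) using 3 with j
    ring
  have h3 := tprod_eq_zero_mul' (f := fun j : ℕ => qPoch (x * q ^ j) p) h2.multipliable
  rw [(hasProd_qPoch_dPoch hq hp x).tprod_eq, h2.tprod_eq] at h3
  simpa using h3

lemma dPoch_eq_qPoch_mul' {q p : ℂ} (hq : ‖q‖ < 1) (hp : ‖p‖ < 1) (x : ℂ) :
    dPoch q p x = qPoch x q * dPoch q p (p * x) := by
  rw [dPoch_comm, dPoch_eq_qPoch_mul hp hq, dPoch_comm]

lemma qPoch_eq_mul {p : ℂ} (hp : ‖p‖ < 1) (x : ℂ) : qPoch x p = (1 - x) * qPoch (p * x) p := by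
  rw [qPoch_eq_dPoch, dPoch_eq_qPoch_mul hp (by simp), ← qPoch_eq_dPoch]
  congr 1
  unfold qPoch
  rw [tprod_eq_mulSingle 0]
  · simp
  · intro j hj; simp [hj]

lemma continuousAt_dPoch {x₀ : ℂ × ℂ × ℂ} (hq : ‖x₀.1‖ < 1) (hp : ‖x₀.2.1‖ < 1) :
    ContinuousAt (fun x : ℂ × ℂ × ℂ => dPoch x.1 x.2.1 x.2.2) x₀ := by
  obtain ⟨r, hr1, hr2⟩ := exists_between hq
  obtain ⟨s, hs1, hs2⟩ := exists_between hp
  have hr0 := (norm_nonneg _).trans_lt hr1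
  have hs0 := (norm_nonneg _).trans_lt hs1
  have h := tendsto_tprod_one_add_of_dominated_convergence (𝓕 := 𝓝 x₀)
    (f := fun (x : ℂ × ℂ × ℂ) (jk : ℕ × ℕ) => -(x.2.2 * x.1 ^ jk.1 * x.2.1 ^ jk.2))
    (g := fun jk : ℕ × ℕ => -(x₀.2.2 * x₀.1 ^ jk.1 * x₀.2.1 ^ jk.2))
    (bound := fun jk => (‖x₀.2.2‖ + 1) * (r ^ jk.1 * s ^ jk.2)) ?_ ?_ ?_
  · simpa [ContinuousAt, dPoch, sub_eq_add_neg] using h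
  · exact ((summable_geometric_of_lt_one hr0.le hr2).mul_of_nonneg
      (summable_geometric_of_lt_one hs0.le hs2) (fun _ => by positivity)
      (fun _ => by positivity)).mul_left _
  · intro k
    have : Continuous fun x : ℂ × ℂ × ℂ => -(x.2.2 * x.1 ^ k.1 * x.2.1 ^ k.2) := by fun_prop
    exact this.continuousAt
  · have e1 : ∀ᶠ x : ℂ × ℂ × ℂ in 𝓝 x₀, ‖x.1‖ < r :=
      (by fun_prop : Continuous fun x : ℂ × ℂ × ℂ => ‖x.1‖).continuousAt.eventually_lt_const hr1
    have e2 : ∀ᶠ x : ℂ × ℂ × ℂ in 𝓝 x₀, ‖x.2.1‖ < s :=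
      (by fun_prop : Continuous fun x : ℂ × ℂ × ℂ => ‖x.2.1‖).continuousAt.eventually_lt_const hs1
    have e3 : ∀ᶠ x : ℂ × ℂ × ℂ in 𝓝 x₀, ‖x.2.2‖ < ‖x₀.2.2‖ + 1 :=
      (by fun_prop : Continuous fun x : ℂ × ℂ × ℂ => ‖x.2.2‖).continuousAt.eventually_lt_const
        (lt_add_one _)
    filter_upwards [e1, e2, e3] with x h1 h2 h3 k
    rw [norm_neg, norm_mul, norm_mul, norm_pow, norm_pow, mul_assoc]
    gcongr

lemma continuousAt_dPoch_comp {X : Type*} [TopologicalSpace X] {f g h : X → ℂ} {a : X}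
    (hf : ContinuousAt f a) (hg : ContinuousAt g a) (hh : ContinuousAt h a)
    (hq : ‖f a‖ < 1) (hp : ‖g a‖ < 1) :
    ContinuousAt (fun x => dPoch (f x) (g x) (h x)) a :=
  ContinuousAt.comp (g := fun x : ℂ × ℂ × ℂ => dPoch x.1 x.2.1 x.2.2)
    (f := fun x => (f x, g x, h x)) (continuousAt_dPoch (x₀ := (f a, g a, h a)) hq hp)
    (hf.prodMk (hg.prodMk hh))

lemma continuousAt_qPoch_comp {X : Type*} [TopologicalSpace X] {f h : X → ℂ} {a : X}
    (hh : ContinuousAt h a) (hf : ContinuousAt f a) (hq : ‖f a‖ < 1) :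
    ContinuousAt (fun x => qPoch (h x) (f x)) a := by
  simp only [qPoch_eq_dPoch]
  exact continuousAt_dPoch_comp hf continuousAt_const hh hq (by simp)

lemma differentiable_dPoch {q p : ℂ} (hq : ‖q‖ < 1) (hp : ‖p‖ < 1) :
    Differentiable ℂ (dPoch q p) := by
  intro x₀
  have h := Summable.hasProdLocallyUniformlyOn_one_add (K := Metric.ball (0 : ℂ) (‖x₀‖ + 1))
    (f := fun (jk : ℕ × ℕ) x => -(x * q ^ jk.1 * p ^ jk.2))
    (u := fun jk => ‖-((‖x₀‖ + 1 : ℂ) * q ^ jk.1 * p ^ jk.2)‖) Metric.isOpen_ball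
    (summable_norm_dPoch hq hp _) (Eventually.of_forall fun jk x hx => by
      have : ‖(‖x₀‖ + 1 : ℂ)‖ = ‖x₀‖ + 1 := by
        rw [← Complex.ofReal_one, ← Complex.ofReal_add, Complex.norm_real,
          Real.norm_of_nonneg (by positivity)]
      have hx' : ‖x‖ < ‖x₀‖ + 1 := by simpa using hx
      simp only [norm_neg, norm_mul, this]
      gcongr) (fun jk => by fun_prop)
  have h2 := h.differentiableOn (Eventually.of_forall fun s => by fun_prop) Metric.isOpen_ball
  have h3 := h2.differentiableAt (Metric.isOpen_ball.mem_nhds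
    (by simp : x₀ ∈ Metric.ball (0 : ℂ) (‖x₀‖ + 1)))
  have he : dPoch q p = fun x => ∏' jk : ℕ × ℕ, (1 + -(x * q ^ jk.1 * p ^ jk.2)) := by
    funext x
    simp only [dPoch, sub_eq_add_neg]
  rwa [he]

lemma differentiable_qPoch {q : ℂ} (hq : ‖q‖ < 1) : Differentiable ℂ fun x => qPoch x q := by
  simp only [qPoch_eq_dPoch]
  exact differentiable_dPoch hq (by simp)

/-! ### Theta functions -/

/-- A function that is continuous at a point and vanishes off a countable set
vanishes at that point. -/
lemma eq_zero_of_countable_exceptions {f : ℂ → ℂ} {v : ℂ} {S : Set ℂ} (hS : S.Countable)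
    (hf : ContinuousAt f v) (h : ∀ w ∉ S, f w = 0) : f v = 0 := by
  by_contra hne
  obtain ⟨w, hw, hwS⟩ := mem_closure_iff_nhds.1 ((hS.dense_compl ℝ) v) _ (hf.eventually_ne hne)
  exact hw (h w hwS)

/-- The theta function `θ(x; p) = (x; p)_∞ (p / x; p)_∞`. -/
noncomputable def theta (p x : ℂ) : ℂ := qPoch x p * qPoch (p / x) p

section Theta

variable {p : ℂ}

lemma theta_mul_left (hp : ‖p‖ < 1) (hp0 : p ≠ 0) {x : ℂ} (hx : x ≠ 0) :
    theta p (p * x) = -x⁻¹ * theta p x := by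
  have e1 : p / (p * x) = x⁻¹ := by field_simp
  have e2 := qPoch_eq_mul hp x
  have e3 := qPoch_eq_mul hp x⁻¹
  unfold theta
  rw [e1, e3, e2, ← div_eq_mul_inv]
  field_simp
  ring

lemma theta_inv (hp : ‖p‖ < 1) {x : ℂ} (hx : x ≠ 0) : theta p x⁻¹ = -x⁻¹ * theta p x := by
  have e2 := qPoch_eq_mul hp x
  have e3 := qPoch_eq_mul hp x⁻¹
  unfold theta
  rw [e3, e2, ← div_eq_mul_inv, div_inv_eq_mul]
  field_simp
  ring

lemma theta_one (hp : ‖p‖ < 1) : theta p 1 = 0 := by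
  rw [theta, qPoch_eq_mul hp]; simp

lemma exists_zpow_of_theta_eq_zero (hp : ‖p‖ < 1) {x : ℂ} (hx : x ≠ 0)
    (h : theta p x = 0) : ∃ n : ℤ, x = p ^ n := by
  by_contra! hn
  refine mul_ne_zero (qPoch_ne_zero hp fun j hj => hn (-j) ?_)
    (qPoch_ne_zero hp fun j hj => hn (j + 1) ?_) h
  · rw [zpow_neg, zpow_natCast]; exact eq_inv_of_mul_eq_one_left hj
  · have hx' : p * p ^ j = x := by field_simp at hj; exact hj
    rw [← hx', ← pow_succ']; exact_mod_cast rfl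

lemma differentiableAt_theta (hp : ‖p‖ < 1) {x : ℂ} (hx : x ≠ 0) :
    DifferentiableAt ℂ (theta p) x := by
  have h1 : DifferentiableAt ℂ (fun x => qPoch (p / x) p) x :=
    ((differentiable_qPoch hp) (p / x)).comp x
      ((differentiableAt_const p).div differentiableAt_id hx)
  exact ((differentiable_qPoch hp) x).mul h1

/-- The zeros `p^n` of the theta function are simple. -/
lemma deriv_theta_zpow_ne_zero (hp : ‖p‖ < 1) (hp0 : p ≠ 0) (n : ℤ) :
    theta p (p ^ n) = 0 ∧ deriv (theta p) (p ^ n) ≠ 0 := by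
  have step (y : ℂ) (hy : y ≠ 0) (h0 : theta p y = 0) :
      theta p (p * y) = 0 ∧ p * deriv (theta p) (p * y) = -y⁻¹ * deriv (theta p) y := by
    refine ⟨by rw [theta_mul_left hp hp0 hy, h0, mul_zero], ?_⟩
    have d1 : HasDerivAt (fun x => theta p (p * x)) (deriv (theta p) (p * y) * p) y := by
      have h1 := (hasDerivAt_id y).const_mul p
      rw [mul_one] at h1
      exact HasDerivAt.comp y (differentiableAt_theta hp (mul_ne_zero hp0 hy)).hasDerivAt h1
    have d2 := (hasDerivAt_inv hy).neg.mul (differentiableAt_theta hp hy).hasDerivAt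
    have d3 : HasDerivAt (fun x => theta p (p * x)) _ y := d2.congr_of_eventuallyEq (by
      filter_upwards [isOpen_ne.mem_nhds hy] with x hx using theta_mul_left hp hp0 hx)
    have := d1.unique d3
    rw [h0, mul_zero, zero_add] at this
    rw [mul_comm]
    exact this
  induction n using Int.induction_on with
  | zero =>
    refine ⟨by simpa using theta_one hp, ?_⟩
    have e : theta p = fun x => (1 - x) * (qPoch (p * x) p * qPoch (p / x) p) := by
      funext x; rw [theta, qPoch_eq_mul hp, mul_assoc]
    have d1 : DifferentiableAt ℂ (fun x => qPoch (p * x) p * qPoch (p / x) p) 1 :=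
      (((differentiable_qPoch hp) _).comp 1
        ((differentiableAt_const p).mul differentiableAt_id)).mul
      (((differentiable_qPoch hp) _).comp 1
        ((differentiableAt_const p).div differentiableAt_id one_ne_zero))
    have d2 := ((hasDerivAt_id (1 : ℂ)).const_sub 1).mul d1.hasDerivAt
    have hne : qPoch p p ≠ 0 := qPoch_ne_zero hp fun j hj => by
      have : ‖p * p ^ j‖ < 1 := by
        rw [← pow_succ', norm_pow]; exact pow_lt_one₀ (norm_nonneg _) hp (by simp)
      simp [hj] at this
    rw [zpow_zero, e]
    have d3 := d2.deriv
    simp only [id] at d3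
    intro h
    have : deriv (fun x => (1 - x) * (qPoch (p * x) p * qPoch (p / x) p)) 1 =
      -1 * (qPoch (p * 1) p * qPoch (p / 1) p) +
        (1 - 1) * deriv (fun x => qPoch (p * x) p * qPoch (p / x) p) 1 := d3
    rw [h] at this
    simp [hne] at this
  | succ n ih =>
    have hz : p ^ ((n : ℤ) + 1) = p * p ^ (n : ℤ) := by rw [zpow_add_one₀ hp0, mul_comm]
    obtain ⟨h1, h2⟩ := step _ (zpow_ne_zero n hp0) ih.1
    rw [hz]
    refine ⟨h1, fun h => ?_⟩
    rw [h, mul_zero] at h2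
    exact mul_ne_zero (neg_ne_zero.2 (inv_ne_zero (zpow_ne_zero _ hp0))) ih.2 h2.symm
  | pred n ih =>
    have hz : p ^ (-(n : ℤ)) = p * p ^ (-(n : ℤ) - 1) := by
      rw [← zpow_one_add₀ hp0]; congr 1; ring
    have hne := zpow_ne_zero (-(n : ℤ) - 1) hp0
    have h0 : theta p (p ^ (-(n : ℤ) - 1)) = 0 := by
      have := ih.1
      rw [hz, theta_mul_left hp hp0 hne] at this
      simpa [hne, hp0] using this
    obtain ⟨h1, h2⟩ := step _ hne h0
    refine ⟨h0, fun h => ?_⟩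
    rw [h, mul_zero, ← hz] at h2
    exact mul_ne_zero hp0 ih.2 h2

/-- Liouville's theorem on the torus `ℂˣ / p^ℤ`. -/
lemma eq_of_differentiable_of_mul_periodic (hp : ‖p‖ < 1) (hp0 : p ≠ 0) {f : ℂ → ℂ}
    (hf : ∀ x, x ≠ 0 → DifferentiableAt ℂ f x) (hper : ∀ x, x ≠ 0 → f (p * x) = f x)
    {x y : ℂ} (hx : x ≠ 0) (hy : y ≠ 0) : f x = f y := by
  have hpz (n : ℤ) : ∀ x, x ≠ 0 → f (p ^ n * x) = f x := by
    induction n using Int.induction_on with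
    | zero => simp
    | succ n ih =>
      intro x hx
      rw [zpow_add_one₀ hp0, mul_assoc, ih _ (mul_ne_zero hp0 hx), hper x hx]
    | pred n ih =>
      intro x hx
      rw [← ih x hx, ← hper (p ^ (-(n : ℤ) - 1) * x) (mul_ne_zero (zpow_ne_zero _ hp0) hx),
        ← mul_assoc, ← zpow_one_add₀ hp0]
      congr 3; ring
  -- `f` takes all its values on the fundamental annulus `‖p‖ ≤ ‖x‖ ≤ 1`, so it is bounded.
  have hK : IsCompact (Metric.closedBall (0 : ℂ) 1 \ Metric.ball 0 ‖p‖) :=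
    (isCompact_closedBall 0 1).diff Metric.isOpen_ball
  have hne : ∀ x ∈ Metric.closedBall (0 : ℂ) 1 \ Metric.ball 0 ‖p‖, x ≠ 0 := by
    rintro x ⟨-, hx⟩ rfl
    simp [hp0] at hx
  obtain ⟨C, hC⟩ := hK.exists_bound_of_continuousOn (f := f)
    fun x hx => (hf x (hne x hx)).continuousAt.continuousWithinAt
  have hb : ∀ x, x ≠ 0 → ‖f x‖ ≤ C := by
    intro x hx
    obtain ⟨n, hn1, hn2⟩ := exists_mem_Ioc_zpow (norm_pos_iff.2 hx)
      (one_lt_inv_iff₀.2 ⟨norm_pos_iff.2 hp0, hp⟩)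
    have hpp := norm_pos_iff.2 hp0
    rw [← hpz (n + 1) x hx]
    refine hC _ ⟨?_, ?_⟩
    · rw [mem_closedBall_zero_iff, norm_mul, norm_zpow]
      calc ‖p‖ ^ (n + 1) * ‖x‖ ≤ ‖p‖ ^ (n + 1) * ‖p‖⁻¹ ^ (n + 1) := by gcongr
        _ = 1 := by rw [← mul_zpow, mul_inv_cancel₀ hpp.ne', one_zpow]
    · rw [mem_ball_zero_iff, not_lt, norm_mul, norm_zpow]
      calc ‖p‖ = ‖p‖ ^ (n + 1) * ‖p‖⁻¹ ^ n := by
            rw [zpow_add_one₀ hpp.ne', mul_right_comm, ← mul_zpow, mul_inv_cancel₀ hpp.ne',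
              one_zpow, one_mul]
        _ ≤ ‖p‖ ^ (n + 1) * ‖x‖ := by gcongr
  have hg : Differentiable ℂ fun u => f (Complex.exp u) := fun u =>
    (hf _ (Complex.exp_ne_zero u)).comp u Complex.differentiable_exp.differentiableAt
  have := hg.apply_eq_apply_of_bounded (isBounded_iff_forall_norm_le.2
    ⟨C, by rintro _ ⟨u, rfl⟩; exact hb _ (Complex.exp_ne_zero u)⟩) (Complex.log x) (Complex.log y)
  simpa [Complex.exp_log hx, Complex.exp_log hy] using this

/-- A quotient of functions holomorphic on `ℂˣ` with the same multiplier is constant when the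
denominator has only simple zeros and the numerator vanishes there. -/
lemma exists_eq_const_mul_of_simple_zeros (hp : ‖p‖ < 1) (hp0 : p ≠ 0) {F G m : ℂ → ℂ}
    (hF : ∀ x, x ≠ 0 → DifferentiableAt ℂ F x) (hG : ∀ x, x ≠ 0 → DifferentiableAt ℂ G x)
    (hm : ∀ x, x ≠ 0 → m x ≠ 0)
    (hFp : ∀ x, x ≠ 0 → F (p * x) = m x * F x) (hGp : ∀ x, x ≠ 0 → G (p * x) = m x * G x)
    (h0 : ∀ x, x ≠ 0 → G x = 0 → F x = 0 ∧ deriv G x ≠ 0) :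
    ∃ C, ∀ x, x ≠ 0 → F x = C * G x := by
  classical
  set H : ℂ → ℂ := fun x => if G x = 0 then deriv F x / deriv G x else F x / G x with hH
  have hHd : ∀ x, x ≠ 0 → DifferentiableAt ℂ H x := by
    intro x hx
    by_cases hGx : G x = 0
    · obtain ⟨hFx, hd⟩ := h0 x hx hGx
      have hns : {y : ℂ | y ≠ 0} ∈ 𝓝 x := isOpen_ne.mem_nhds hx
      have dd {f : ℂ → ℂ} (hf : ∀ x, x ≠ 0 → DifferentiableAt ℂ f x) :
          DifferentiableAt ℂ (dslope f x) x :=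
        ((Complex.differentiableOn_dslope hns).2
          fun y hy => (hf y hy).differentiableWithinAt).differentiableAt hns
      have hq : DifferentiableAt ℂ (fun y => dslope F x y / dslope G x y) x :=
        (dd hF).div (dd hG) (by rwa [dslope_same])
      refine hq.congr_of_eventuallyEq ?_
      filter_upwards [(dd hG).continuousAt.eventually_ne (by rwa [dslope_same])] with y hy
      by_cases hyx : y = x
      · subst hyx; simp [hH, hGx]
      · have hyx' : y - x ≠ 0 := sub_ne_zero.2 hyx
        rw [dslope_of_ne _ hyx, slope_def_field, hGx, sub_zero] at hy
        have hGy : G y ≠ 0 := fun h => hy (by simp [h])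
        rw [hH]
        simp only [hGy, if_false]
        rw [dslope_of_ne _ hyx, dslope_of_ne _ hyx, slope_def_field, slope_def_field, hFx, hGx]
        simp only [sub_zero]
        rw [div_div_div_cancel_right₀ hyx']
    · refine ((hF x hx).div (hG x hx) hGx).congr_of_eventuallyEq ?_
      filter_upwards [(hG x hx).continuousAt.eventually_ne hGx] with y hy
      simp [hH, hy]
  have hGiso : ∀ x, x ≠ 0 → ∀ᶠ y in 𝓝[≠] x, G y ≠ 0 := by
    intro x hx
    by_cases hGx : G x = 0
    · have := (hG x hx).hasDerivAt.eventually_ne (c := 0) (h0 x hx hGx).2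
      exact this
    · exact ((hG x hx).continuousAt.eventually_ne hGx).filter_mono nhdsWithin_le_nhds
  have hHp : ∀ x, x ≠ 0 → H (p * x) = H x := by
    intro x hx
    have hc : Tendsto (fun y => H (p * y) - H y) (𝓝[≠] x) (𝓝 (H (p * x) - H x)) := by
      have : ContinuousAt (fun y => H (p * y) - H y) x :=
        ((hHd _ (mul_ne_zero hp0 hx)).continuousAt.comp (f := fun y => p * y)
          (by fun_prop)).sub (hHd x hx).continuousAt
      exact this.tendsto.mono_left nhdsWithin_le_nhds
    have he : ∀ᶠ y in 𝓝[≠] x, H (p * y) - H y = 0 := by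
      filter_upwards [hGiso x hx, (isOpen_ne.mem_nhds hx : {y : ℂ | y ≠ 0} ∈ 𝓝 x) |>
        mem_nhdsWithin_of_mem_nhds] with y hy hy0
      have h1 : G (p * y) ≠ 0 := by rw [hGp y hy0]; exact mul_ne_zero (hm y hy0) hy
      simp only [hH, hy, h1, if_false]
      rw [hFp y hy0, hGp y hy0, mul_div_mul_left _ _ (hm y hy0), sub_self]
    exact sub_eq_zero.1 (tendsto_nhds_unique (hc.congr' he) tendsto_const_nhds)
  refine ⟨H 1, fun x hx => ?_⟩
  rw [eq_of_differentiable_of_mul_periodic hp hp0 hHd hHp one_ne_zero hx]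
  by_cases hGx : G x = 0
  · simp [hGx, (h0 x hx hGx).1]
  · simp [hH, hGx]

/-- The addition formula for generic `v`. -/
lemma theta_addition_of_generic (hp : ‖p‖ < 1) (hp0 : p ≠ 0) {x y u v : ℂ} (hx : x ≠ 0)
    (hy : y ≠ 0) (hu : u ≠ 0) (hv : v ≠ 0) (hvv : ∀ n : ℤ, v * v ≠ p ^ n)
    (hyv : ∀ n : ℤ, y * v ≠ p ^ n) (hyv' : ∀ n : ℤ, y / v ≠ p ^ n) :
    theta p (x * y) * theta p (x / y) * theta p (u * v) * theta p (u / v)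
      - theta p (x * v) * theta p (x / v) * theta p (u * y) * theta p (u / y)
      - u / y * theta p (y * v) * theta p (y / v) * theta p (x * u) * theta p (x / u) = 0 := by
  have hth (a : ℂ) (ha : a ≠ 0) : ∀ x, x ≠ 0 →
      DifferentiableAt ℂ (fun x => theta p (x * a)) x := fun x hx =>
    DifferentiableAt.comp (g := theta p) (f := fun x => x * a) x
      (differentiableAt_theta hp (mul_ne_zero hx ha))
      (differentiableAt_id.mul_const a)
  have hth' (a : ℂ) (ha : a ≠ 0) : ∀ x, x ≠ 0 →
      DifferentiableAt ℂ (fun x => theta p (x / a)) x := fun x hx =>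
    DifferentiableAt.comp (g := theta p) (f := fun x => x / a) x
      (differentiableAt_theta hp (div_ne_zero hx ha))
      (differentiableAt_id.div_const a)
  have hG (a : ℂ) (ha : a ≠ 0) : ∀ x, x ≠ 0 →
      DifferentiableAt ℂ (fun x => theta p (x * a) * theta p (x / a)) x := fun x hx =>
    (hth a ha x hx).mul (hth' a ha x hx)
  have hGp (a : ℂ) (ha : a ≠ 0) (x : ℂ) (hx : x ≠ 0) :
      theta p (p * x * a) * theta p (p * x / a) =
        (x * x)⁻¹ * (theta p (x * a) * theta p (x / a)) := by
    rw [mul_assoc, mul_div_assoc, theta_mul_left hp hp0 (mul_ne_zero hx ha),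
      theta_mul_left hp hp0 (div_ne_zero hx ha)]
    field_simp
  have inv_swap (a b : ℂ) (ha : a ≠ 0) (hb : b ≠ 0) :
      theta p (a / b) = -(a / b) * theta p (b / a) := by
    have := theta_inv hp (div_ne_zero hb ha)
    rwa [inv_div] at this
  set F : ℂ → ℂ := fun x => theta p (x * y) * theta p (x / y) * (theta p (u * v) * theta p (u / v))
      - theta p (x * v) * theta p (x / v) * (theta p (u * y) * theta p (u / y))
      - theta p (x * u) * theta p (x / u) * (u / y * theta p (y * v) * theta p (y / v)) with hF
  set G : ℂ → ℂ := fun x => theta p (x * v) * theta p (x / v) with hGdef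
  have hFp : ∀ x, x ≠ 0 → F (p * x) = (x * x)⁻¹ * F x := by
    intro x hx
    simp only [hF]
    rw [hGp y hy x hx, hGp v hv x hx, hGp u hu x hx]
    ring
  have hFd : ∀ x, x ≠ 0 → DifferentiableAt ℂ F x := fun x hx =>
    (((hG y hy x hx).mul_const _).sub ((hG v hv x hx).mul_const _)).sub
      ((hG u hu x hx).mul_const _)
  -- As functions of `x`, `F` and `G` have the same multiplier, and `F` vanishes at the simple
  -- zeros `p ^ n * v` and `p ^ n * v⁻¹` of `G`: hence `F = C * G`.
  have hFv : F v = 0 := by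
    simp only [hF]
    rw [div_self hv, theta_one hp, inv_swap u v hu hv, inv_swap v y hv hy, mul_comm v y,
      mul_comm v u]
    field_simp
    ring
  have hFv' : F v⁻¹ = 0 := by
    simp only [hF]
    have e (a : ℂ) (ha : a ≠ 0) : theta p (v⁻¹ * a) * theta p (v⁻¹ / a) =
        (v * v)⁻¹ * (theta p (v * a) * theta p (v / a)) := by
      have e1 : v⁻¹ * a = (v / a)⁻¹ := by field_simp
      have e2 : v⁻¹ / a = (v * a)⁻¹ := by field_simp
      rw [e1, e2, theta_inv hp (div_ne_zero hv ha), theta_inv hp (mul_ne_zero hv ha)]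
      field_simp
    rw [e y hy, e v hv, e u hu]
    have : F v = 0 := hFv
    simp only [hF] at this
    linear_combination (v * v)⁻¹ * this
  have hFz (a : ℂ) (ha : a ≠ 0) (h : F a = 0) (n : ℤ) : F (p ^ n * a) = 0 := by
    induction n using Int.induction_on with
    | zero => simpa
    | succ n ih =>
      rw [zpow_add_one₀ hp0, mul_comm (p ^ (n : ℤ)), mul_assoc,
        hFp _ (mul_ne_zero (zpow_ne_zero _ hp0) ha), ih, mul_zero]
    | pred n ih =>
      have hne : p ^ (-(n : ℤ) - 1) * a ≠ 0 := mul_ne_zero (zpow_ne_zero _ hp0) ha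
      have hz : p ^ (-(n : ℤ)) = p * p ^ (-(n : ℤ) - 1) := by
        rw [← zpow_one_add₀ hp0]; congr 1; ring
      rw [hz, mul_assoc, hFp _ hne] at ih
      exact (mul_eq_zero.1 ih).resolve_left (inv_ne_zero (mul_ne_zero hne hne))
  have hGz : ∀ x, x ≠ 0 → G x = 0 → F x = 0 ∧ deriv G x ≠ 0 := by
    intro x hx hGx
    have dmul : HasDerivAt (fun x => theta p (x * v)) (deriv (theta p) (x * v) * v) x := by
      have h1 := (hasDerivAt_id x).mul_const v
      rw [one_mul] at h1
      exact HasDerivAt.comp x (differentiableAt_theta hp (mul_ne_zero hx hv)).hasDerivAt h1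
    have ddiv : HasDerivAt (fun x => theta p (x / v)) (deriv (theta p) (x / v) * v⁻¹) x := by
      have h1 := (hasDerivAt_id x).div_const v
      rw [one_div] at h1
      exact HasDerivAt.comp x (differentiableAt_theta hp (div_ne_zero hx hv)).hasDerivAt h1
    have hd : deriv G x = _ := (dmul.mul ddiv).deriv
    rcases mul_eq_zero.1 hGx with h | h
    · obtain ⟨n, hn⟩ := exists_zpow_of_theta_eq_zero hp (mul_ne_zero hx hv) h
      have hxe : x = p ^ n * v⁻¹ := by rw [← hn]; field_simp
      refine ⟨by rw [hxe]; exact hFz _ (inv_ne_zero hv) hFv' n, ?_⟩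
      rw [hd, h, zero_mul, add_zero]
      refine mul_ne_zero (mul_ne_zero ?_ hv) fun h2 => ?_
      · rw [hn]; exact (deriv_theta_zpow_ne_zero hp hp0 n).2
      · obtain ⟨k, hk⟩ := exists_zpow_of_theta_eq_zero hp (div_ne_zero hx hv) h2
        refine hvv (n - k) ?_
        rw [zpow_sub₀ hp0, ← hn, ← hk]
        field_simp
    · obtain ⟨n, hn⟩ := exists_zpow_of_theta_eq_zero hp (div_ne_zero hx hv) h
      have hxe : x = p ^ n * v := by rw [← hn]; field_simp
      refine ⟨by rw [hxe]; exact hFz _ hv hFv n, ?_⟩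
      rw [hd, h, mul_zero, zero_add]
      refine mul_ne_zero (fun h2 => ?_) (mul_ne_zero ?_ (inv_ne_zero hv))
      · obtain ⟨k, hk⟩ := exists_zpow_of_theta_eq_zero hp (mul_ne_zero hx hv) h2
        refine hvv (k - n) ?_
        rw [zpow_sub₀ hp0, ← hn, ← hk]
        field_simp
      · rw [hn]; exact (deriv_theta_zpow_ne_zero hp hp0 n).2
  obtain ⟨C, hC⟩ := exists_eq_const_mul_of_simple_zeros hp hp0 hFd (hG v hv)
    (fun x hx => inv_ne_zero (mul_ne_zero hx hx)) hFp (hGp v hv) hGz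
  -- `F` also vanishes at `y`, where `G` does not, and so `C = 0`.
  have hFy : F y = 0 := by
    simp only [hF]
    rw [div_self hy, theta_one hp, inv_swap y u hy hu, mul_comm y u]
    field_simp
    ring
  have hGy : G y ≠ 0 := mul_ne_zero
    (fun h => by
      obtain ⟨n, hn⟩ := exists_zpow_of_theta_eq_zero hp (mul_ne_zero hy hv) h
      exact hyv n hn)
    (fun h => by
      obtain ⟨n, hn⟩ := exists_zpow_of_theta_eq_zero hp (div_ne_zero hy hv) h
      exact hyv' n hn)
  have hC0 : C = 0 := by
    have := hC y hy
    rw [hFy] at this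
    exact (mul_eq_zero.1 this.symm).resolve_right hGy
  have := hC x hx
  rw [hC0, zero_mul] at this
  simp only [hF] at this
  linear_combination this

/-- Weierstrass' addition formula for theta functions. -/
lemma theta_addition (hp : ‖p‖ < 1) (hp0 : p ≠ 0) {x y u v : ℂ} (hx : x ≠ 0)
    (hy : y ≠ 0) (hu : u ≠ 0) (hv : v ≠ 0) :
    theta p (x * y) * theta p (x / y) * theta p (u * v) * theta p (u / v)
      - theta p (x * v) * theta p (x / v) * theta p (u * y) * theta p (u / y)
      - u / y * theta p (y * v) * theta p (y / v) * theta p (x * u) * theta p (x / u) = 0 := by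
  -- The values of `v` that are not generic form a countable set, so the others are dense.
  set S : Set ℂ := {0} ∪ ((fun v : ℂ => v * v) ⁻¹' range fun n : ℤ => p ^ n) ∪
    (range fun n : ℤ => p ^ n / y) ∪ range fun n : ℤ => y / p ^ n
  have hS : S.Countable := by
    refine (((countable_singleton 0).union ?_).union (countable_range _)).union (countable_range _)
    have : (fun v : ℂ => v * v) ⁻¹' (range fun n : ℤ => p ^ n) =
        ⋃ n : ℤ, {v : ℂ | v * v = p ^ n} := by
      ext v; simp [eq_comm]
    rw [this]
    refine countable_iUnion fun n => Finite.countable ?_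
    obtain ⟨s, hs⟩ := IsAlgClosed.exists_pow_nat_eq (p ^ n) two_pos
    refine (toFinite {s, -s}).subset fun v hv => ?_
    have : v * v = s * s := hv.trans (hs.symm.trans (sq s))
    exact mul_self_eq_mul_self_iff.1 this
  have ct (a : ℂ → ℂ) (ha : ContinuousAt a v) (h0 : a v ≠ 0) :
      ContinuousAt (fun v => theta p (a v)) v :=
    ContinuousAt.comp (differentiableAt_theta hp h0).continuousAt ha
  have cm (b : ℂ) (hb : b ≠ 0) := ct (fun v => b * v) (by fun_prop) (mul_ne_zero hb hv)
  have cd (b : ℂ) (hb : b ≠ 0) := ct (fun v => b / v)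
    (continuousAt_const.div continuousAt_id hv) (div_ne_zero hb hv)
  refine eq_zero_of_countable_exceptions hS (v := v) (f := fun v =>
    theta p (x * y) * theta p (x / y) * theta p (u * v) * theta p (u / v)
      - theta p (x * v) * theta p (x / v) * theta p (u * y) * theta p (u / y)
      - u / y * theta p (y * v) * theta p (y / v) * theta p (x * u) * theta p (x / u)) ?_ ?_
  · have h1 := cm u hu
    have h2 := cd u hu
    have h3 := cm x hx
    have h4 := cd x hx
    have h5 := cm y hy
    have h6 := cd y hy
    exact ((continuousAt_const.mul h1).mul h2 |>.sub
      (((h3.mul h4).mul continuousAt_const).mul continuousAt_const)).sub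
      ((((continuousAt_const.mul h5).mul h6).mul continuousAt_const).mul continuousAt_const)
  · intro w hw
    simp only [S, mem_union, mem_singleton_iff, mem_preimage, mem_range, not_or, not_exists] at hw
    obtain ⟨⟨⟨h0, h1⟩, h2⟩, h3⟩ := hw
    refine theta_addition_of_generic hp hp0 hx hy hu h0 (fun n hn => h1 n hn.symm)
      (fun n hn => h2 n ?_) (fun n hn => h3 n ?_)
    · rw [← hn]; field_simp
    · rw [← hn]; field_simp

/-- The addition formula in a form that avoids square roots. -/
lemma theta_addition' (hp : ‖p‖ < 1) (hp0 : p ≠ 0) {s P M N : ℂ} (hs : s ≠ 0)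
    (hP : P ≠ 0) (hM : M ≠ 0) (hN : N ≠ 0) :
    theta p P * theta p (s / P) * theta p (N * M / s) * theta p (N / M)
      - theta p M * theta p (s / M) * theta p (N * P / s) * theta p (N / P)
      = N / P * theta p (P * M / s) * theta p (P / M) * theta p N * theta p (s / N) := by
  obtain ⟨x, rfl⟩ := IsAlgClosed.exists_pow_nat_eq s two_pos
  have hx : x ≠ 0 := by rintro rfl; simp at hs
  have h := theta_addition hp hp0 hx (div_ne_zero hP hx) (div_ne_zero hN hx) (div_ne_zero hM hx)
  have e1 (y : ℂ) : x * (y / x) = y := by field_simp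
  have e2 (y : ℂ) (hy : y ≠ 0) : x / (y / x) = x ^ 2 / y := by field_simp
  have e3 (y w : ℂ) : y / x * (w / x) = y * w / x ^ 2 := by field_simp
  have e4 (y w : ℂ) : y / x / (w / x) = y / w := by field_simp
  simp only [e1, e2 _ hP, e2 _ hM, e2 _ hN, e3, e4] at h
  linear_combination h

lemma theta_div_swap (hp : ‖p‖ < 1) {a b : ℂ} (ha : a ≠ 0) (hb : b ≠ 0) :
    theta p (a / b) = -(a / b) * theta p (b / a) := by
  have := theta_inv hp (div_ne_zero hb ha)
  rwa [inv_div] at this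

/-- The functions `x ↦ θ(α x) θ(α κ / x)` span a space of dimension two: expansion in the basis
belonging to `α = z` and `α = z⁻¹`. -/
lemma theta_expansion (hp : ‖p‖ < 1) (hp0 : p ≠ 0) {α x e z : ℂ} (hα : α ≠ 0) (hx : x ≠ 0)
    (he : e ≠ 0) (hz : z ≠ 0) :
    theta p (x * e) * theta p (z ^ 2) * (theta p (α * x) * theta p (α * e)) =
      theta p (x * z) * theta p (e * z) * (theta p (α * z) * theta p (α * (x * e) / z)) -
      z ^ 2 * (theta p (x / z) * theta p (e / z)) *
        (theta p (α / z) * theta p (α * (x * e) * z)) := by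
  have h := theta_addition' hp hp0 (s := x / e) (P := x * z) (M := x / z) (N := α * x)
    (by positivity) (by positivity) (by positivity) (by positivity)
  have e1 : x / e / (x * z) = 1 / (e * z) := by field_simp
  have e2 : α * x * (x / z) / (x / e) = α * (x * e) / z := by field_simp
  have e3 : α * x / (x / z) = α * z := by field_simp
  have e4 : x / e / (x / z) = z / e := by field_simp
  have e5 : α * x * (x * z) / (x / e) = α * (x * e) * z := by field_simp
  have e6 : α * x / (x * z) = α / z := by field_simp
  have e7 : x * z * (x / z) / (x / e) = x * e := by field_simp
  have e8 : x * z / (x / z) = z ^ 2 := by field_simp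
  have e9 : x / e / (α * x) = 1 / (α * e) := by field_simp
  rw [e1, e2, e3, e4, e5, e6, e7, e8, e9, theta_div_swap hp one_ne_zero (mul_ne_zero he hz),
    theta_div_swap hp one_ne_zero (mul_ne_zero hα he), theta_div_swap hp hz he, div_one,
    div_one] at h
  generalize theta p (x * z) = T₁, theta p (e * z) = T₂, theta p (α * (x * e) / z) = T₃,
    theta p (α * z) = T₄, theta p (x / z) = T₅, theta p (e / z) = T₆,
    theta p (α * (x * e) * z) = T₇, theta p (α / z) = T₈, theta p (x * e) = T₉,
    theta p (z ^ 2) = T₁₀, theta p (α * x) = T₁₁, theta p (α * e) = T₁₂ at h ⊢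
  field_simp at h
  linear_combination h

lemma theta_four_term (hp : ‖p‖ < 1) (hp0 : p ≠ 0) {a c d κ z : ℂ} (ha : a ≠ 0) (hc : c ≠ 0)
    (hd : d ≠ 0) (hκ : κ ≠ 0) (hz : z ≠ 0) :
    theta p (a / z) * theta p (a * d * κ) * theta p (a * c * κ) * theta p (a * c * d * z) -
      theta p (a * c * d * κ * z) * theta p (a * c) * theta p (a * d) * theta p (a * κ / z) =
    -(a / z) * (theta p (a * c * d * κ * a) * theta p (c * z) * theta p (d * z) * theta p κ) := by
  have h := theta_addition' hp hp0 (s := d * κ * z) (P := a * d * κ) (M := a * c * d * κ * z)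
    (N := d * z) (by positivity) (by positivity) (by positivity) (by positivity)
  have e1 : d * κ * z / (a * d * κ) = z / a := by field_simp
  have e2 : d * z * (a * c * d * κ * z) / (d * κ * z) = a * c * d * z := by field_simp
  have e3 : d * z / (a * c * d * κ * z) = 1 / (a * c * κ) := by field_simp
  have e4 : d * κ * z / (a * c * d * κ * z) = 1 / (a * c) := by field_simp
  have e5 : d * z * (a * d * κ) / (d * κ * z) = a * d := by field_simp
  have e6 : d * z / (a * d * κ) = z / (a * κ) := by field_simp
  have e7 : a * d * κ * (a * c * d * κ * z) / (d * κ * z) = a * c * d * κ * a := by field_simp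
  have e8 : a * d * κ / (a * c * d * κ * z) = 1 / (c * z) := by field_simp
  have e9 : d * κ * z / (d * z) = κ := by field_simp
  rw [e1, e2, e3, e4, e5, e6, e7, e8, e9, theta_div_swap hp one_ne_zero (by positivity),
    theta_div_swap hp one_ne_zero (mul_ne_zero ha hc), theta_div_swap hp hz ha,
    theta_div_swap hp hz (mul_ne_zero ha hκ),
    theta_div_swap hp one_ne_zero (mul_ne_zero hc hz), div_one, div_one, div_one] at h
  generalize theta p (a * d * κ) = T₁, theta p (a / z) = T₂, theta p (a * c * d * z) = T₃,
    theta p (a * c * κ) = T₄, theta p (a * c * d * κ * z) = T₅, theta p (a * c) = T₆,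
    theta p (a * d) = T₇, theta p (a * κ / z) = T₈, theta p (a * c * d * κ * a) = T₉,
    theta p (c * z) = T₁₀, theta p (d * z) = T₁₁, theta p κ = T₁₂ at h ⊢
  field_simp at h ⊢
  linear_combination h

/-- The theta function identity behind the `q`-difference equation of the kernel. -/
lemma theta_difference_identity (hp : ‖p‖ < 1) (hp0 : p ≠ 0) {a b c d e A z : ℂ} (ha : a ≠ 0)
    (hb : b ≠ 0) (hc : c ≠ 0) (hd : d ≠ 0) (he : e ≠ 0) (hz : z ≠ 0) (hA : A = a * b * c * d * e)
    (hbe : theta p (b * e) ≠ 0) :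
    theta p (z ^ 2) * (theta p (a * z) * theta p (a / z) *
        (theta p (A / b) * theta p (A / c) * theta p (A / d) * theta p (A / e)) -
      theta p (A * z) * theta p (A / z) *
        (theta p (a * b) * theta p (a * c) * theta p (a * d) * theta p (a * e))) =
    -(a * theta p (a * A)) *
      (z⁻¹ * (theta p (a * z) * theta p (b * z) * theta p (c * z) * theta p (d * z) *
        theta p (e * z)) * theta p (A / z) -
      z ^ 3 * (theta p (a / z) * theta p (b / z) * theta p (c / z) * theta p (d / z) *
        theta p (e / z)) * theta p (A * z)) := by
  have h1 := theta_expansion hp hp0 (α := a * c * d) (by positivity) hb he hz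
  have h2 := theta_expansion hp hp0 (α := a) ha hb he hz
  have h3 := theta_four_term hp hp0 ha hc hd (mul_ne_zero hb he) hz
  have h4 := theta_four_term hp hp0 ha hc hd (mul_ne_zero hb he) (inv_ne_zero hz)
  have f1 : A / b = a * c * d * e := by rw [hA]; field_simp
  have f2 : A / e = a * c * d * b := by rw [hA]; field_simp
  have f3 : A / c = a * d * (b * e) := by rw [hA]; field_simp
  have f4 : A / d = a * c * (b * e) := by rw [hA]; field_simp
  have f5 : a * c * d * (b * e) = A := by rw [hA]; ring
  rw [f5] at h1 h3 h4
  simp only [div_inv_eq_mul, ← div_eq_mul_inv] at h4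
  rw [f1, f2, f3, f4, mul_comm a A]
  have hzz : z⁻¹ = 1 / z := by simp
  refine mul_left_cancel₀ hbe ?_
  generalize theta p (b * e) = T₁, theta p (z ^ 2) = T₂, theta p (a * c * d * b) = T₃,
    theta p (a * c * d * e) = T₄, theta p (b * z) = T₅, theta p (e * z) = T₆,
    theta p (a * c * d * z) = T₇, theta p (A / z) = T₈, theta p (b / z) = T₉,
    theta p (e / z) = T₁₀, theta p (a * c * d / z) = T₁₁, theta p (A * z) = T₁₂,
    theta p (a * b) = T₁₃, theta p (a * e) = T₁₄, theta p (a * z) = T₁₅,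
    theta p (a * (b * e) / z) = T₁₆, theta p (a / z) = T₁₇, theta p (a * (b * e) * z) = T₁₈,
    theta p (a * d * (b * e)) = T₁₉, theta p (a * c * (b * e)) = T₂₀, theta p (a * c) = T₂₁,
    theta p (a * d) = T₂₂, theta p (A * a) = T₂₃, theta p (c * z) = T₂₄,
    theta p (d * z) = T₂₅, theta p (c / z) = T₂₆, theta p (d / z) = T₂₇ at *
  have hz' : z⁻¹ * z = 1 := inv_mul_cancel₀ hz
  linear_combination T₁₅ * T₁₇ * T₁₉ * T₂₀ * h1 - T₁₂ * T₈ * T₂₁ * T₂₂ * h2 +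
    T₅ * T₆ * T₁₅ * T₈ * h3 - z ^ 2 * T₉ * T₁₀ * T₁₇ * T₁₂ * h4

end Theta

/-! ### Holomorphic families of continuous functions -/

/-- A jointly continuous family of functions on a compact space that depends holomorphically on a
parameter is holomorphic as a map into the Banach space of continuous functions. -/
lemma exists_differentiableOn_continuousMap {X : Type*} [TopologicalSpace X] [CompactSpace X]
    {U : Set ℂ} (hU : IsOpen U) {g : ℂ → X → ℂ}
    (hc : ContinuousOn (fun x : ℂ × X => g x.1 x.2) (U ×ˢ univ))
    (hd : ∀ x, DifferentiableOn ℂ (fun z => g z x) U) :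
    ∃ G : ℂ → C(X, ℂ), DifferentiableOn ℂ G U ∧ ∀ z ∈ U, ∀ x, G z x = g z x := by
  classical
  let g' : C(U × X, ℂ) := ⟨fun x => g x.1 x.2, by
    have : ContinuousOn (fun x : ℂ × X => g x.1 x.2) (U ×ˢ univ) := hc
    exact this.comp_continuous (f := fun x : U × X => ((x.1 : ℂ), x.2)) (by fun_prop)
      fun x => ⟨x.1.2, mem_univ _⟩⟩
  set G : ℂ → C(X, ℂ) := fun z => if h : z ∈ U then g'.curry ⟨z, h⟩ else 0 with hG
  have hGU : ∀ z ∈ U, ∀ x, G z x = g z x := fun z hz x => by simp [hG, hz, g']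
  have hGc : ContinuousOn G U := by
    rw [continuousOn_iff_continuous_domRestrict]
    convert g'.curry.continuous using 1
    ext z x
    simp [hG, z.2]
  refine ⟨G, fun z₀ hz₀ => ?_, hGU⟩
  obtain ⟨R, hR, hRU⟩ := Metric.nhds_basis_closedBall.mem_iff.1 (hU.mem_nhds hz₀)
  lift R to NNReal using hR.le
  have hint : CircleIntegrable G z₀ R :=
    (hGc.mono (Metric.sphere_subset_closedBall.trans hRU)).circleIntegrable hR.le
  have hps := (hasFPowerSeriesOn_cauchy_integral hint hR).differentiableOn
  have hmem : Metric.eball z₀ (R : ENNReal) ∈ 𝓝 z₀ := Metric.eball_mem_nhds _ (by simpa using hR)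
  refine ((hps.differentiableAt hmem).congr_of_eventuallyEq ?_).differentiableWithinAt
  filter_upwards [Metric.ball_mem_nhds z₀ hR] with z hz
  ext x
  have hzU : z ∈ U := hRU (Metric.ball_subset_closedBall hz)
  have h1 : ((2 * Real.pi * Complex.I : ℂ)⁻¹ • ∮ w in C(z₀, R), (w - z)⁻¹ • G w) x =
      (2 * Real.pi * Complex.I : ℂ)⁻¹ • ∮ w in C(z₀, R), (w - z)⁻¹ • G w x := by
    rw [ContinuousMap.smul_apply]
    congr 1
    have hci : CircleIntegrable (fun w => (w - z)⁻¹ • G w) z₀ R := by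
      refine ContinuousOn.circleIntegrable hR.le (ContinuousOn.fun_smul ?_
        (hGc.mono (Metric.sphere_subset_closedBall.trans hRU)))
      refine ContinuousOn.inv₀ (by fun_prop) fun w hw h => ?_
      rw [sub_eq_zero.1 h, Metric.mem_sphere] at hw
      rw [Metric.mem_ball] at hz
      exact hz.ne hw
    have := (ContinuousMap.evalCLM ℂ x : C(X, ℂ) →L[ℂ] ℂ).intervalIntegral_comp_comm hci.out
    simp only [circleIntegral]
    rw [← ContinuousMap.evalCLM_apply ℂ x, ← this]
    simp
  rw [h1, hGU z hzU]
  have hdz : DifferentiableOn ℂ (fun w => G w x) (Metric.closedBall z₀ R) :=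
    ((hd x).mono hRU).congr fun w hw => hGU w (hRU hw) x
  rw [Complex.two_pi_I_inv_smul_circleIntegral_sub_inv_smul_of_differentiable_on_off_countable
    countable_empty hz hdz.continuousOn
    fun w hw => hdz.differentiableAt (Metric.closedBall_mem_nhds_of_mem hw.1), hGU z hzU]

/-- The difference quotient of a holomorphic function is jointly continuous. -/
lemma continuousOn_dslope_prod {f : ℂ → ℂ} {U : Set ℂ} (hU : IsOpen U)
    (hf : DifferentiableOn ℂ f U) :
    ContinuousOn (fun x : ℂ × ℂ => dslope f x.1 x.2) (U ×ˢ U) := by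
  rintro ⟨a, b⟩ ⟨ha, hb⟩
  refine ContinuousAt.continuousWithinAt ?_
  simp only at ha hb
  have hfa := hf.analyticAt (hU.mem_nhds ha)
  by_cases hab : a = b
  · subst hab
    have h1 := hfa.hasStrictDerivAt
    have h2 : ContinuousAt (deriv f) a := hfa.deriv.continuousAt
    rw [ContinuousAt, dslope_same, Metric.tendsto_nhds]
    intro ε hε
    have h3 := h1.isLittleO.def (half_pos hε)
    have h4 : ∀ᶠ x : ℂ × ℂ in 𝓝 (a, a), dist (deriv f x.1) (deriv f a) < ε :=
      (ContinuousAt.comp (g := deriv f) (f := Prod.fst) (x := ((a, a) : ℂ × ℂ)) h2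
        continuousAt_fst).eventually (Metric.ball_mem_nhds _ hε)
    filter_upwards [h3, h4] with x hx hx'
    by_cases hxx : x.2 = x.1
    · rw [hxx, dslope_same]; exact hx'
    · have hne : x.1 - x.2 ≠ 0 := sub_ne_zero.2 (Ne.symm hxx)
      have : dslope f x.1 x.2 - deriv f a =
          (f x.1 - f x.2 - (x.1 - x.2) * deriv f a) / (x.1 - x.2) := by
        have hne' : x.2 - x.1 ≠ 0 := sub_ne_zero.2 hxx
        rw [dslope_of_ne _ hxx, slope_def_field]
        field_simp
        ring
      rw [dist_eq_norm, this, norm_div, div_lt_iff₀ (norm_pos_iff.2 hne)]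
      have h5 : ‖f x.1 - f x.2 - (x.1 - x.2) * deriv f a‖ ≤ ε / 2 * ‖x.1 - x.2‖ := by
        simpa using hx
      have := norm_pos_iff.2 hne
      nlinarith
  · have hfb := (hf.differentiableAt (hU.mem_nhds hb)).continuousAt
    have h1 : ContinuousAt (fun x : ℂ × ℂ => (f x.2 - f x.1) / (x.2 - x.1)) (a, b) :=
      ((ContinuousAt.comp (x := ((a, b) : ℂ × ℂ)) hfb continuousAt_snd).sub
        (ContinuousAt.comp (x := ((a, b) : ℂ × ℂ)) hfa.continuousAt continuousAt_fst)).div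
        (by fun_prop) (sub_ne_zero.2 (Ne.symm hab))
    refine h1.congr ?_
    have : {x : ℂ × ℂ | x.2 ≠ x.1} ∈ 𝓝 ((a, b) : ℂ × ℂ) :=
      (isOpen_ne_fun continuous_snd continuous_fst).mem_nhds (Ne.symm hab)
    filter_upwards [this] with x hx
    rw [dslope_of_ne _ hx, slope_def_field]

lemma dslope_comm (f : ℂ → ℂ) (a b : ℂ) : dslope f a b = dslope f b a := by
  by_cases h : b = a
  · rw [h]
  · rw [dslope_of_ne _ h, dslope_of_ne _ (Ne.symm h), slope_comm]

/-! ### Cycles and winding numbers -/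

/-- A one-cycle, viewed as the functional `f ↦ ∫ f(z) dz`: a functional on functions that are
continuous on a compact set `K`, linear and bounded for the supremum norm on `K`. That the cycle
is closed is expressed by the vanishing of the integrals of the exact forms `(z - w)⁻² dz`,
`w ∉ K`, which is all that the theory of winding numbers uses. -/
structure IsCycle (K : Set ℂ) (Λ : (ℂ → ℂ) → ℂ) : Prop where
  isCompact : IsCompact K
  map_add : ∀ f g, ContinuousOn f K → ContinuousOn g K → Λ (fun z => f z + g z) = Λ f + Λ g
  map_smul : ∀ (c : ℂ) f, ContinuousOn f K → Λ (fun z => c * f z) = c * Λ f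
  bound : ∃ C, ∀ f M, ContinuousOn f K → (∀ z ∈ K, ‖f z‖ ≤ M) → ‖Λ f‖ ≤ C * M
  closed : ∀ w ∉ K, Λ (fun z => ((z - w) ^ 2)⁻¹) = 0

/-- The winding number `(2πi)⁻¹ ∫ dz / (z - w)` of a cycle. -/
noncomputable def wind (Λ : (ℂ → ℂ) → ℂ) (w : ℂ) : ℂ :=
  (2 * Real.pi * Complex.I)⁻¹ * Λ fun z => (z - w)⁻¹

lemma two_pi_I_mul_wind (Λ : (ℂ → ℂ) → ℂ) (w : ℂ) :
    2 * Real.pi * Complex.I * wind Λ w = Λ fun z => (z - w)⁻¹ := by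
  rw [wind, mul_inv_cancel_left₀ Complex.two_pi_I_ne_zero]

namespace IsCycle

variable {K L : Set ℂ} {Λ Λ' : (ℂ → ℂ) → ℂ}

lemma map_sub (h : IsCycle K Λ) {f g : ℂ → ℂ} (hf : ContinuousOn f K) (hg : ContinuousOn g K) :
    Λ (fun z => f z - g z) = Λ f - Λ g := by
  have h1 := h.map_add f (fun z => -1 * g z) hf (by fun_prop)
  rw [h.map_smul _ _ hg] at h1
  simpa [sub_eq_add_neg] using h1

lemma congr (h : IsCycle K Λ) {f g : ℂ → ℂ} (hf : ContinuousOn f K) (hfg : EqOn f g K) :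
    Λ f = Λ g := by
  have hg : ContinuousOn g K := hf.congr hfg.symm
  obtain ⟨C, hC⟩ := h.bound
  have := hC (fun z => f z - g z) 0 (hf.sub hg) fun z hz => by simp [hfg hz]
  rw [h.map_sub hf hg, mul_zero, norm_le_zero_iff, sub_eq_zero] at this
  exact this

lemma exists_nonneg_bound (h : IsCycle K Λ) :
    ∃ C, 0 ≤ C ∧ ∀ f M, 0 ≤ M → ContinuousOn f K → (∀ z ∈ K, ‖f z‖ ≤ M) → ‖Λ f‖ ≤ C * M := by
  obtain ⟨C, hC⟩ := h.bound
  refine ⟨max C 0, le_max_right _ _, fun f M hM hf hfM => (hC f M hf hfM).trans ?_⟩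
  gcongr
  exact le_max_left _ _

lemma continuousOn_inv_sub {w : ℂ} (hw : w ∉ K) : ContinuousOn (fun z => (z - w)⁻¹) K :=
  ContinuousOn.inv₀ (by fun_prop) fun z hz h => hw (by rwa [← sub_eq_zero.1 h])

lemma continuousOn_inv_sub_sq {w : ℂ} (hw : w ∉ K) : ContinuousOn (fun z => ((z - w) ^ 2)⁻¹) K :=
  ContinuousOn.inv₀ (by fun_prop) fun z hz h =>
    hw (by rwa [← sub_eq_zero.1 (pow_eq_zero_iff two_ne_zero |>.1 h)])

/-- `Λ + c Λ'` on the union of the supports. -/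
lemma add_smul (h : IsCycle K Λ) (h' : IsCycle L Λ') (c : ℂ) :
    IsCycle (K ∪ L) fun f => Λ f + c * Λ' f where
  isCompact := h.isCompact.union h'.isCompact
  map_add f g hf hg := by
    rw [h.map_add f g (hf.mono subset_union_left) (hg.mono subset_union_left),
      h'.map_add f g (hf.mono subset_union_right) (hg.mono subset_union_right)]
    ring
  map_smul a f hf := by
    rw [h.map_smul a f (hf.mono subset_union_left), h'.map_smul a f (hf.mono subset_union_right)]
    ring
  bound := by
    obtain ⟨C, hC⟩ := h.bound
    obtain ⟨D, hD⟩ := h'.bound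
    refine ⟨C + ‖c‖ * D, fun f M hf hM => ?_⟩
    have h1 := hC f M (hf.mono subset_union_left) fun z hz => hM z (Or.inl hz)
    have h2 := hD f M (hf.mono subset_union_right) fun z hz => hM z (Or.inr hz)
    calc ‖Λ f + c * Λ' f‖ ≤ ‖Λ f‖ + ‖c‖ * ‖Λ' f‖ := (norm_add_le _ _).trans (by rw [norm_mul])
      _ ≤ C * M + ‖c‖ * (D * M) := by gcongr
      _ = (C + ‖c‖ * D) * M := by ring
  closed w hw := by
    rw [h.closed w fun h => hw (Or.inl h), h'.closed w fun h => hw (Or.inr h)]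
    ring

lemma wind_add_smul (c w : ℂ) : wind (fun f => Λ f + c * Λ' f) w = wind Λ w + c * wind Λ' w := by
  simp only [wind]; ring

/-- The extension by zero of a continuous function on `K`. -/
noncomputable def extend (K : Set ℂ) (φ : C(K, ℂ)) : ℂ → ℂ :=
  open Classical in fun z => if h : z ∈ K then φ ⟨z, h⟩ else 0

lemma extend_apply (φ : C(K, ℂ)) (z : K) : extend K φ z = φ z := by simp [extend]

lemma continuousOn_extend (φ : C(K, ℂ)) : ContinuousOn (extend K φ) K := by
  rw [continuousOn_iff_continuous_domRestrict]
  convert φ.continuous using 1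
  ext z
  simp [extend]

/-- A cycle as a continuous linear functional on the Banach space `C(K, ℂ)`. -/
lemma exists_clm (h : IsCycle K Λ) :
    ∃ T : C(K, ℂ) →L[ℂ] ℂ, ∀ (f : ℂ → ℂ) (φ : C(K, ℂ)), (∀ z : K, φ z = f z) → T φ = Λ f := by
  have : CompactSpace K := isCompact_iff_compactSpace.1 h.isCompact
  obtain ⟨C, hC0, hC⟩ := h.exists_nonneg_bound
  have he (φ : C(K, ℂ)) (f : ℂ → ℂ) (hf : ∀ z : K, φ z = f z) : Λ (extend K φ) = Λ f :=
    h.congr (continuousOn_extend φ) fun z hz => by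
      rw [← hf ⟨z, hz⟩, ← extend_apply φ ⟨z, hz⟩]
  let T : C(K, ℂ) →ₗ[ℂ] ℂ :=
    { toFun := fun φ => Λ (extend K φ)
      map_add' := fun φ ψ => by
        rw [← h.map_add _ _ (continuousOn_extend φ) (continuousOn_extend ψ)]
        exact he _ _ fun z => by simp [extend_apply]
      map_smul' := fun c φ => by
        rw [RingHom.id_apply, smul_eq_mul, ← h.map_smul _ _ (continuousOn_extend φ)]
        exact he _ _ fun z => by simp [extend_apply] }
  refine ⟨T.mkContinuous C fun φ => hC _ _ (norm_nonneg _) (continuousOn_extend φ)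
    fun z hz => ?_, fun f φ hf => he φ f hf⟩
  rw [extend_apply φ ⟨z, hz⟩]
  exact φ.norm_coe_le_norm _

/-- Integration over a cycle of a family of functions that depends holomorphically on a parameter
`w` may be interchanged with the derivative in `w`. -/
lemma exists_hasDerivAt (h : IsCycle K Λ) {U : Set ℂ} (hU : IsOpen U) {g : ℂ → ℂ → ℂ}
    (hc : ContinuousOn (fun x : ℂ × ℂ => g x.1 x.2) (U ×ˢ K))
    (hd : ∀ x ∈ K, DifferentiableOn ℂ (fun z => g z x) U) {w : ℂ} (hw : w ∈ U) :
    ContinuousOn (fun x => deriv (fun z => g z x) w) K ∧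
      HasDerivAt (fun z => Λ (g z)) (Λ fun x => deriv (fun z => g z x) w) w := by
  have : CompactSpace K := isCompact_iff_compactSpace.1 h.isCompact
  obtain ⟨T, hT⟩ := h.exists_clm
  obtain ⟨G, hG, hGg⟩ := exists_differentiableOn_continuousMap (X := K) hU
    (g := fun z x => g z x) (by
      refine hc.comp (f := fun x : ℂ × K => (x.1, (x.2 : ℂ))) (by fun_prop) ?_
      rintro ⟨z, x⟩ ⟨hz, -⟩
      exact ⟨hz, x.2⟩) fun x => hd x x.2
  have hGd := (hG.differentiableAt (hU.mem_nhds hw)).hasDerivAt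
  have hev (x : K) : deriv G w x = deriv (fun z => g z x) w := by
    have h1 := ((ContinuousMap.evalCLM ℂ x : C(K, ℂ) →L[ℂ] ℂ).hasFDerivAt.comp_hasDerivAt w hGd)
    have h2 : HasDerivAt (fun z => g z x) (deriv G w x) w := by
      refine HasDerivAt.congr_of_eventuallyEq h1 ?_
      filter_upwards [hU.mem_nhds hw] with z hz
      simp [hGg z hz x]
    exact h2.deriv.symm
  constructor
  · rw [continuousOn_iff_continuous_domRestrict]
    convert (deriv G w).continuous using 1
    ext x
    exact (hev x).symm
  · rw [← hT (fun x => deriv (fun z => g z x) w) (deriv G w) hev]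
    refine (T.hasFDerivAt.comp_hasDerivAt w hGd).congr_of_eventuallyEq ?_
    filter_upwards [hU.mem_nhds hw] with z hz
    exact (hT (g z) (G z) (hGg z hz)).symm

lemma hasDerivAt_wind (h : IsCycle K Λ) {w : ℂ} (hw : w ∉ K) : HasDerivAt (wind Λ) 0 w := by
  have hne : ∀ z ∈ Kᶜ, ∀ x ∈ K, x - z ≠ 0 := fun z hz x hx h0 => hz (by rwa [← sub_eq_zero.1 h0])
  have h1 := (h.exists_hasDerivAt h.isCompact.isClosed.isOpen_compl (g := fun z x => (x - z)⁻¹)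
    (by
      refine ContinuousOn.inv₀ (by fun_prop) ?_
      rintro ⟨z, x⟩ ⟨hz, hx⟩
      exact hne z hz x hx)
    (fun x hx => DifferentiableOn.inv (by fun_prop) fun z hz => hne z hz x hx) (w := w) hw)
  have h2 : ∀ x ∈ K, deriv (fun z => (x - z)⁻¹) w = ((x - w) ^ 2)⁻¹ := fun x hx => by
    have := (((hasDerivAt_id w).const_sub x).fun_inv (hne w hw x hx)).deriv
    rw [id] at this
    simpa using this
  rw [h.congr h1.1 h2, h.closed w hw] at h1
  have := h1.2.const_mul ((2 * Real.pi * Complex.I : ℂ)⁻¹)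
  rw [mul_zero] at this
  exact this

lemma wind_eq_of_isPreconnected (h : IsCycle K Λ) {S : Set ℂ} (hS : IsOpen S)
    (hS' : IsPreconnected S) (hSK : Disjoint S K) {a b : ℂ} (ha : a ∈ S) (hb : b ∈ S) :
    wind Λ a = wind Λ b :=
  hS.is_const_of_deriv_eq_zero hS'
    (fun _ hz =>
      (h.hasDerivAt_wind (disjoint_left.1 hSK hz)).differentiableAt.differentiableWithinAt)
    (fun _ hz => (h.hasDerivAt_wind (disjoint_left.1 hSK hz)).deriv) ha hb

lemma eventually_wind_eq (h : IsCycle K Λ) {w : ℂ} (hw : w ∉ K) :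
    ∀ᶠ z in 𝓝 w, z ∉ K ∧ wind Λ z = wind Λ w := by
  obtain ⟨r, hr, hrK⟩ := Metric.isOpen_iff.1 h.isCompact.isClosed.isOpen_compl w hw
  filter_upwards [Metric.ball_mem_nhds w hr] with z hz
  exact ⟨hrK hz, h.wind_eq_of_isPreconnected Metric.isOpen_ball
    (convex_ball w r).isPreconnected (disjoint_left.2 hrK) hz (Metric.mem_ball_self hr)⟩

/-- The winding number vanishes outside every disc that contains the cycle. -/
lemma wind_eq_zero_of_lt_norm (h : IsCycle K Λ) {R : ℝ} (hK : ∀ z ∈ K, ‖z‖ ≤ R) {w : ℂ}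
    (hR : 0 ≤ R) (hw : R < ‖w‖) : wind Λ w = 0 := by
  -- `S` is a half-plane containing `w` that misses the disc: move `w` along its ray to infinity.
  set S : Set ℂ := {z | R * ‖w‖ < (z * star w).re} with hS
  have hSo : IsOpen S := isOpen_lt continuous_const (by fun_prop)
  have hSc : Convex ℝ S := by
    have hl : IsLinearMap ℝ fun z : ℂ => (z * star w).re :=
      ⟨fun x y => by simp [add_mul], fun c x => by simp; ring⟩
    exact convex_halfSpace_gt hl _
  have hw0 : 0 < ‖w‖ := hR.trans_lt hw
  have hSK : Disjoint S K := by
    refine disjoint_left.2 fun z hz hzK => ?_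
    have h1 : (z * star w).re ≤ ‖z‖ * ‖w‖ := (Complex.re_le_norm _).trans (by simp)
    have h2 : ‖z‖ * ‖w‖ ≤ R * ‖w‖ := by gcongr; exact hK z hzK
    exact absurd (hz : R * ‖w‖ < _) (not_lt.2 (h1.trans h2))
  have hmem (s : ℝ) (hs : 1 ≤ s) : (s : ℂ) * w ∈ S := by
    have : ((s : ℂ) * w * star w).re = s * (‖w‖ * ‖w‖) := by
      rw [mul_assoc]
      simp [Complex.mul_conj, Complex.normSq_eq_norm_sq, sq, ← Complex.ofReal_mul]
    rw [hS, mem_ofPred_eq, this]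
    nlinarith [mul_pos hw0 hw0]
  obtain ⟨C, hC0, hC⟩ := h.exists_nonneg_bound
  have hb (s : ℝ) (hs : 1 ≤ s) (hs' : R < s * ‖w‖) :
      ‖(2 * Real.pi * Complex.I) * wind Λ w‖ ≤ C * (s * ‖w‖ - R)⁻¹ := by
    have e := h.wind_eq_of_isPreconnected hSo hSc.isPreconnected hSK (hmem 1 le_rfl) (hmem s hs)
    rw [Complex.ofReal_one, one_mul] at e
    rw [e, two_pi_I_mul_wind]
    refine hC _ _ (inv_nonneg.2 (sub_nonneg.2 hs'.le))
      (continuousOn_inv_sub (disjoint_left.1 hSK (hmem s hs))) fun z hz => ?_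
    rw [norm_inv]
    refine inv_anti₀ (sub_pos.2 hs') ?_
    have h1 := norm_sub_norm_le ((s : ℂ) * w) z
    rw [norm_sub_rev, norm_mul, Complex.norm_real, Real.norm_of_nonneg (by linarith)] at h1
    have := hK z hz
    linarith
  have hlim : Tendsto (fun s : ℝ => C * (s * ‖w‖ - R)⁻¹) atTop (𝓝 0) := by
    have h1 : Tendsto (fun s : ℝ => s * ‖w‖ - R) atTop atTop :=
      tendsto_atTop_add_const_right _ _ (tendsto_id.atTop_mul_const hw0)
    simpa using h1.inv_tendsto_atTop.const_mul C
  have hle : ‖(2 * Real.pi * Complex.I) * wind Λ w‖ ≤ 0 := by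
    refine ge_of_tendsto hlim ?_
    filter_upwards [eventually_ge_atTop 1] with s hs
    exact hb s hs (by nlinarith)
  rw [norm_le_zero_iff] at hle
  exact (mul_eq_zero.1 hle).resolve_left Complex.two_pi_I_ne_zero

/-- Cauchy's theorem in its homological form, by Dixon's argument: the integrals of the
difference quotients of `f` extend to an entire function that vanishes at infinity. -/
lemma dslope_eq_zero (h : IsCycle K Λ) {U : Set ℂ} (hU : IsOpen U) (hKU : K ⊆ U) {f : ℂ → ℂ}
    (hf : DifferentiableOn ℂ f U) (hwind : ∀ w ∉ U, wind Λ w = 0) {z : ℂ} (hz : z ∈ U) :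
    Λ (dslope f z) = 0 := by
  classical
  have hcd : ContinuousOn (fun x : ℂ × ℂ => dslope f x.1 x.2) (U ×ˢ K) :=
    (continuousOn_dslope_prod hU hf).mono (prod_mono_right hKU)
  have hdU : ∀ z ∈ U, DifferentiableAt ℂ (fun z => Λ (dslope f z)) z := fun z hz =>
    (h.exists_hasDerivAt hU hcd (fun x hx => by
      simp only [fun z => dslope_comm f z x]
      exact (Complex.differentiableOn_dslope (hU.mem_nhds (hKU hx))).2 hf) hz).2.differentiableAt
  have hfK : ContinuousOn f K := hf.continuousOn.mono hKU
  have hne : ∀ z ∈ Kᶜ, ∀ x ∈ K, x - z ≠ 0 := fun z hz x hx h0 => hz (by rwa [← sub_eq_zero.1 h0])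
  have hdK : ∀ z ∉ K, DifferentiableAt ℂ (fun z => Λ fun x => f x * (x - z)⁻¹) z := fun z hz =>
    (h.exists_hasDerivAt h.isCompact.isClosed.isOpen_compl
      (g := fun z x => f x * (x - z)⁻¹) (by
        refine ContinuousOn.mul (hfK.comp continuousOn_snd fun x hx => hx.2)
          (ContinuousOn.inv₀ (by fun_prop) ?_)
        rintro ⟨z, x⟩ ⟨hz, hx⟩
        exact hne z hz x hx)
      (fun x hx => DifferentiableOn.const_mul
        (DifferentiableOn.inv (by fun_prop) fun z hz => hne z hz x hx) _) hz).2.differentiableAt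
  -- The two expressions agree where both are defined.
  have hagree : ∀ z ∈ U, z ∉ K → wind Λ z = 0 →
      Λ (dslope f z) = Λ fun x => f x * (x - z)⁻¹ := by
    intro z hzU hzK hz0
    have h1 : Λ (dslope f z) = Λ fun x => f x * (x - z)⁻¹ - f z * (x - z)⁻¹ := by
      refine h.congr (hcd.comp (f := fun x => (z, x)) (by fun_prop) fun x hx => ⟨hzU, hx⟩)
        fun x hx => ?_
      have hxz : x ≠ z := fun e => hzK (e ▸ hx)
      rw [dslope_of_ne _ hxz, slope_def_field]
      ring
    rw [h1, h.map_sub (hfK.fun_mul (continuousOn_inv_sub hzK))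
      ((continuousOn_inv_sub hzK).const_mul _), h.map_smul _ _ (continuousOn_inv_sub hzK),
      ← two_pi_I_mul_wind Λ z, hz0]
    ring
  set H : ℂ → ℂ := fun z => if z ∈ U then Λ (dslope f z) else Λ fun x => f x * (x - z)⁻¹ with hH
  have hHK : ∀ z ∉ K, wind Λ z = 0 → H z = Λ fun x => f x * (x - z)⁻¹ := by
    intro z hzK hz0
    by_cases hzU : z ∈ U
    · simp [hH, hzU, hagree z hzU hzK hz0]
    · simp [hH, hzU]
  have hHd : Differentiable ℂ H := by
    intro z
    by_cases hzU : z ∈ U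
    · refine (hdU z hzU).congr_of_eventuallyEq ?_
      filter_upwards [hU.mem_nhds hzU] with y hy
      simp [hH, hy]
    · have hzK : z ∉ K := fun hK => hzU (hKU hK)
      refine (hdK z hzK).congr_of_eventuallyEq ?_
      filter_upwards [h.eventually_wind_eq hzK] with y hy
      exact hHK y hy.1 (hy.2.trans (hwind z hzU))
  obtain ⟨R, hR⟩ := h.isCompact.isBounded.exists_norm_le
  obtain ⟨M, hM⟩ := h.isCompact.exists_bound_of_continuousOn hfK
  obtain ⟨C, hC0, hC⟩ := h.exists_nonneg_bound
  have hlim : Tendsto H (cocompact ℂ) (𝓝 0) := by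
    have hlim' : Tendsto (fun z : ℂ => C * (max M 0 * (‖z‖ - max R 0)⁻¹)) (cocompact ℂ) (𝓝 0) := by
      have h1 : Tendsto (fun z : ℂ => ‖z‖ - max R 0) (cocompact ℂ) atTop :=
        tendsto_atTop_add_const_right _ _ (tendsto_norm_cocompact_atTop (E := ℂ))
      simpa using (h1.inv_tendsto_atTop.const_mul (max M 0)).const_mul C
    refine squeeze_zero_norm' ?_ hlim'
    filter_upwards [(tendsto_norm_cocompact_atTop (E := ℂ)).eventually_gt_atTop (max R 0)] with z hz
    have hzK : z ∉ K := fun hK => absurd hz (not_lt.2 ((hR z hK).trans (le_max_left _ _)))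
    rw [hHK z hzK (h.wind_eq_zero_of_lt_norm (fun x hx => (hR x hx).trans (le_max_left _ _))
      (le_max_right R 0) hz)]
    have hpos := sub_pos.2 hz
    refine hC _ _ (by positivity) (hfK.mul (continuousOn_inv_sub hzK)) fun x hx => ?_
    rw [norm_mul, norm_inv]
    have h1 := norm_sub_norm_le z x
    have h2 := hR x hx
    rw [norm_sub_rev] at h1
    gcongr
    · exact (hM x hx).trans (le_max_left _ _)
    · linarith [le_max_left R 0]
  have := hHd.apply_eq_of_tendsto_cocompact z hlim
  simpa [hH, hz] using this

/-- Cauchy's integral theorem for cycles. -/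
lemma eq_zero (h : IsCycle K Λ) {U : Set ℂ} (hU : IsOpen U) (hKU : K ⊆ U) {f : ℂ → ℂ}
    (hf : DifferentiableOn ℂ f U) (hwind : ∀ w ∉ U, wind Λ w = 0) : Λ f = 0 := by
  rcases K.eq_empty_or_nonempty with rfl | ⟨z, hz⟩
  · obtain ⟨C, hC⟩ := h.bound
    simpa using hC f 0 (continuousOn_empty _) (by simp)
  · have h1 := h.dslope_eq_zero hU hKU (f := fun w => (w - z) * f w) (by fun_prop) hwind (hKU hz)
    rw [← h1]
    refine h.congr (hf.continuousOn.mono hKU) fun w hw => ?_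
    by_cases hwz : w = z
    · subst hwz
      have h2 := ((hasDerivAt_id w).sub_const w).mul
        (hf.differentiableAt (hU.mem_nhds (hKU hz))).hasDerivAt
      have h3 : deriv (fun y => (y - w) * f y) w = _ := h2.deriv
      rw [dslope_same, h3]
      simp
    · have := sub_ne_zero.2 hwz
      rw [dslope_of_ne _ hwz, slope_def_field]
      field_simp
      simp

/-- Cauchy's integral formula for cycles. -/
lemma map_mul_inv_sub (h : IsCycle K Λ) {U : Set ℂ} (hU : IsOpen U) (hKU : K ⊆ U) {f : ℂ → ℂ}
    (hf : DifferentiableOn ℂ f U) (hwind : ∀ w ∉ U, wind Λ w = 0) {z : ℂ} (hz : z ∈ U)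
    (hzK : z ∉ K) :
    Λ (fun x => f x * (x - z)⁻¹) = 2 * Real.pi * Complex.I * wind Λ z * f z := by
  have h1 := h.dslope_eq_zero hU hKU hf hwind hz
  have hc := continuousOn_inv_sub hzK
  have hfK := hf.continuousOn.mono hKU
  rw [← h.congr (f := fun x => f x * (x - z)⁻¹ - f z * (x - z)⁻¹)
    ((hfK.mul hc).sub (hc.const_mul _)) (fun x hx => by
      have hxz : x ≠ z := fun e => hzK (e ▸ hx)
      rw [dslope_of_ne _ hxz, slope_def_field]
      ring), h.map_sub (hfK.fun_mul hc) (hc.const_mul _), h.map_smul _ _ hc,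
      ← two_pi_I_mul_wind Λ z,
    sub_eq_zero] at h1
  rw [h1]; ring

/-- Homologous cycles have the same integrals. -/
lemma eq_of_wind_eq (h : IsCycle K Λ) (h' : IsCycle L Λ') {U : Set ℂ} (hU : IsOpen U)
    (hKU : K ⊆ U) (hLU : L ⊆ U) {f : ℂ → ℂ} (hf : DifferentiableOn ℂ f U)
    (hwind : ∀ w ∉ U, wind Λ w = wind Λ' w) : Λ f = Λ' f := by
  have := (h.add_smul h' (-1)).eq_zero hU (union_subset hKU hLU) hf fun w hw => by
    rw [wind_add_smul, hwind w hw]; ring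
  linear_combination this

end IsCycle

/-! ### Circles and the construction of separating cycles -/

lemma isCycle_circle (c : ℂ) {R : ℝ} (hR : 0 < R) :
    IsCycle (Metric.sphere c R) fun f => ∮ z in C(c, R), f z where
  isCompact := isCompact_sphere c R
  map_add f g hf hg := circleIntegral.integral_add (hf.circleIntegrable hR.le)
    (hg.circleIntegrable hR.le)
  map_smul a f hf := circleIntegral.integral_const_mul a f c R
  bound := ⟨2 * Real.pi * R, fun f M _ hM =>
    circleIntegral.norm_integral_le_of_norm_le_const hR.le hM⟩
  closed w hw := by
    have := circleIntegral.integral_sub_zpow_of_ne (n := -2) (by norm_num) c w R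
    simpa [zpow_neg] using this

lemma wind_circle_of_mem {c w : ℂ} {R : ℝ} (hw : w ∈ Metric.ball c R) :
    wind (fun f => ∮ z in C(c, R), f z) w = 1 := by
  rw [wind, circleIntegral.integral_sub_inv_of_mem_ball hw,
    inv_mul_cancel₀ Complex.two_pi_I_ne_zero]

lemma wind_circle_of_notMem {c w : ℂ} {R : ℝ} (hR : 0 < R) (hw : R < ‖w - c‖) :
    wind (fun f => ∮ z in C(c, R), f z) w = 0 := by
  have hne : ∀ z ∈ Metric.closedBall c R, z - w ≠ 0 := fun z hz h => by
    rw [sub_eq_zero.1 h, mem_closedBall_iff_norm] at hz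
    linarith
  have : (∮ z in C(c, R), (z - w)⁻¹) = 0 :=
    Complex.circleIntegral_eq_zero_of_differentiable_on_off_countable hR.le
      countable_empty (ContinuousOn.inv₀ (by fun_prop) hne) fun z hz =>
        DifferentiableAt.inv (by fun_prop) (hne z (Metric.ball_subset_closedBall hz.1))
  simp only [wind, this, mul_zero]

/-- The image of a cycle under `z ↦ z / c`. -/
lemma IsCycle.scale {K : Set ℂ} {Λ : (ℂ → ℂ) → ℂ} (h : IsCycle K Λ) {c : ℂ} (hc : c ≠ 0) :
    IsCycle ((fun z => z / c) '' K) fun f => Λ fun z => c⁻¹ * f (z / c) := by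
  have hcont {f : ℂ → ℂ} (hf : ContinuousOn f ((fun z => z / c) '' K)) :
      ContinuousOn (fun z => c⁻¹ * f (z / c)) K :=
    continuousOn_const.mul (hf.comp (by fun_prop) (mapsTo_image _ _))
  refine ⟨h.isCompact.image (by fun_prop), fun f g hf hg => ?_, fun a f hf => ?_, ?_, ?_⟩
  · rw [← h.map_add _ _ (hcont hf) (hcont hg)]
    simp only [mul_add]
  · rw [← h.map_smul _ _ (hcont hf)]
    simp only [mul_left_comm]
  · obtain ⟨C, hC⟩ := h.bound
    refine ⟨C * ‖c⁻¹‖, fun f M hf hM => ?_⟩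
    rw [mul_assoc]
    refine hC _ _ (hcont hf) fun z hz => ?_
    rw [norm_mul]
    gcongr
    exact hM _ (mem_image_of_mem _ hz)
  · intro w hw
    have hcw : c * w ∉ K := fun hK => hw ⟨c * w, hK, by field_simp⟩
    have e : (fun z => c⁻¹ * ((z / c - w) ^ 2)⁻¹) = fun z => c * ((z - c * w) ^ 2)⁻¹ := by
      funext z
      have : z / c - w = (z - c * w) / c := by field_simp
      rw [this, div_pow, inv_div]
      field_simp
    rw [e, h.map_smul _ _ (IsCycle.continuousOn_inv_sub_sq hcw), h.closed _ hcw, mul_zero]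

lemma wind_scale (Λ : (ℂ → ℂ) → ℂ) {c : ℂ} (hc : c ≠ 0) (w : ℂ) :
    wind (fun f => Λ fun z => c⁻¹ * f (z / c)) w = wind Λ (c * w) := by
  have e : (fun z => c⁻¹ * (z / c - w)⁻¹) = fun z => (z - c * w)⁻¹ := by
    funext z
    rw [← mul_inv]
    congr 1
    field_simp
  simp only [wind, e]

lemma exists_isolating_radius {T : Set ℂ} {w : ℂ} {r : ℝ} (hr : 0 < r)
    (hfin : {z ∈ T | ‖z - w‖ ≤ r}.Finite) : ∃ δ > 0, ∀ z ∈ T, z ≠ w → δ < ‖z - w‖ := by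
  have hF := hfin.sdiff (t := {w})
  obtain ⟨s, hs, hsF⟩ := Metric.isOpen_iff.1 hF.isClosed.isOpen_compl w (by simp)
  refine ⟨min (s / 2) r, by positivity, fun z hz hzw => ?_⟩
  by_contra! hle
  refine hsF (a := z) ?_ ⟨⟨hz, hle.trans (min_le_right _ _)⟩, hzw⟩
  rw [mem_ball_iff_norm]
  linarith [hle.trans (min_le_left _ _)]

/-- A set `A` that accumulates only at the origin and a set `B` that accumulates only at infinity
are separated by a cycle made of a small circle about the origin and circles about
finitely many points of `A`. -/
lemma exists_separating_cycle {A B : Set ℂ} (hA : ∀ ε > 0, {w ∈ A | ε ≤ ‖w‖}.Finite)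
    (hB : ∀ R : ℝ, {w ∈ B | ‖w‖ ≤ R}.Finite) (h0 : (0 : ℂ) ∉ B) (hAB : Disjoint A B) :
    ∃ K Λ, IsCycle K Λ ∧ ((0 : ℂ) ∉ K ∧ wind Λ 0 = 1) ∧ (∀ w ∈ A, w ∉ K ∧ wind Λ w = 1) ∧
      ∀ w ∈ B, w ∉ K ∧ wind Λ w = 0 := by
  classical
  obtain ⟨ε₁, hε₁, hBε⟩ : ∃ δ > 0, ∀ z ∈ B, z ≠ 0 → δ < ‖z - 0‖ :=
    exists_isolating_radius one_pos (by simpa using hB 1)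
  -- The radius of the small circle avoids the moduli of `A` and stays below those of `B`.
  obtain ⟨ε, ⟨hε2, hε1⟩, hεA⟩ : ∃ ε ∈ Ioo (ε₁ / 2) ε₁, ε ∉ norm '' {w ∈ A | ε₁ / 2 ≤ ‖w‖} :=
    (Ioo_infinite (half_lt_self hε₁)).exists_notMem_finite ((hA _ (half_pos hε₁)).image _)
  have hε0 : 0 < ε := (half_pos hε₁).trans hε2
  have hne : ∀ w ∈ A, ‖w‖ ≠ ε := fun w hw h => hεA ⟨w, ⟨hw, by rw [h]; exact hε2.le⟩, h⟩
  have hBlt : ∀ w ∈ B, ε < ‖w‖ := fun w hw => by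
    have := hBε w hw fun h => h0 (h ▸ hw)
    rw [sub_zero] at this
    exact hε1.trans this
  have hSfin := hA ε hε0
  have key : ∀ S : Finset ℂ, (∀ w ∈ S, w ∈ A ∧ ε < ‖w‖) → ∃ K Λ, IsCycle K Λ ∧
      ((0 : ℂ) ∉ K ∧ wind Λ 0 = 1) ∧
      (∀ w ∈ A, w ∉ K ∧ wind Λ w = if ‖w‖ < ε ∨ w ∈ S then 1 else 0) ∧
      ∀ w ∈ B, w ∉ K ∧ wind Λ w = 0 := by
    intro S
    induction S using Finset.induction_on with
    | empty =>
      intro _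
      refine ⟨_, _, isCycle_circle 0 hε0, ⟨by simp [hε0.ne], wind_circle_of_mem (by simpa)⟩,
        fun w hw => ⟨by simpa using hne w hw, ?_⟩, fun w hw => ⟨?_, ?_⟩⟩
      · rcases (hne w hw).lt_or_gt with h | h
        · rw [if_pos (Or.inl h), wind_circle_of_mem (by simpa)]
        · rw [if_neg (by simp [h.le]), wind_circle_of_notMem hε0 (by simpa)]
      · simpa using (hBlt w hw).ne'
      · exact wind_circle_of_notMem hε0 (by simpa using hBlt w hw)
    | insert v S hv ih =>
      intro hS
      obtain ⟨K, Λ, hΛ, h00, hΛA, hΛB⟩ := ih fun w hw => hS w (Finset.mem_insert_of_mem hw)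
      obtain ⟨hvA, hvε⟩ := hS v (Finset.mem_insert_self _ _)
      have hv0 : 0 < ‖v‖ := hε0.trans hvε
      obtain ⟨δ, hδ, hδT⟩ : ∃ δ > 0, ∀ z ∈ A ∪ B ∪ {0}, z ≠ v → δ < ‖z - v‖ := by
        refine exists_isolating_radius (half_pos hv0) (((hA _ (half_pos hv0)).union
          (hB (2 * ‖v‖))).subset ?_)
        rintro z ⟨hz, hzv⟩
        have h1 := norm_sub_norm_le z v
        have h2 := norm_sub_norm_le v z
        rw [norm_sub_rev] at h2
        rcases hz with (hz | hz) | hz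
        · exact Or.inl ⟨hz, by linarith⟩
        · exact Or.inr ⟨hz, by linarith⟩
        · rw [mem_singleton_iff.1 hz, zero_sub, norm_neg] at hzv
          linarith
      have hoff : ∀ z ∈ A ∪ B ∪ {0}, z ∉ Metric.sphere v δ := fun z hz hzs => by
        rw [mem_sphere_iff_norm] at hzs
        by_cases hzv : z = v
        · simp [hzv, hδ.ne] at hzs
        · exact (hδT z hz hzv).ne' hzs
      have hw0 : ∀ z ∈ A ∪ B ∪ {0}, z ≠ v →
          wind (fun f => ∮ x in C(v, δ), f x) z = 0 := fun z hz hzv =>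
        wind_circle_of_notMem hδ (hδT z hz hzv)
      refine ⟨_, _, hΛ.add_smul (isCycle_circle v hδ) 1, ⟨?_, ?_⟩, fun w hw => ⟨?_, ?_⟩,
        fun w hw => ⟨?_, ?_⟩⟩
      · exact fun h => h.elim h00.1 (hoff 0 (by simp))
      · rw [IsCycle.wind_add_smul, h00.2, hw0 0 (by simp) (norm_pos_iff.1 hv0).symm]
        ring
      · exact fun h => h.elim (hΛA w hw).1 (hoff w (by simp [hw]))
      · rw [IsCycle.wind_add_smul, (hΛA w hw).2]
        by_cases hwv : w = v
        · subst hwv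
          rw [if_neg (by simp [hv, hvε.le]), if_pos (by simp),
            wind_circle_of_mem (Metric.mem_ball_self hδ)]
          ring
        · rw [hw0 w (by simp [hw]) hwv]
          simp [hwv]
      · exact fun h => h.elim (hΛB w hw).1 (hoff w (by simp [hw]))
      · rw [IsCycle.wind_add_smul, (hΛB w hw).2, hw0 w (by simp [hw])
          fun e => disjoint_left.1 hAB hvA (e ▸ hw)]
        ring
  obtain ⟨K, Λ, h1, h2, h3, h4⟩ := key hSfin.toFinset fun w hw => by
    rw [Finite.mem_toFinset] at hw
    exact ⟨hw.1, lt_of_le_of_ne hw.2 (hne w hw.1).symm⟩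
  refine ⟨K, Λ, h1, h2, fun w hw => ⟨(h3 w hw).1, ?_⟩, h4⟩
  rw [(h3 w hw).2, if_pos]
  rcases (hne w hw).lt_or_gt with h | h
  · exact Or.inl h
  · exact Or.inr (by simpa using ⟨hw, h.le⟩)

/-! ### Piecewise continuously differentiable loops -/

section Loop

variable {γ : ℝ → ℂ} {a b : ℝ}

lemma IsPiecewiseC1Loop.exists_countable_differentiableAt (h : IsPiecewiseC1Loop γ a b) :
    ∃ S : Set ℝ, S.Countable ∧ ∀ x ∈ Ioo a b \ S, DifferentiableAt ℝ γ x := by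
  obtain ⟨n, s, hs, h0, hn, hC⟩ := h.piecewise
  refine ⟨range s, countable_range s, fun x hx => ?_⟩
  have hex : ∃ i < n, x ∈ Ioo (s i) (s (i + 1)) := by
    have hP : ∃ k, x < s k := ⟨n, hn ▸ hx.1.2⟩
    classical
    have hk := Nat.find_spec hP
    have hk0 : Nat.find hP ≠ 0 := fun e => by
      rw [e, h0] at hk
      exact absurd hk (not_lt.2 hx.1.1.le)
    obtain ⟨i, hi⟩ := Nat.exists_eq_succ_of_ne_zero hk0
    have hle : s i ≤ x := not_lt.1 (Nat.find_min hP (by omega))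
    have hin : Nat.find hP ≤ n := Nat.find_min' hP (hn ▸ hx.1.2)
    exact ⟨i, by omega, lt_of_le_of_ne hle fun e => hx.2 ⟨i, e⟩, by rwa [hi] at hk⟩
  obtain ⟨i, hi, hxi⟩ := hex
  exact (((hC i hi).differentiableOn one_ne_zero) x (Ioo_subset_Icc_self hxi)).differentiableAt
    (Icc_mem_nhds hxi.1 hxi.2)

lemma IsPiecewiseC1Loop.intervalIntegrable_deriv (h : IsPiecewiseC1Loop γ a b) :
    IntervalIntegrable (deriv γ) MeasureTheory.volume a b := by
  obtain ⟨n, s, hs, h0, hn, hC⟩ := h.piecewise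
  rw [← h0, ← hn]
  refine IntervalIntegrable.trans_iterate fun i hi => ?_
  rcases (hs (Nat.le_succ i)).eq_or_lt with he | hlt
  · rw [Nat.succ_eq_add_one] at he
    rw [he]
  · have hc : ContinuousOn (derivWithin γ (Icc (s i) (s (i + 1)))) (Icc (s i) (s (i + 1))) :=
      (hC i hi).continuousOn_derivWithin (uniqueDiffOn_Icc hlt) le_rfl
    have h1 : IntervalIntegrable (derivWithin γ (Icc (s i) (s (i + 1)))) MeasureTheory.volume
        (s i) (s (i + 1)) := ContinuousOn.intervalIntegrable (by rwa [uIcc_of_le hlt.le])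
    refine h1.congr_uIoo ?_
    rw [uIoo_of_le hlt.le]
    intro x hx
    exact derivWithin_of_mem_nhds (Icc_mem_nhds hx.1 hx.2)

lemma IsPiecewiseC1Loop.intervalIntegrable_mul (h : IsPiecewiseC1Loop γ a b) {f : ℂ → ℂ}
    (hf : ContinuousOn f (γ '' Icc a b)) :
    IntervalIntegrable (fun x => deriv γ x * f (γ x)) MeasureTheory.volume a b := by
  refine h.intervalIntegrable_deriv.mul_continuousOn ?_
  rw [uIcc_of_le h.lt.le]
  exact hf.comp h.continuousOn (mapsTo_image _ _)

lemma IsPiecewiseC1Loop.isCycle (h : IsPiecewiseC1Loop γ a b) :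
    IsCycle (γ '' Icc a b) fun f => contourIntegral f γ a b where
  isCompact := isCompact_Icc.image_of_continuousOn h.continuousOn
  map_add f g hf hg := by
    simp only [contourIntegral, mul_add]
    exact intervalIntegral.integral_add (h.intervalIntegrable_mul hf) (h.intervalIntegrable_mul hg)
  map_smul c f _ := by
    simp only [contourIntegral, mul_left_comm _ c]
    exact intervalIntegral.integral_const_mul c _
  bound := by
    refine ⟨∫ x in a..b, ‖deriv γ x‖, fun f M hf hM => ?_⟩
    rw [← intervalIntegral.integral_mul_const]
    refine intervalIntegral.norm_integral_le_of_norm_le h.lt.le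
      (Eventually.of_forall fun x hx => ?_)
      (h.intervalIntegrable_deriv.norm.mul_const M)
    rw [norm_mul]
    gcongr
    exact hM _ (mem_image_of_mem _ (Ioc_subset_Icc_self hx))
  closed w hw := by
    obtain ⟨S, hS, hd⟩ := h.exists_countable_differentiableAt
    have hne : ∀ x ∈ Icc a b, γ x - w ≠ 0 := fun x hx e =>
      hw ⟨x, hx, sub_eq_zero.1 e⟩
    have := MeasureTheory.integral_eq_of_hasDerivAt_off_countable_of_le
      (fun x => -(γ x - w)⁻¹) (fun x => deriv γ x * ((γ x - w) ^ 2)⁻¹) h.lt.le hS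
      ((h.continuousOn.sub continuousOn_const).inv₀ hne).neg
      (fun x hx => by
        have h1 := (((hd x hx).hasDerivAt.sub_const w).fun_inv
          (hne x (Ioo_subset_Icc_self hx.1))).fun_neg
        rwa [neg_div, neg_neg, div_eq_mul_inv] at h1)
      (h.intervalIntegrable_mul (f := fun z => ((z - w) ^ 2)⁻¹)
        (IsCycle.continuousOn_inv_sub_sq hw))
    rw [h.closed, sub_self] at this
    exact this

/-- A curve passes through a given countable set with velocity zero at almost every time. -/
lemma ae_deriv_eq_zero_of_mem_countable (γ : ℝ → ℂ) {S : Set ℂ} (hS : S.Countable) :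
    ∀ᵐ x, γ x ∈ S → deriv γ x = 0 := by
  have hc (c : ℂ) : {x | γ x = c ∧ deriv γ x ≠ 0}.Countable := by
    refine (countable_setOfPred_isolated_right_within (s := {x | γ x = c ∧ deriv γ x ≠ 0})).mono ?_
    rintro x ⟨hx, hd⟩
    have hda : DifferentiableAt ℝ γ x := by
      by_contra hn
      exact hd (deriv_zero_of_not_differentiableAt hn)
    have he := hda.hasDerivAt.eventually_ne (c := c) hd
    have he' : ∀ᶠ y in 𝓝[>] x, γ y ≠ c :=
      he.filter_mono (nhdsWithin_mono _ fun y hy => ne_of_gt hy)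
    refine ⟨⟨hx, hd⟩, empty_mem_iff_bot.1 ?_⟩
    filter_upwards [self_mem_nhdsWithin, he'.filter_mono (nhdsWithin_mono x inter_subset_right)]
      with y hy hyc using hyc hy.1.1
  have hu : {x | γ x ∈ S ∧ deriv γ x ≠ 0}.Countable := by
    have : {x | γ x ∈ S ∧ deriv γ x ≠ 0} = ⋃ c ∈ S, {x | γ x = c ∧ deriv γ x ≠ 0} := by
      ext x; simp
    rw [this]
    exact hS.biUnion fun c _ => hc c
  filter_upwards [hu.ae_notMem MeasureTheory.volume] with x hx hxS
  by_contra hne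
  exact hx ⟨hxS, hne⟩

end Loop

/-! ### The kernel with its removable singularities removed -/

lemma ellGamma_eq (q p u : ℂ) :
    ellGamma q p u = dPoch q p (q * p * u⁻¹) / dPoch q p u := by
  unfold ellGamma dPoch
  congr 1
  exact tprod_congr fun jk => by ring

lemma ellGamma_inv_eq (q p u : ℂ) :
    (ellGamma q p u)⁻¹ = dPoch q p u / dPoch q p (q * p * u⁻¹) := by
  rw [ellGamma_eq, inv_div]

/-- `1 / (Γ(u) Γ(u⁻¹)) = θ(u; p) θ(u⁻¹; q)`, with denominators cleared. -/
lemma dPoch_mul_dPoch_inv {q p : ℂ} (hq : ‖q‖ < 1) (hp : ‖p‖ < 1) (u : ℂ) :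
    dPoch q p u * dPoch q p u⁻¹ =
      theta p u * theta q u⁻¹ * (dPoch q p (q * p * u⁻¹) * dPoch q p (q * p * u)) := by
  rw [dPoch_eq_qPoch_mul hq hp u, dPoch_eq_qPoch_mul' hq hp (q * u),
    dPoch_eq_qPoch_mul' hq hp u⁻¹, dPoch_eq_qPoch_mul hq hp (p * u⁻¹), theta, theta,
    div_inv_eq_mul, div_eq_mul_inv]
  ring_nf

/-- The kernel with the factor `1 / (Γ(z²) Γ(z⁻²))` replaced by the function
`θ(z²; p) θ(z⁻²; q)`, holomorphic on `ℂˣ`, that it equals generically. -/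
noncomputable def regKernel (q p : ℂ) (t : Fin 5 → ℂ) (z : ℂ) : ℂ :=
  theta p (z ^ 2) * theta q (z ^ 2)⁻¹ *
    (∏ m, (ellGamma q p (t m * z) * ellGamma q p (t m * z⁻¹) *
      ellGamma q p (bigA t * (t m)⁻¹))) *
    ((ellGamma q p (bigA t * z))⁻¹ * (ellGamma q p (bigA t * z⁻¹))⁻¹ *
      ∏ m, ∏ s ∈ Finset.Ioi m, (ellGamma q p (t m * t s))⁻¹)

lemma kernel_eq_regKernel {q p : ℂ} (hq : ‖q‖ < 1) (hp : ‖p‖ < 1) (t : Fin 5 → ℂ) {z : ℂ}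
    (h1 : dPoch q p (q * p * z ^ 2) ≠ 0) (h2 : dPoch q p (q * p * (z ^ 2)⁻¹) ≠ 0) :
    kernel q p t z = regKernel q p t z := by
  have h := dPoch_mul_dPoch_inv hq hp (z ^ 2)
  have e : (ellGamma q p (z ^ 2))⁻¹ * (ellGamma q p (z ^ 2)⁻¹)⁻¹ =
      theta p (z ^ 2) * theta q (z ^ 2)⁻¹ := by
    rw [ellGamma_inv_eq, ellGamma_inv_eq, inv_inv, div_mul_div_comm, h,
      mul_div_cancel_right₀ _ (mul_ne_zero h2 h1)]
  rw [regKernel, ← e, kernel, div_eq_mul_inv]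
  simp only [mul_inv, Finset.prod_inv_distrib]
  ring

/-- The exceptional points where `kernel` may take a junk value. -/
lemma countable_exceptional (q p : ℂ) (hq : ‖q‖ < 1) (hp : ‖p‖ < 1) :
    {z : ℂ | dPoch q p (q * p * z ^ 2) = 0 ∨ dPoch q p (q * p * (z ^ 2)⁻¹) = 0}.Countable := by
  have hfin (c : ℂ) : {z : ℂ | z ^ 2 = c}.Countable := by
    obtain ⟨s, hs⟩ := IsAlgClosed.exists_pow_nat_eq c two_pos
    refine (toFinite {s, -s}).countable.mono fun v hv => ?_
    exact sq_eq_sq_iff_eq_or_eq_neg.1 ((hv : v ^ 2 = c).trans hs.symm)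
  have : (⋃ jk : ℕ × ℕ, {z : ℂ | z ^ 2 = (q ^ (jk.1 + 1) * p ^ (jk.2 + 1))⁻¹} ∪
      {z : ℂ | z ^ 2 = q ^ (jk.1 + 1) * p ^ (jk.2 + 1)}).Countable :=
    countable_iUnion fun jk => (hfin _).union (hfin _)
  refine this.mono fun z hz => ?_
  rw [mem_iUnion]
  by_contra! hne
  rcases hz with hz | hz
  · refine dPoch_ne_zero hq hp (fun j k h => hne (j, k) (Or.inl ?_)) hz
    exact eq_inv_of_mul_eq_one_left (by rw [← h]; ring)
  · refine dPoch_ne_zero hq hp (fun j k h => hne (j, k) (Or.inr ?_)) hz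
    have hz0 : z ^ 2 ≠ 0 := by rintro h0; simp [h0] at h
    have : (q ^ (j + 1) * p ^ (k + 1)) * (z ^ 2)⁻¹ = 1 := by rw [← h]; ring
    exact ((mul_inv_eq_one₀ hz0).1 this).symm

/-! ### Poles of the kernel and separating cycles -/

/-- The six parameters `t₁, …, t₅` and `q p / A`; all poles of the kernel are multiples of these
and of their inverses. -/
noncomputable def node (q p : ℂ) (t : Fin 5 → ℂ) : Option (Fin 5) → ℂ
  | some m => t m
  | none => (bigA t)⁻¹ * q * p

/-- The points `τ q^j p^k` of `poleSet`, indexed by a parameter `τ` and by `j`, `k`. -/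
noncomputable def polePt (q p : ℂ) (t : Fin 5 → ℂ) (i : Option (Fin 5) × ℕ × ℕ) : ℂ :=
  node q p t i.1 * q ^ i.2.1 * p ^ i.2.2

lemma poleSet_eq_range (q p : ℂ) (t : Fin 5 → ℂ) : poleSet q p t = range (polePt q p t) := by
  ext w
  constructor
  · rintro (⟨m, j, k, rfl⟩ | ⟨j, k, rfl⟩)
    · exact ⟨(some m, j, k), rfl⟩
    · exact ⟨(none, j, k), by simp only [polePt, node]; ring⟩
  · rintro ⟨⟨_ | m, j, k⟩, rfl⟩
    · exact Or.inr ⟨j, k, by simp only [polePt, node]; ring⟩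
    · exact Or.inl ⟨m, j, k, rfl⟩

/-- The set of `z ≠ 0` at which none of the denominators of the kernel vanishes. -/
def regSet (q p : ℂ) (t : Fin 5 → ℂ) : Set ℂ :=
  {z | z ≠ 0 ∧ ∀ m, dPoch q p (node q p t m * z) ≠ 0 ∧ dPoch q p (node q p t m * z⁻¹) ≠ 0}

lemma mem_regSet {q p : ℂ} (hq : ‖q‖ < 1) (hp : ‖p‖ < 1) {t : Fin 5 → ℂ} {z : ℂ} (hz : z ≠ 0)
    (h1 : z ∉ poleSet q p t) (h2 : z⁻¹ ∉ poleSet q p t) : z ∈ regSet q p t := by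
  rw [poleSet_eq_range] at h1 h2
  refine ⟨hz, fun m => ⟨dPoch_ne_zero hq hp fun j k h => h2 ⟨(m, j, k), ?_⟩,
    dPoch_ne_zero hq hp fun j k h => h1 ⟨(m, j, k), ?_⟩⟩⟩
  · simp only [polePt]
    exact eq_inv_of_mul_eq_one_left (by rw [← h]; ring)
  · simp only [polePt]
    exact (mul_inv_eq_one₀ hz).1 (by rw [← h]; ring)

/-- The points around which the cycle `Λ` winds once, and around whose inverse it
does not wind. -/
def sepSet (K : Set ℂ) (Λ : (ℂ → ℂ) → ℂ) : Set ℂ :=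
  {w | w ∉ K ∧ wind Λ w = 1 ∧ (w ≠ 0 → w⁻¹ ∉ K ∧ wind Λ w⁻¹ = 0)}

lemma IsCycle.isOpen_sepSet {K : Set ℂ} {Λ : (ℂ → ℂ) → ℂ} (h : IsCycle K Λ) :
    IsOpen (sepSet K Λ) := by
  rw [isOpen_iff_mem_nhds]
  rintro w ⟨hw, hw1, hw2⟩
  by_cases h0 : w = 0
  · subst h0
    obtain ⟨R, hR⟩ := h.isCompact.isBounded.exists_norm_le
    have hpos : 0 < (max R 1)⁻¹ := by positivity
    filter_upwards [h.eventually_wind_eq hw, Metric.ball_mem_nhds (0 : ℂ) hpos] with z hz hzR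
    refine ⟨hz.1, hz.2.trans hw1, fun hz0 => ?_⟩
    have hlt : max R 1 < ‖z⁻¹‖ := by
      rw [norm_inv]
      rw [mem_ball_zero_iff] at hzR
      exact (lt_inv_comm₀ (by positivity) (norm_pos_iff.2 hz0)).2 hzR
    refine ⟨fun hK => absurd ((hR _ hK).trans (le_max_left R 1)) (not_le.2 hlt), ?_⟩
    exact h.wind_eq_zero_of_lt_norm (fun z hz => (hR z hz).trans (le_max_left R 1))
      (by positivity) hlt
  · have h1 := (continuousAt_inv₀ h0).eventually (h.eventually_wind_eq (hw2 h0).1)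
    filter_upwards [h.eventually_wind_eq hw, h1] with z hz hz'
    exact ⟨hz.1, hz.2.trans hw1, fun _ => ⟨hz'.1, hz'.2.trans (hw2 h0).2⟩⟩

/-- A cycle that winds once around the origin and around the points of `P`, and does not wind
around their inverses. -/
structure IsSeparatingCycle (P K : Set ℂ) (Λ : (ℂ → ℂ) → ℂ) : Prop where
  isCycle : IsCycle K Λ
  zero_mem : (0 : ℂ) ∈ sepSet K Λ
  subset : P ⊆ sepSet K Λ

lemma IsSeparatingCycle.mono {P Q K : Set ℂ} {Λ : (ℂ → ℂ) → ℂ} (h : IsSeparatingCycle P K Λ)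
    (hQ : Q ⊆ P) : IsSeparatingCycle Q K Λ :=
  ⟨h.isCycle, h.zero_mem, hQ.trans h.subset⟩

lemma IsSeparatingCycle.subset_regSet {P K : Set ℂ} {Λ : (ℂ → ℂ) → ℂ} {q p : ℂ}
    {t : Fin 5 → ℂ} (h : IsSeparatingCycle P K Λ) (hP : poleSet q p t ⊆ P)
    (hq : ‖q‖ < 1) (hp : ‖p‖ < 1) : K ⊆ regSet q p t := by
  intro z hz
  have hz0 : z ≠ 0 := by rintro rfl; exact h.zero_mem.1 hz
  refine mem_regSet hq hp hz0 (fun hzP => (h.subset (hP hzP)).1 hz) fun hzP => ?_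
  exact ((h.subset (hP hzP)).2.2 (inv_ne_zero hz0)).1 (by rwa [inv_inv])

/-- All separating cycles have the same winding numbers about the points that are not regular. -/
lemma IsSeparatingCycle.wind_eq {P K L : Set ℂ} {Λ Λ' : (ℂ → ℂ) → ℂ} {q p : ℂ}
    {t : Fin 5 → ℂ} (h : IsSeparatingCycle P K Λ) (h' : IsSeparatingCycle P L Λ')
    (hP : poleSet q p t ⊆ P) (hq : ‖q‖ < 1) (hp : ‖p‖ < 1) {w : ℂ} (hw : w ∉ regSet q p t) :
    wind Λ w = wind Λ' w := by
  by_cases h0 : w = 0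
  · rw [h0, h.zero_mem.2.1, h'.zero_mem.2.1]
  by_cases h1 : w ∈ poleSet q p t
  · rw [(h.subset (hP h1)).2.1, (h'.subset (hP h1)).2.1]
  by_cases h2 : w⁻¹ ∈ poleSet q p t
  · have e1 := ((h.subset (hP h2)).2.2 (inv_ne_zero h0)).2
    have e2 := ((h'.subset (hP h2)).2.2 (inv_ne_zero h0)).2
    rw [inv_inv] at e1 e2
    rw [e1, e2]
  · exact absurd (mem_regSet hq hp h0 h1 h2) hw

/-! ### Analyticity and continuity of the kernel -/

/-- The conditions under which the `z`-independent factors of the kernel are finite, expressed by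
the nonvanishing of the double products that these factors have as denominators. -/
structure Admissible (q p : ℂ) (t : Fin 5 → ℂ) : Prop where
  norm_q : ‖q‖ < 1
  norm_p : ‖p‖ < 1
  ne_zero : ∀ m, t m ≠ 0
  num : ∀ m, dPoch q p (bigA t * (t m)⁻¹) ≠ 0
  den : ∀ m s, m < s → dPoch q p (q * p * (t m * t s)⁻¹) ≠ 0

lemma bigA_ne_zero {t : Fin 5 → ℂ} (ht : ∀ m, t m ≠ 0) : bigA t ≠ 0 :=
  Finset.prod_ne_zero_iff.2 fun m _ => ht m

section Continuity

variable {X : Type*} [TopologicalSpace X] {f g h : X → ℂ} {a : X}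

lemma continuousAt_ellGamma (hf : ContinuousAt f a) (hg : ContinuousAt g a)
    (hh : ContinuousAt h a) (hq : ‖f a‖ < 1) (hp : ‖g a‖ < 1) (h0 : h a ≠ 0)
    (hne : dPoch (f a) (g a) (h a) ≠ 0) :
    ContinuousAt (fun x => ellGamma (f x) (g x) (h x)) a := by
  simp only [ellGamma_eq]
  exact (continuousAt_dPoch_comp hf hg ((hf.fun_mul hg).mul (hh.inv₀ h0)) hq hp).div
    (continuousAt_dPoch_comp hf hg hh hq hp) hne

lemma continuousAt_ellGamma_inv (hf : ContinuousAt f a) (hg : ContinuousAt g a)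
    (hh : ContinuousAt h a) (hq : ‖f a‖ < 1) (hp : ‖g a‖ < 1) (h0 : h a ≠ 0)
    (hne : dPoch (f a) (g a) (f a * g a * (h a)⁻¹) ≠ 0) :
    ContinuousAt (fun x => (ellGamma (f x) (g x) (h x))⁻¹) a := by
  simp only [ellGamma_inv_eq]
  exact (continuousAt_dPoch_comp hf hg hh hq hp).div
    (continuousAt_dPoch_comp hf hg ((hf.fun_mul hg).mul (hh.inv₀ h0)) hq hp) hne

lemma continuousAt_theta (hf : ContinuousAt f a) (hh : ContinuousAt h a) (hq : ‖f a‖ < 1)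
    (h0 : h a ≠ 0) : ContinuousAt (fun x => theta (f x) (h x)) a :=
  (continuousAt_qPoch_comp hh hf hq).mul (continuousAt_qPoch_comp (hf.div hh h0) hf hq)

end Continuity

lemma differentiableAt_ellGamma_comp {q p : ℂ} (hq : ‖q‖ < 1) (hp : ‖p‖ < 1) {h : ℂ → ℂ} {z : ℂ}
    (hh : DifferentiableAt ℂ h z) (h0 : h z ≠ 0) (hne : dPoch q p (h z) ≠ 0) :
    DifferentiableAt ℂ (fun z => ellGamma q p (h z)) z := by
  simp only [ellGamma_eq]
  exact ((differentiable_dPoch hq hp _).fun_comp' z ((hh.inv h0).const_mul _)).div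
    ((differentiable_dPoch hq hp _).fun_comp' z hh) hne

lemma differentiableAt_ellGamma_inv_comp {q p : ℂ} (hq : ‖q‖ < 1) (hp : ‖p‖ < 1) {h : ℂ → ℂ}
    {z : ℂ} (hh : DifferentiableAt ℂ h z) (h0 : h z ≠ 0)
    (hne : dPoch q p (q * p * (h z)⁻¹) ≠ 0) :
    DifferentiableAt ℂ (fun z => (ellGamma q p (h z))⁻¹) z := by
  simp only [ellGamma_inv_eq]
  exact ((differentiable_dPoch hq hp _).fun_comp' z hh).div
    ((differentiable_dPoch hq hp _).fun_comp' z ((hh.inv h0).const_mul _)) hne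

lemma node_none_mul (q p : ℂ) (t : Fin 5 → ℂ) (z : ℂ) :
    node q p t none * z = q * p * (bigA t * z⁻¹)⁻¹ := by
  rw [node, mul_inv, inv_inv]; ring

lemma isOpen_regSet {q p : ℂ} (hq : ‖q‖ < 1) (hp : ‖p‖ < 1) (t : Fin 5 → ℂ) :
    IsOpen (regSet q p t) := by
  have hc := (differentiable_dPoch hq hp).continuous
  rw [isOpen_iff_mem_nhds]
  rintro z ⟨hz, h⟩
  have h1 : ∀ᶠ y in 𝓝 z, ∀ m, dPoch q p (node q p t m * y) ≠ 0 ∧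
      dPoch q p (node q p t m * y⁻¹) ≠ 0 := by
    rw [eventually_all]
    intro m
    have c1 : ContinuousAt (fun y => dPoch q p (node q p t m * y)) z :=
      (hc.comp (continuous_const.mul continuous_id)).continuousAt
    have c2 : ContinuousAt (fun y => dPoch q p (node q p t m * y⁻¹)) z :=
      ContinuousAt.comp' hc.continuousAt (continuousAt_const.mul (continuousAt_inv₀ hz))
    exact (c1.eventually_ne (h m).1).and (c2.eventually_ne (h m).2)
  filter_upwards [h1, isOpen_ne.mem_nhds hz] with y hy hy0 using ⟨hy0, hy⟩

lemma differentiableOn_regKernel {q p : ℂ} {t : Fin 5 → ℂ} (h : Admissible q p t) :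
    DifferentiableOn ℂ (fun z => regKernel q p t z / z) (regSet q p t) := by
  rintro z ⟨hz, hreg⟩
  refine DifferentiableAt.differentiableWithinAt ?_
  have hq := h.norm_q
  have hp := h.norm_p
  have hA := bigA_ne_zero h.ne_zero
  have hz2 : z ^ 2 ≠ 0 := pow_ne_zero 2 hz
  have hpow : DifferentiableAt ℂ (fun z : ℂ => z ^ 2) z := by fun_prop
  have hinv : DifferentiableAt ℂ (fun z : ℂ => z⁻¹) z := differentiableAt_inv hz
  have d1 : DifferentiableAt ℂ (fun z => theta p (z ^ 2)) z :=
    (differentiableAt_theta hp hz2).fun_comp' z hpow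
  have d2 : DifferentiableAt ℂ (fun z => theta q (z ^ 2)⁻¹) z :=
    (differentiableAt_theta hq (inv_ne_zero hz2)).fun_comp' z (hpow.inv hz2)
  have l1 (c : ℂ) : DifferentiableAt ℂ (fun z => c * z) z := by fun_prop
  have l2 (c : ℂ) : DifferentiableAt ℂ (fun z => c * z⁻¹) z := hinv.const_mul c
  have d3 (m : Fin 5) : DifferentiableAt ℂ (fun z => ellGamma q p (t m * z) *
      ellGamma q p (t m * z⁻¹) * ellGamma q p (bigA t * (t m)⁻¹)) z :=
    ((differentiableAt_ellGamma_comp hq hp (h := fun z => t m * z) (l1 _)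
      (mul_ne_zero (h.ne_zero m) hz) (hreg (some m)).1).fun_mul
      (differentiableAt_ellGamma_comp hq hp (h := fun z => t m * z⁻¹) (l2 _)
      (mul_ne_zero (h.ne_zero m) (inv_ne_zero hz)) (hreg (some m)).2)).mul_const _
  have d4 : DifferentiableAt ℂ (fun z => (ellGamma q p (bigA t * z))⁻¹) z :=
    differentiableAt_ellGamma_inv_comp hq hp (h := fun z => bigA t * z) (l1 _)
      (mul_ne_zero hA hz) (by
        have := (hreg none).2
        rwa [node_none_mul, inv_inv] at this)
  have d5 : DifferentiableAt ℂ (fun z => (ellGamma q p (bigA t * z⁻¹))⁻¹) z :=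
    differentiableAt_ellGamma_inv_comp hq hp (h := fun z => bigA t * z⁻¹) (l2 _)
      (mul_ne_zero hA (inv_ne_zero hz)) (by
        have := (hreg none).1
        rwa [node_none_mul] at this)
  have d3' := DifferentiableAt.fun_finsetProd (u := Finset.univ) fun m _ => d3 m
  exact ((((d1.fun_mul d2).fun_mul d3').fun_mul ((d4.fun_mul d5).mul_const _))).fun_div
    differentiableAt_id hz

/-- Triples `(q, p, t)` of parameters. -/
abbrev Param : Type := ℂ × ℂ × (Fin 5 → ℂ)

lemma continuous_bigA : Continuous bigA :=
  continuous_finsetProd _ fun m _ => continuous_apply m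

lemma continuousAt_regKernel {x : Param} (h : Admissible x.1 x.2.1 x.2.2) {z : ℂ}
    (hz : z ∈ regSet x.1 x.2.1 x.2.2) :
    ContinuousAt (fun y : Param × ℂ => regKernel y.1.1 y.1.2.1 y.1.2.2 y.2 / y.2) (x, z) := by
  obtain ⟨hz, hreg⟩ := hz
  have hq := h.norm_q
  have hp := h.norm_p
  have hA := bigA_ne_zero h.ne_zero
  have hz2 : z ^ 2 ≠ 0 := pow_ne_zero 2 hz
  have cq : ContinuousAt (fun y : Param × ℂ => y.1.1) (x, z) := by fun_prop
  have cp : ContinuousAt (fun y : Param × ℂ => y.1.2.1) (x, z) := by fun_prop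
  have ct (m : Fin 5) : ContinuousAt (fun y : Param × ℂ => y.1.2.2 m) (x, z) := by fun_prop
  have cA : ContinuousAt (fun y : Param × ℂ => bigA y.1.2.2) (x, z) :=
    (continuous_bigA.comp (by fun_prop : Continuous fun y : Param × ℂ => y.1.2.2)).continuousAt
  have cz : ContinuousAt (fun y : Param × ℂ => y.2) (x, z) := by fun_prop
  have czi : ContinuousAt (fun y : Param × ℂ => y.2⁻¹) (x, z) := cz.inv₀ hz
  have cz2 : ContinuousAt (fun y : Param × ℂ => y.2 ^ 2) (x, z) := by fun_prop
  have d1 : ContinuousAt (fun y : Param × ℂ => theta y.1.2.1 (y.2 ^ 2)) (x, z) :=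
    continuousAt_theta cp cz2 hp hz2
  have d2 : ContinuousAt (fun y : Param × ℂ => theta y.1.1 (y.2 ^ 2)⁻¹) (x, z) :=
    continuousAt_theta cq (cz2.inv₀ hz2) hq (inv_ne_zero hz2)
  have d3 : ContinuousAt (fun y : Param × ℂ => ∏ m, (ellGamma y.1.1 y.1.2.1 (y.1.2.2 m * y.2) *
      ellGamma y.1.1 y.1.2.1 (y.1.2.2 m * y.2⁻¹) *
      ellGamma y.1.1 y.1.2.1 (bigA y.1.2.2 * (y.1.2.2 m)⁻¹))) (x, z) := by
    refine tendsto_finsetProd _ fun m _ => ?_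
    exact ((continuousAt_ellGamma cq cp ((ct m).mul cz) hq hp
      (mul_ne_zero (h.ne_zero m) hz) (hreg (some m)).1).mul
      (continuousAt_ellGamma cq cp ((ct m).mul czi) hq hp
      (mul_ne_zero (h.ne_zero m) (inv_ne_zero hz)) (hreg (some m)).2)).mul
      (continuousAt_ellGamma cq cp (cA.mul ((ct m).inv₀ (h.ne_zero m))) hq hp
      (mul_ne_zero hA (inv_ne_zero (h.ne_zero m))) (h.num m))
  have d4 : ContinuousAt (fun y : Param × ℂ =>
      (ellGamma y.1.1 y.1.2.1 (bigA y.1.2.2 * y.2))⁻¹) (x, z) :=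
    continuousAt_ellGamma_inv cq cp (cA.mul cz) hq hp (mul_ne_zero hA hz) (by
        have := (hreg none).2
        rwa [node_none_mul, inv_inv] at this)
  have d5 : ContinuousAt (fun y : Param × ℂ =>
      (ellGamma y.1.1 y.1.2.1 (bigA y.1.2.2 * y.2⁻¹))⁻¹) (x, z) :=
    continuousAt_ellGamma_inv cq cp (cA.mul czi) hq hp (mul_ne_zero hA (inv_ne_zero hz)) (by
        have := (hreg none).1
        rwa [node_none_mul] at this)
  have d6 : ContinuousAt (fun y : Param × ℂ => ∏ m, ∏ s ∈ Finset.Ioi m,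
      (ellGamma y.1.1 y.1.2.1 (y.1.2.2 m * y.1.2.2 s))⁻¹) (x, z) := by
    refine tendsto_finsetProd _ fun m _ => tendsto_finsetProd _ fun s hs => ?_
    exact continuousAt_ellGamma_inv cq cp ((ct m).mul (ct s)) hq hp
      (mul_ne_zero (h.ne_zero m) (h.ne_zero s)) (h.den m s (Finset.mem_Ioi.1 hs))
  exact (((d1.mul d2).mul d3).mul ((d4.mul d5).mul d6)).div cz hz

lemma Admissible.eventually {x : Param} (h : Admissible x.1 x.2.1 x.2.2) :
    ∀ᶠ y : Param in 𝓝 x, Admissible y.1 y.2.1 y.2.2 := by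
  have hq := h.norm_q
  have hp := h.norm_p
  have cq : ContinuousAt (fun y : Param => y.1) x := by fun_prop
  have cp : ContinuousAt (fun y : Param => y.2.1) x := by fun_prop
  have ct (m : Fin 5) : ContinuousAt (fun y : Param => y.2.2 m) x := by fun_prop
  have cA : ContinuousAt (fun y : Param => bigA y.2.2) x :=
    (continuous_bigA.comp (by fun_prop : Continuous fun y : Param => y.2.2)).continuousAt
  have e1 : ∀ᶠ y : Param in 𝓝 x, ‖y.1‖ < 1 := cq.norm.eventually_lt_const hq
  have e2 : ∀ᶠ y : Param in 𝓝 x, ‖y.2.1‖ < 1 := cp.norm.eventually_lt_const hp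
  have e3 : ∀ᶠ y : Param in 𝓝 x, ∀ m, y.2.2 m ≠ 0 :=
    eventually_all.2 fun m => (ct m).eventually_ne (h.ne_zero m)
  have e4 : ∀ᶠ y : Param in 𝓝 x, ∀ m, dPoch y.1 y.2.1 (bigA y.2.2 * (y.2.2 m)⁻¹) ≠ 0 :=
    eventually_all.2 fun m => (continuousAt_dPoch_comp cq cp
      (cA.fun_mul ((ct m).inv₀ (h.ne_zero m))) hq hp).eventually_ne (h.num m)
  have e5 : ∀ᶠ y : Param in 𝓝 x, ∀ m s, m < s →
      dPoch y.1 y.2.1 (y.1 * y.2.1 * (y.2.2 m * y.2.2 s)⁻¹) ≠ 0 := by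
    refine eventually_all.2 fun m => eventually_all.2 fun s => ?_
    by_cases hms : m < s
    · filter_upwards [(continuousAt_dPoch_comp cq cp ((cq.fun_mul cp).fun_mul
        (((ct m).fun_mul (ct s)).inv₀ (mul_ne_zero (h.ne_zero m) (h.ne_zero s)))) hq
        hp).eventually_ne
        (h.den m s hms)] with y hy _ using hy
    · exact Eventually.of_forall fun y hy => absurd hy hms
  filter_upwards [e1, e2, e3, e4, e5] with y h1 h2 h3 h4 h5 using ⟨h1, h2, h3, h4, h5⟩

/-- Points `τ q^j p^k` that lie in an open neighbourhood of the origin remain there under small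
changes of the parameters, uniformly in `j`, `k`. -/
lemma eventually_polePt_mem {x : Param} (hq : ‖x.1‖ < 1) (hp : ‖x.2.1‖ < 1)
    (ht : ∀ m, x.2.2 m ≠ 0) {O : Set ℂ} (hO : IsOpen O) (h0 : (0 : ℂ) ∈ O)
    {S : Set (Option (Fin 5) × ℕ × ℕ)} (hS : ∀ i ∈ S, polePt x.1 x.2.1 x.2.2 i ∈ O) :
    ∀ᶠ y : Param in 𝓝 x, ∀ i ∈ S, polePt y.1 y.2.1 y.2.2 i ∈ O := by
  have cq : ContinuousAt (fun y : Param => y.1) x := by fun_prop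
  have cp : ContinuousAt (fun y : Param => y.2.1) x := by fun_prop
  have ct (m : Fin 5) : ContinuousAt (fun y : Param => y.2.2 m) x := by fun_prop
  have cA : ContinuousAt (fun y : Param => bigA y.2.2) x :=
    (continuous_bigA.comp (by fun_prop : Continuous fun y : Param => y.2.2)).continuousAt
  have cn (m : Option (Fin 5)) : ContinuousAt (fun y : Param => node y.1 y.2.1 y.2.2 m) x := by
    cases m with
    | none => exact ((cA.inv₀ (bigA_ne_zero ht)).mul cq).mul cp
    | some m => exact ct m
  obtain ⟨r, hr1, hr2⟩ := exists_between (max_lt hq hp)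
  have hr0 : 0 ≤ r := (norm_nonneg _).trans ((le_max_left _ _).trans hr1.le)
  obtain ⟨M, hM⟩ : ∃ M, ∀ m, ‖node x.1 x.2.1 x.2.2 m‖ < M := by
    obtain ⟨M, hM⟩ := (finite_range fun m => ‖node x.1 x.2.1 x.2.2 m‖).bddAbove
    exact ⟨M + 1, fun m => lt_add_of_le_of_pos (hM ⟨m, rfl⟩) one_pos⟩
  have hM0 : 0 ≤ M := (norm_nonneg _).trans (hM none).le
  obtain ⟨η, hη, hηO⟩ := Metric.isOpen_iff.1 hO 0 h0
  obtain ⟨J, hJ⟩ : ∃ J : ℕ, M * r ^ J < η := by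
    have : Tendsto (fun J : ℕ => M * r ^ J) atTop (𝓝 (M * 0)) :=
      (tendsto_pow_atTop_nhds_zero_of_lt_one hr0 hr2).const_mul M
    rw [mul_zero] at this
    exact (this.eventually_lt_const hη).exists
  have e1 : ∀ᶠ y : Param in 𝓝 x, ‖y.1‖ < r :=
    cq.norm.eventually_lt_const ((le_max_left _ _).trans_lt hr1)
  have e2 : ∀ᶠ y : Param in 𝓝 x, ‖y.2.1‖ < r :=
    cp.norm.eventually_lt_const ((le_max_right _ _).trans_lt hr1)
  have e3 : ∀ᶠ y : Param in 𝓝 x, ∀ m, ‖node y.1 y.2.1 y.2.2 m‖ < M :=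
    eventually_all.2 fun m => (cn m).norm.eventually_lt_const (hM m)
  have e4 : ∀ᶠ y : Param in 𝓝 x, ∀ (m : Option (Fin 5)) (j k : Fin J),
      (m, (j : ℕ), (k : ℕ)) ∈ S → polePt y.1 y.2.1 y.2.2 (m, j, k) ∈ O := by
    refine eventually_all.2 fun m => eventually_all.2 fun j => eventually_all.2 fun k => ?_
    by_cases hi : (m, (j : ℕ), (k : ℕ)) ∈ S
    · have c : ContinuousAt (fun y : Param => polePt y.1 y.2.1 y.2.2 (m, j, k)) x :=
        ((cn m).mul (cq.pow _)).mul (cp.pow _)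
      filter_upwards [c.eventually (hO.mem_nhds (hS _ hi))] with y hy _ using hy
    · exact Eventually.of_forall fun y hy => absurd hy hi
  filter_upwards [e1, e2, e3, e4] with y h1 h2 h3 h4
  rintro ⟨m, j, k⟩ hi
  by_cases hjk : j < J ∧ k < J
  · exact h4 m ⟨j, hjk.1⟩ ⟨k, hjk.2⟩ hi
  · refine hηO (mem_ball_zero_iff.2 (lt_of_le_of_lt ?_ hJ))
    have hJjk : J ≤ j + k := by omega
    calc ‖polePt y.1 y.2.1 y.2.2 (m, j, k)‖ =
          ‖node y.1 y.2.1 y.2.2 m‖ * ‖y.1‖ ^ j * ‖y.2.1‖ ^ k := by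
          simp [polePt]
      _ ≤ M * r ^ j * r ^ k := by
          have := (h3 m).le
          gcongr
      _ = M * r ^ (j + k) := by rw [pow_add, mul_assoc]
      _ ≤ M * r ^ J := by
          gcongr ?_ * ?_
          exact pow_le_pow_of_le_one hr0 hr2.le hJjk

lemma IsSeparatingCycle.eventually {K : Set ℂ} {Λ : (ℂ → ℂ) → ℂ} {x : Param}
    (h : IsSeparatingCycle (poleSet x.1 x.2.1 x.2.2) K Λ) (hq : ‖x.1‖ < 1) (hp : ‖x.2.1‖ < 1)
    (ht : ∀ m, x.2.2 m ≠ 0) :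
    ∀ᶠ y : Param in 𝓝 x, IsSeparatingCycle (poleSet y.1 y.2.1 y.2.2) K Λ := by
  have := eventually_polePt_mem hq hp ht h.isCycle.isOpen_sepSet h.zero_mem (S := univ)
    fun i _ => h.subset (by rw [poleSet_eq_range]; exact mem_range_self i)
  filter_upwards [this] with y hy
  refine ⟨h.isCycle, h.zero_mem, ?_⟩
  rw [poleSet_eq_range]
  rintro _ ⟨i, rfl⟩
  exact hy i (mem_univ i)

/-- Integrals over a fixed cycle depend continuously on parameters. -/
lemma IsCycle.continuousAt_map {X : Type*} [TopologicalSpace X] {K : Set ℂ} {Λ : (ℂ → ℂ) → ℂ}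
    (h : IsCycle K Λ) {F : X → ℂ → ℂ} {x : X}
    (hF : ∀ z ∈ K, ContinuousAt (fun y : X × ℂ => F y.1 y.2) (x, z))
    (hFK : ∀ᶠ y in 𝓝 x, ContinuousOn (F y) K) : ContinuousAt (fun y => Λ (F y)) x := by
  obtain ⟨C, hC0, hC⟩ := h.exists_nonneg_bound
  rw [ContinuousAt, Metric.tendsto_nhds]
  intro ε hε
  have hδ : 0 < ε / (C + 1) := by positivity
  have hu : ∀ᶠ y in 𝓝 x, ∀ z ∈ K, ‖F y z - F x z‖ < ε / (C + 1) := by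
    refine h.isCompact.eventually_forall_of_forall_eventually fun z hz => ?_
    have c1 := hF z hz
    have c2 : ContinuousAt (fun y : X × ℂ => F x y.2) (x, z) :=
      ContinuousAt.comp (f := fun y : X × ℂ => (x, y.2)) (g := fun y : X × ℂ => F y.1 y.2)
        (x := (x, z)) c1 (by fun_prop)
    have c3 : ContinuousAt (fun y : X × ℂ => ‖F y.1 y.2 - F x y.2‖) (x, z) := (c1.sub c2).norm
    exact c3.eventually_lt_const (by simpa using hδ)
  filter_upwards [hu, hFK] with y hy hyK
  rw [dist_eq_norm, ← h.map_sub hyK hFK.self_of_nhds]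
  refine (hC _ _ hδ.le (hyK.sub hFK.self_of_nhds) fun z hz => (hy z hz).le).trans_lt ?_
  rw [← mul_div_assoc, div_lt_iff₀ (by positivity)]
  nlinarith

lemma IsSeparatingCycle.continuousAt_regKernel {K : Set ℂ} {Λ : (ℂ → ℂ) → ℂ} {x : Param}
    (h : IsSeparatingCycle (poleSet x.1 x.2.1 x.2.2) K Λ) (ha : Admissible x.1 x.2.1 x.2.2) :
    ContinuousAt (fun y : Param => Λ fun z => regKernel y.1 y.2.1 y.2.2 z / z) x := by
  refine h.isCycle.continuousAt_map
    (F := fun (y : Param) z => regKernel y.1 y.2.1 y.2.2 z / z) (fun z hz => ?_) ?_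
  · exact EllipticBeta.continuousAt_regKernel ha
      (h.subset_regSet Subset.rfl ha.norm_q ha.norm_p hz)
  · filter_upwards [h.eventually ha.norm_q ha.norm_p ha.ne_zero, ha.eventually] with y hy hya
    exact (differentiableOn_regKernel hya).continuousOn.mono
      (hy.subset_regSet Subset.rfl hya.norm_q hya.norm_p)

/-- The integral of the kernel does not depend on the separating cycle. -/
lemma IsSeparatingCycle.integral_eq {K L : Set ℂ} {Λ Λ' : (ℂ → ℂ) → ℂ} {q p : ℂ}
    {t : Fin 5 → ℂ} (h : IsSeparatingCycle (poleSet q p t) K Λ)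
    (h' : IsSeparatingCycle (poleSet q p t) L Λ') (ha : Admissible q p t) :
    (Λ fun z => regKernel q p t z / z) = Λ' fun z => regKernel q p t z / z :=
  h.isCycle.eq_of_wind_eq h'.isCycle (isOpen_regSet ha.norm_q ha.norm_p t)
    (h.subset_regSet Subset.rfl ha.norm_q ha.norm_p)
    (h'.subset_regSet Subset.rfl ha.norm_q ha.norm_p) (differentiableOn_regKernel ha)
    fun _ hw => h.wind_eq h' Subset.rfl ha.norm_q ha.norm_p hw

/-! ### The difference equation in the first parameter -/

lemma ellGamma_mul_left {q p u : ℂ} (hq : ‖q‖ < 1) (hp : ‖p‖ < 1) (hq0 : q ≠ 0)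
    (hu : dPoch q p u ≠ 0) : ellGamma q p (q * u) = theta p u * ellGamma q p u := by
  have h1 := dPoch_eq_qPoch_mul hq hp u
  have h2 := dPoch_eq_qPoch_mul hq hp (p * u⁻¹)
  have e1 : q * p * (q * u)⁻¹ = p * u⁻¹ := by
    rw [mul_inv]; field_simp
  have e2 : q * (p * u⁻¹) = q * p * u⁻¹ := by ring
  rw [e2] at h2
  rw [h1] at hu
  have hu1 := left_ne_zero_of_mul hu
  rw [ellGamma_eq, ellGamma_eq, e1, h2, h1, theta, div_eq_mul_inv p u]
  rw [mul_div_assoc', div_eq_div_iff (right_ne_zero_of_mul hu) hu]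
  ring

lemma ellGamma_inv_eq_theta_mul {q p u : ℂ} (hq : ‖q‖ < 1) (hp : ‖p‖ < 1) (hq0 : q ≠ 0)
    (hu : dPoch q p (p * u⁻¹) ≠ 0) :
    (ellGamma q p u)⁻¹ = theta p u * (ellGamma q p (q * u))⁻¹ := by
  have h1 := dPoch_eq_qPoch_mul hq hp u
  have h2 := dPoch_eq_qPoch_mul hq hp (p * u⁻¹)
  have e1 : q * p * (q * u)⁻¹ = p * u⁻¹ := by
    rw [mul_inv]; field_simp
  have e2 : q * (p * u⁻¹) = q * p * u⁻¹ := by ring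
  rw [e2] at h2
  rw [h2] at hu
  rw [ellGamma_inv_eq, ellGamma_inv_eq, e1, h2, h1, theta, div_eq_mul_inv p u,
    mul_div_assoc', div_eq_div_iff (right_ne_zero_of_mul hu) hu]
  ring

lemma prod_pairs (f : Fin 5 → Fin 5 → ℂ) :
    ∏ m, ∏ s ∈ Finset.Ioi m, f m s =
      (f 0 1 * f 0 2 * f 0 3 * f 0 4) * (f 1 2 * f 1 3 * f 1 4 * (f 2 3 * f 2 4 * f 3 4)) := by
  have e0 : Finset.Ioi (0 : Fin 5) = {1, 2, 3, 4} := by decide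
  have e1 : Finset.Ioi (1 : Fin 5) = {2, 3, 4} := by decide
  have e2 : Finset.Ioi (2 : Fin 5) = {3, 4} := by decide
  have e3 : Finset.Ioi (3 : Fin 5) = {4} := by decide
  have e4 : Finset.Ioi (4 : Fin 5) = ∅ := by decide
  rw [Fin.prod_univ_five, e0, e1, e2, e3, e4]
  simp
  ring

/-- The parameters with `t₁` replaced by `c t₁`. -/
def shift (c : ℂ) (t : Fin 5 → ℂ) : Fin 5 → ℂ := Function.update t 0 (c * t 0)

lemma shift_zero (c : ℂ) (t : Fin 5 → ℂ) : shift c t 0 = c * t 0 := Function.update_self ..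

lemma shift_of_ne (c : ℂ) (t : Fin 5 → ℂ) {m : Fin 5} (hm : m ≠ 0) : shift c t m = t m :=
  Function.update_of_ne hm ..

lemma bigA_shift (c : ℂ) (t : Fin 5 → ℂ) : bigA (shift c t) = c * bigA t := by
  simp only [bigA, Fin.prod_univ_five, shift_zero, shift_of_ne c t (by decide : (1 : Fin 5) ≠ 0),
    shift_of_ne c t (by decide : (2 : Fin 5) ≠ 0), shift_of_ne c t (by decide : (3 : Fin 5) ≠ 0),
    shift_of_ne c t (by decide : (4 : Fin 5) ≠ 0)]
  ring

/-- The certificate `g` of the difference equation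
`ρ(z; q t₁, …) - ρ(z; t₁, …) = g(z / q) - g(z)`. -/
noncomputable def certificate (q p : ℂ) (t : Fin 5 → ℂ) (z : ℂ) : ℂ :=
  ((∏ m, ellGamma q p (bigA t * (t m)⁻¹)) *
    (∏ m, ∏ s ∈ Finset.Ioi m, (ellGamma q p (t m * t s))⁻¹) * (t 0 * theta p (t 0 * bigA t)) /
    (theta p (t 0 * t 1) * theta p (t 0 * t 2) * theta p (t 0 * t 3) * theta p (t 0 * t 4))) *
  (z⁻¹ * theta q (z⁻¹ ^ 2) *
    (∏ m, (ellGamma q p (q * (t m * z)) * ellGamma q p (t m * z⁻¹))) *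
    ((ellGamma q p (q * (bigA t * z)))⁻¹ * (ellGamma q p (bigA t * z⁻¹))⁻¹))

lemma certificate_inv {q p : ℂ} (hq : ‖q‖ < 1) (hq0 : q ≠ 0) (t : Fin 5 → ℂ) {z : ℂ}
    (hz : z ≠ 0) : certificate q p t z⁻¹ = -certificate q p t (z / q) := by
  have hu : z⁻¹ ^ 2 ≠ 0 := pow_ne_zero 2 (inv_ne_zero hz)
  have e1 : (z / q)⁻¹ ^ 2 = q * (q * z⁻¹ ^ 2) := by rw [inv_div]; field_simp
  have e2 (c : ℂ) : q * (c * (z / q)) = c * z := by field_simp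
  have e3 (c : ℂ) : c * (z / q)⁻¹ = q * (c * z⁻¹) := by rw [inv_div]; field_simp
  have h1 := theta_inv hq (pow_ne_zero 2 hz)
  rw [← inv_pow] at h1
  have h2 : theta q (q * (q * z⁻¹ ^ 2)) = -(z ^ 2) / q * theta q (z ^ 2) := by
    rw [theta_mul_left hq hq0 (mul_ne_zero hq0 hu), theta_mul_left hq hq0 hu, h1]
    field_simp
  have h3 : (z / q)⁻¹ = q * z⁻¹ := by rw [inv_div]; ring
  have h4 : ∏ m, (ellGamma q p (q * (t m * z⁻¹)) * ellGamma q p (t m * z)) =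
      ∏ m, (ellGamma q p (t m * z) * ellGamma q p (q * (t m * z⁻¹))) :=
    Finset.prod_congr rfl fun m _ => mul_comm _ _
  unfold certificate
  rw [e1, h2, inv_inv]
  simp only [e2, e3]
  rw [h3, h4]
  generalize (∏ m, ellGamma q p (bigA t * (t m)⁻¹)) *
    (∏ m, ∏ s ∈ Finset.Ioi m, (ellGamma q p (t m * t s))⁻¹) * (t 0 * theta p (t 0 * bigA t)) /
    (theta p (t 0 * t 1) * theta p (t 0 * t 2) * theta p (t 0 * t 3) * theta p (t 0 * t 4)) = C
  generalize ∏ m, (ellGamma q p (t m * z) * ellGamma q p (q * (t m * z⁻¹))) = B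
  generalize (ellGamma q p (q * (bigA t * z⁻¹)))⁻¹ = D, (ellGamma q p (bigA t * z))⁻¹ = E,
    theta q (z ^ 2) = Q
  field_simp

lemma regKernel_shift_sub {q p : ℂ} {t : Fin 5 → ℂ} (hq0 : q ≠ 0) (hp0 : p ≠ 0)
    (h : Admissible q p t) (h' : Admissible q p (shift q t))
    (h0 : ∀ m, m ≠ 0 → theta p (t 0 * t m) ≠ 0) (h14 : theta p (t 1 * t 4) ≠ 0) {z : ℂ}
    (hz : z ∈ regSet q p t) (hz' : z ∈ regSet q p (shift q t)) :
    regKernel q p (shift q t) z - regKernel q p t z =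
      -(certificate q p t z + certificate q p t z⁻¹) := by
  obtain ⟨hz0, hz⟩ := hz
  obtain ⟨-, hz'⟩ := hz'
  have hq := h.norm_q
  have hp := h.norm_p
  have hA := bigA_ne_zero h.ne_zero
  have n1 : (1 : Fin 5) ≠ 0 := by decide
  have n2 : (2 : Fin 5) ≠ 0 := by decide
  have n3 : (3 : Fin 5) ≠ 0 := by decide
  have n4 : (4 : Fin 5) ≠ 0 := by decide
  have ha (m : Fin 5) : ellGamma q p (q * (t m * z)) = theta p (t m * z) * ellGamma q p (t m * z) :=
    ellGamma_mul_left hq hp hq0 (hz (some m)).1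
  have hb (m : Fin 5) : ellGamma q p (q * (t m * z⁻¹)) =
      theta p (t m * z⁻¹) * ellGamma q p (t m * z⁻¹) :=
    ellGamma_mul_left hq hp hq0 (hz (some m)).2
  have hc (m : Fin 5) : ellGamma q p (q * bigA t * (t m)⁻¹) =
      theta p (bigA t * (t m)⁻¹) * ellGamma q p (bigA t * (t m)⁻¹) := by
    rw [mul_assoc]
    exact ellGamma_mul_left hq hp hq0 (h.num m)
  have e1 (y : ℂ) : node q p (shift q t) none * y = p * (bigA t * y⁻¹)⁻¹ := by
    rw [node, bigA_shift, mul_inv, mul_inv, inv_inv]; field_simp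
  have hG : (ellGamma q p (bigA t * z))⁻¹ =
      theta p (bigA t * z) * (ellGamma q p (q * (bigA t * z)))⁻¹ :=
    ellGamma_inv_eq_theta_mul hq hp hq0 (by
      have := (hz' none).2
      rwa [e1, inv_inv] at this)
  have hH : (ellGamma q p (bigA t * z⁻¹))⁻¹ =
      theta p (bigA t * z⁻¹) * (ellGamma q p (q * (bigA t * z⁻¹)))⁻¹ :=
    ellGamma_inv_eq_theta_mul hq hp hq0 (by
      have := (hz' none).1
      rwa [e1] at this)
  have hd (m : Fin 5) (hm : m ≠ 0) : (ellGamma q p (t 0 * t m))⁻¹ =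
      theta p (t 0 * t m) * (ellGamma q p (q * (t 0 * t m)))⁻¹ :=
    ellGamma_inv_eq_theta_mul hq hp hq0 (by
      have := h'.den 0 m (Fin.pos_of_ne_zero hm)
      rw [shift_zero, shift_of_ne q t hm] at this
      have e : q * p * (q * t 0 * t m)⁻¹ = p * (t 0 * t m)⁻¹ := by
        rw [mul_assoc q (t 0), mul_inv q]; field_simp
      rwa [e] at this)
  have hθ : theta q (z ^ 2) = -z ^ 2 * theta q (z ^ 2)⁻¹ := by
    rw [theta_inv hq (pow_ne_zero 2 hz0)]
    field_simp
  have key := theta_difference_identity hp hp0 (A := bigA t) (h.ne_zero 0) (h.ne_zero 1)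
    (h.ne_zero 2) (h.ne_zero 3) (h.ne_zero 4) hz0 (by rw [bigA, Fin.prod_univ_five]) h14
  simp only [div_eq_mul_inv] at key
  simp only [regKernel, certificate, prod_pairs]
  simp only [Fin.prod_univ_five, bigA_shift, shift_zero,
    shift_of_ne q t n1, shift_of_ne q t n2, shift_of_ne q t n3, shift_of_ne q t n4, inv_inv,
    inv_pow]
  have hc0 : q * bigA t * (q * t 0)⁻¹ = bigA t * (t 0)⁻¹ := by
    rw [mul_inv]; field_simp
  rw [hc0]
  simp only [hc]
  simp only [mul_assoc q]
  simp only [ha, hb, hG, hH, hd 1 n1, hd 2 n2, hd 3 n3, hd 4 n4, hθ]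
  have t1 := h0 1 n1
  have t2 := h0 2 n2
  have t3 := h0 3 n3
  have t4 := h0 4 n4
  generalize theta p (t 0 * t 1) = T1, theta p (t 0 * t 2) = T2, theta p (t 0 * t 3) = T3,
    theta p (t 0 * t 4) = T4 at *
  generalize theta q (z ^ 2)⁻¹ = Q, theta p (z ^ 2) = Z at *
  generalize theta p (t 0 * bigA t) = TA, theta p (bigA t * z) = TAz,
    theta p (bigA t * z⁻¹) = TAz', theta p (bigA t * (t 1)⁻¹) = TA1,
    theta p (bigA t * (t 2)⁻¹) = TA2, theta p (bigA t * (t 3)⁻¹) = TA3,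
    theta p (bigA t * (t 4)⁻¹) = TA4 at *
  generalize theta p (t 0 * z) = a0, theta p (t 1 * z) = a1, theta p (t 2 * z) = a2,
    theta p (t 3 * z) = a3, theta p (t 4 * z) = a4, theta p (t 0 * z⁻¹) = b0,
    theta p (t 1 * z⁻¹) = b1, theta p (t 2 * z⁻¹) = b2, theta p (t 3 * z⁻¹) = b3,
    theta p (t 4 * z⁻¹) = b4 at *
  clear ha hb hc hd hG hH hθ e1
  -- `W` collects the factors common to both kernels and to the certificate.
  set W := Q *
    (ellGamma q p (t 0 * z) * ellGamma q p (t 0 * z⁻¹) * ellGamma q p (bigA t * (t 0)⁻¹) *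
    (ellGamma q p (t 1 * z) * ellGamma q p (t 1 * z⁻¹) * ellGamma q p (bigA t * (t 1)⁻¹)) *
    (ellGamma q p (t 2 * z) * ellGamma q p (t 2 * z⁻¹) * ellGamma q p (bigA t * (t 2)⁻¹)) *
    (ellGamma q p (t 3 * z) * ellGamma q p (t 3 * z⁻¹) * ellGamma q p (bigA t * (t 3)⁻¹)) *
    (ellGamma q p (t 4 * z) * ellGamma q p (t 4 * z⁻¹) * ellGamma q p (bigA t * (t 4)⁻¹))) *
    ((ellGamma q p (q * (bigA t * z)))⁻¹ * (ellGamma q p (q * (bigA t * z⁻¹)))⁻¹) *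
    ((ellGamma q p (q * (t 0 * t 1)))⁻¹ * (ellGamma q p (q * (t 0 * t 2)))⁻¹ *
      (ellGamma q p (q * (t 0 * t 3)))⁻¹ * (ellGamma q p (q * (t 0 * t 4)))⁻¹) *
    ((ellGamma q p (t 1 * t 2))⁻¹ * (ellGamma q p (t 1 * t 3))⁻¹ * (ellGamma q p (t 1 * t 4))⁻¹ *
      ((ellGamma q p (t 2 * t 3))⁻¹ * (ellGamma q p (t 2 * t 4))⁻¹ *
        (ellGamma q p (t 3 * t 4))⁻¹)) with hW
  have hT : T1 * T2 * T3 * T4 ≠ 0 := by positivity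
  trans W * (Z * (a0 * b0 * (TA1 * TA2 * TA3 * TA4) - TAz * TAz' * (T1 * T2 * T3 * T4)))
  · rw [hW]; ring
  · have hTi : T1 * T2 * T3 * T4 * (T1 * T2 * T3 * T4)⁻¹ = 1 := mul_inv_cancel₀ hT
    rw [key, div_eq_mul_inv]
    generalize (T1 * T2 * T3 * T4)⁻¹ = Ti at *
    trans -(W * (t 0 * TA) * (z⁻¹ * (a0 * a1 * a2 * a3 * a4) * TAz' -
      z ^ 3 * (b0 * b1 * b2 * b3 * b4) * TAz) * (T1 * T2 * T3 * T4 * Ti))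
    · rw [hTi]; ring
    · rw [hW]; ring

/-- The parameters `t₁, …, t₅` and `p / A`, which govern the poles of `certificate`. -/
noncomputable def certNode (p : ℂ) (t : Fin 5 → ℂ) : Option (Fin 5) → ℂ
  | some m => t m
  | none => (bigA t)⁻¹ * p

/-- The set of `z ≠ 0` at which none of the denominators of `certificate` vanishes. -/
def certSet (q p : ℂ) (t : Fin 5 → ℂ) : Set ℂ :=
  {z | z ≠ 0 ∧ ∀ m, dPoch q p (certNode p t m * z⁻¹) ≠ 0 ∧
    dPoch q p (q * (certNode p t m * z)) ≠ 0}

lemma certNode_mem {q p : ℂ} (hq0 : q ≠ 0) (t : Fin 5 → ℂ) (m : Option (Fin 5)) (j k : ℕ) :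
    certNode p t m * q ^ j * p ^ k ∈ poleSet q p t ∪ poleSet q p (shift q t) := by
  cases m with
  | some m => exact Or.inl (Or.inl ⟨m, j, k, rfl⟩)
  | none =>
    refine Or.inr (Or.inr ⟨j, k, ?_⟩)
    rw [bigA_shift, certNode]
    field_simp
    ring

lemma mem_certSet {q p : ℂ} (hq : ‖q‖ < 1) (hp : ‖p‖ < 1) {t : Fin 5 → ℂ} {z : ℂ} (hz : z ≠ 0)
    (h1 : ∀ m (j k : ℕ), z ≠ certNode p t m * q ^ j * p ^ k)
    (h2 : ∀ m (j k : ℕ), z⁻¹ ≠ certNode p t m * q ^ (j + 1) * p ^ k) : z ∈ certSet q p t := by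
  refine ⟨hz, fun m => ⟨dPoch_ne_zero hq hp fun j k h => h1 m j k ?_,
    dPoch_ne_zero hq hp fun j k h => h2 m j k ?_⟩⟩
  · exact ((mul_inv_eq_one₀ hz).1 (by rw [← h]; ring)).symm
  · exact (eq_inv_of_mul_eq_one_left (by rw [← h]; ring)).symm

lemma isOpen_certSet {q p : ℂ} (hq : ‖q‖ < 1) (hp : ‖p‖ < 1) (t : Fin 5 → ℂ) :
    IsOpen (certSet q p t) := by
  have hc := (differentiable_dPoch hq hp).continuous
  rw [isOpen_iff_mem_nhds]
  rintro z ⟨hz, h⟩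
  have h1 : ∀ᶠ y in 𝓝 z, ∀ m, dPoch q p (certNode p t m * y⁻¹) ≠ 0 ∧
      dPoch q p (q * (certNode p t m * y)) ≠ 0 := by
    rw [eventually_all]
    intro m
    have c1 : ContinuousAt (fun y => dPoch q p (q * (certNode p t m * y))) z :=
      (hc.comp (continuous_const.mul (continuous_const.mul continuous_id))).continuousAt
    have c2 : ContinuousAt (fun y => dPoch q p (certNode p t m * y⁻¹)) z :=
      ContinuousAt.comp' hc.continuousAt (continuousAt_const.mul (continuousAt_inv₀ hz))
    exact (c2.eventually_ne (h m).1).and (c1.eventually_ne (h m).2)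
  filter_upwards [h1, isOpen_ne.mem_nhds hz] with y hy hy0 using ⟨hy0, hy⟩

lemma differentiableOn_certificate {q p : ℂ} (hq : ‖q‖ < 1) (hp : ‖p‖ < 1) (hq0 : q ≠ 0)
    {t : Fin 5 → ℂ} (ht : ∀ m, t m ≠ 0) :
    DifferentiableOn ℂ (fun z => certificate q p t z / z) (certSet q p t) := by
  rintro z ⟨hz, hreg⟩
  refine DifferentiableAt.differentiableWithinAt ?_
  have hA := bigA_ne_zero ht
  have hzi : z⁻¹ ≠ 0 := inv_ne_zero hz
  have hinv : DifferentiableAt ℂ (fun z : ℂ => z⁻¹) z := differentiableAt_inv hz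
  have d1 : DifferentiableAt ℂ (fun z => theta q (z⁻¹ ^ 2)) z :=
    (differentiableAt_theta hq (pow_ne_zero 2 hzi)).fun_comp' z (hinv.fun_pow 2)
  have l1 (c : ℂ) : DifferentiableAt ℂ (fun z => q * (c * z)) z := by fun_prop
  have l2 (c : ℂ) : DifferentiableAt ℂ (fun z => c * z⁻¹) z := hinv.const_mul c
  have d3 (m : Fin 5) : DifferentiableAt ℂ (fun z => ellGamma q p (q * (t m * z)) *
      ellGamma q p (t m * z⁻¹)) z :=
    (differentiableAt_ellGamma_comp hq hp (h := fun z => q * (t m * z)) (l1 _)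
      (mul_ne_zero hq0 (mul_ne_zero (ht m) hz)) (hreg (some m)).2).fun_mul
      (differentiableAt_ellGamma_comp hq hp (h := fun z => t m * z⁻¹) (l2 _)
      (mul_ne_zero (ht m) hzi) (hreg (some m)).1)
  have d4 : DifferentiableAt ℂ (fun z => (ellGamma q p (q * (bigA t * z)))⁻¹) z :=
    differentiableAt_ellGamma_inv_comp hq hp (h := fun z => q * (bigA t * z)) (l1 _)
      (mul_ne_zero hq0 (mul_ne_zero hA hz)) (by
        have := (hreg none).1
        have e : q * p * (q * (bigA t * z))⁻¹ = certNode p t none * z⁻¹ := by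
          rw [certNode]; field_simp
        rwa [e])
  have d5 : DifferentiableAt ℂ (fun z => (ellGamma q p (bigA t * z⁻¹))⁻¹) z :=
    differentiableAt_ellGamma_inv_comp hq hp (h := fun z => bigA t * z⁻¹) (l2 _)
      (mul_ne_zero hA hzi) (by
        have := (hreg none).2
        have e : q * p * (bigA t * z⁻¹)⁻¹ = q * (certNode p t none * z) := by
          rw [certNode]; field_simp
        rwa [e])
  have d3' := DifferentiableAt.fun_finsetProd (u := Finset.univ) fun m _ => d3 m
  exact ((((hinv.fun_mul d1).fun_mul d3').fun_mul (d4.fun_mul d5)).const_mul _).fun_div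
    differentiableAt_id hz

/-- The integral of the kernel is unchanged under `t₁ ↦ q t₁`: the difference of the two kernels
is `g(z / q) - g(z)` with `g = certificate`, and no pole of `g` lies between the cycle
and its dilation by `q⁻¹`. -/
lemma IsSeparatingCycle.integral_shift {K : Set ℂ} {Λ : (ℂ → ℂ) → ℂ} {q p : ℂ}
    {t : Fin 5 → ℂ} (hΛ : IsSeparatingCycle (poleSet q p t ∪ poleSet q p (shift q t)) K Λ)
    (hq0 : q ≠ 0) (hp0 : p ≠ 0) (h : Admissible q p t) (h' : Admissible q p (shift q t))
    (h0 : ∀ m, m ≠ 0 → theta p (t 0 * t m) ≠ 0) (h14 : theta p (t 1 * t 4) ≠ 0) :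
    (Λ fun z => regKernel q p (shift q t) z / z) = Λ fun z => regKernel q p t z / z := by
  have hq := h.norm_q
  have hp := h.norm_p
  have hc := hΛ.isCycle
  have hK0 : ∀ z ∈ K, z ≠ 0 := fun z hz => by rintro rfl; exact hΛ.zero_mem.1 hz
  have hKr : K ⊆ regSet q p t := hΛ.subset_regSet subset_union_left hq hp
  have hKr' : K ⊆ regSet q p (shift q t) := hΛ.subset_regSet subset_union_right hq hp
  have hmem := certNode_mem (p := p) hq0 t
  have hmem' (m : Option (Fin 5)) (j k : ℕ) :
      certNode p t m * q ^ j * p ^ k ∈ sepSet K Λ := hΛ.subset (hmem m j k)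
  have hinv {z : ℂ} (hz : z ≠ 0) (hs : z⁻¹ ∈ sepSet K Λ) : z ∉ K ∧ wind Λ z = 0 := by
    simpa using hs.2.2 (inv_ne_zero hz)
  have hKc : K ⊆ certSet q p t := fun z hz => mem_certSet hq hp (hK0 z hz)
    (fun m j k e => (hmem' m j k).1 (e ▸ hz))
    fun m j k e => (hinv (hK0 z hz) (e ▸ hmem' m (j + 1) k)).1 hz
  have hKc' : (fun z => z / q) '' K ⊆ certSet q p t := by
    rintro _ ⟨z, hz, rfl⟩
    refine mem_certSet hq hp (div_ne_zero (hK0 z hz) hq0) (fun m j k e => ?_) fun m j k e => ?_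
    · refine (hmem' m (j + 1) k).1 ?_
      convert hz using 1
      rw [(div_eq_iff hq0).1 e]; ring
    · refine (hinv (hK0 z hz) ?_).1 hz
      convert hmem' m j k using 1
      rw [inv_div, div_eq_mul_inv] at e
      have : q * z⁻¹ = q * (certNode p t m * q ^ j * p ^ k) := by rw [e]; ring
      exact mul_left_cancel₀ hq0 this
  have hd := differentiableOn_certificate hq hp hq0 h.ne_zero
  have hscale := hc.eq_of_wind_eq (hc.scale hq0) (isOpen_certSet hq hp t) hKc hKc' hd (by
    intro w hw
    rw [wind_scale Λ hq0]
    by_cases hw0 : w = 0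
    · rw [hw0, mul_zero]
    by_contra hne
    refine hw (mem_certSet hq hp hw0 (fun m j k e => hne ?_) fun m j k e => hne ?_)
    · have e' : q * w = certNode p t m * q ^ (j + 1) * p ^ k := by rw [e]; ring
      rw [e', (hmem' m (j + 1) k).2.1, e, (hmem' m j k).2.1]
    · have e' : (q * w)⁻¹ = certNode p t m * q ^ j * p ^ k := by
        rw [mul_inv, e]; field_simp; ring
      rw [(hinv hw0 (e ▸ hmem' m (j + 1) k)).2,
        (hinv (mul_ne_zero hq0 hw0) (e' ▸ hmem' m j k)).2])
  have c1 := (differentiableOn_regKernel h).continuousOn.mono hKr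
  have c2 := (differentiableOn_regKernel h').continuousOn.mono hKr'
  have c3 := hd.continuousOn.mono hKc
  have c4 : ContinuousOn (fun z => q⁻¹ * (certificate q p t (z / q) / (z / q))) K :=
    continuousOn_const.mul ((hd.continuousOn.mono hKc').comp (by fun_prop) (mapsTo_image _ _))
  rw [← sub_eq_zero, ← hc.map_sub c2 c1]
  rw [← sub_eq_zero, ← hc.map_sub c3 c4] at hscale
  rw [← neg_eq_zero, ← neg_one_mul, ← hc.map_smul _ _ (c2.fun_sub c1), ← hscale]
  refine hc.congr (continuousOn_const.mul (c2.fun_sub c1)) fun z hz => ?_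
  have e := regKernel_shift_sub hq0 hp0 h h' h0 h14 (hKr hz) (hKr' hz)
  rw [certificate_inv hq hq0 t (hK0 z hz)] at e
  have hz0 := hK0 z hz
  simp only [← sub_div, e]
  generalize certificate q p t z = c, certificate q p t (z / q) = d
  field_simp
  ring

lemma regKernel_comm {q p : ℂ} (hq : ‖q‖ < 1) (hp : ‖p‖ < 1) (t : Fin 5 → ℂ) {z : ℂ}
    (hz : z ≠ 0) : regKernel q p t z = regKernel p q t z := by
  have hz2 : z ^ 2 ≠ 0 := pow_ne_zero 2 hz
  have e (u : ℂ) : ellGamma q p u = ellGamma p q u := by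
    rw [ellGamma_eq, ellGamma_eq, dPoch_comm q p u, dPoch_comm q p, mul_comm q p]
  simp only [regKernel, e, theta_inv hq hz2, theta_inv hp hz2]
  ring

lemma poleSet_comm (q p : ℂ) (t : Fin 5 → ℂ) : poleSet q p t = poleSet p q t := by
  ext w
  constructor <;>
  · rintro (⟨m, j, k, rfl⟩ | ⟨j, k, rfl⟩)
    · exact Or.inl ⟨m, k, j, by ring⟩
    · exact Or.inr ⟨k, j, by ring⟩

lemma Admissible.symm {q p : ℂ} {t : Fin 5 → ℂ} (h : Admissible q p t) : Admissible p q t :=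
  ⟨h.norm_p, h.norm_q, h.ne_zero, fun m => dPoch_comm q p _ ▸ h.num m,
    fun m s hms => by rw [dPoch_comm, mul_comm p q]; exact h.den m s hms⟩

/-! ### Generic parameters -/

/-- `x` is not an integral monomial in `q` and `p`. -/
def NonRes (q p x : ℂ) : Prop := ∀ a b : ℤ, x * q ^ a * p ^ b ≠ 1

namespace NonRes

variable {q p x : ℂ}

lemma symm (h : NonRes q p x) : NonRes p q x := fun a b e => h b a (by rw [← e]; ring)

lemma inv (h : NonRes q p x) : NonRes q p x⁻¹ := fun a b e => h (-a) (-b) (by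
  rw [zpow_neg, zpow_neg, ← inv_inj, mul_inv, mul_inv, inv_inv, inv_inv, inv_one, e])

lemma mul_zpow (h : NonRes q p x) (hq0 : q ≠ 0) (hp0 : p ≠ 0) (a b : ℤ) :
    NonRes q p (x * q ^ a * p ^ b) := fun c d e => h (a + c) (b + d) (by
  rw [zpow_add₀ hq0, zpow_add₀ hp0, ← e]; ring)

lemma dPoch_ne_zero (h : NonRes q p x) (hq : ‖q‖ < 1) (hp : ‖p‖ < 1) : dPoch q p x ≠ 0 :=
  EllipticBeta.dPoch_ne_zero hq hp fun j k => mod_cast h j k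

lemma dPoch_mul_inv_ne_zero (h : NonRes q p x) (hq : ‖q‖ < 1) (hp : ‖p‖ < 1) (hq0 : q ≠ 0)
    (hp0 : p ≠ 0) : dPoch q p (q * p * x⁻¹) ≠ 0 := by
  have := (h.inv.mul_zpow hq0 hp0 1 1).dPoch_ne_zero hq hp
  rw [zpow_one, zpow_one] at this
  convert this using 2
  ring

lemma ellGamma_ne_zero (h : NonRes q p x) (hq : ‖q‖ < 1) (hp : ‖p‖ < 1) (hq0 : q ≠ 0)
    (hp0 : p ≠ 0) : ellGamma q p x ≠ 0 := by
  rw [ellGamma_eq]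
  exact div_ne_zero (h.dPoch_mul_inv_ne_zero hq hp hq0 hp0) (h.dPoch_ne_zero hq hp)

lemma theta_ne_zero (h : NonRes q p x) (hp : ‖p‖ < 1) (hx : x ≠ 0) : theta p x ≠ 0 := by
  intro e
  obtain ⟨n, hn⟩ := exists_zpow_of_theta_eq_zero hp hx e
  refine h 0 (-n) ?_
  rw [zpow_zero, mul_one, zpow_neg, ← hn, mul_inv_cancel₀ hx]

end NonRes

/-- The Laurent monomial `∏ tₘ ^ nₘ`. -/
noncomputable def mono (t : Fin 5 → ℂ) (n : Fin 5 → ℤ) : ℂ := ∏ m, t m ^ n m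

section Mono

variable {t : Fin 5 → ℂ}

lemma mono_ne_zero (ht : ∀ m, t m ≠ 0) (n : Fin 5 → ℤ) : mono t n ≠ 0 :=
  Finset.prod_ne_zero_iff.2 fun m _ => zpow_ne_zero _ (ht m)

lemma mono_add (ht : ∀ m, t m ≠ 0) (n k : Fin 5 → ℤ) : mono t (n + k) = mono t n * mono t k := by
  simp only [mono, Pi.add_apply, zpow_add₀ (ht _), Finset.prod_mul_distrib]

lemma mono_sub (ht : ∀ m, t m ≠ 0) (n k : Fin 5 → ℤ) :
    mono t (n - k) = mono t n * (mono t k)⁻¹ := by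
  simp only [mono, Pi.sub_apply, zpow_sub₀ (ht _), div_eq_mul_inv, Finset.prod_mul_distrib,
    Finset.prod_inv_distrib]

lemma mono_single (t : Fin 5 → ℂ) (m : Fin 5) : mono t (Pi.single m 1) = t m := by
  rw [mono, Finset.prod_eq_single m (fun s _ hs => by rw [Pi.single_eq_of_ne hs, zpow_zero])
    (by simp), Pi.single_eq_same, zpow_one]

lemma mono_one (t : Fin 5 → ℂ) : mono t 1 = bigA t := by
  simp [mono, bigA]

lemma mono_update (t : Fin 5 → ℂ) (c : ℂ) (n : Fin 5 → ℤ) :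
    mono (Function.update t 0 c) n = c ^ n 0 * (t 1 ^ n 1 * t 2 ^ n 2 * t 3 ^ n 3 * t 4 ^ n 4) := by
  rw [mono, Fin.prod_univ_five, Function.update_self,
    Function.update_of_ne (by decide), Function.update_of_ne (by decide),
    Function.update_of_ne (by decide), Function.update_of_ne (by decide)]
  ring

end Mono

/-- Parameters without multiplicative relations, except that a power of `t₁ t₂` may be
a monomial in `q` and `p`. -/
structure Semigeneric (q p : ℂ) (t : Fin 5 → ℂ) : Prop where
  norm_q : ‖q‖ < 1
  norm_p : ‖p‖ < 1
  q_ne_zero : q ≠ 0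
  p_ne_zero : p ≠ 0
  ne_zero : ∀ m, t m ≠ 0
  nonRes : ∀ n : Fin 5 → ℤ, ¬(n 0 = n 1 ∧ n 2 = 0 ∧ n 3 = 0 ∧ n 4 = 0) → NonRes q p (mono t n)

/-- Parameters without multiplicative relations involving some of the `tₘ`. -/
structure Generic (q p : ℂ) (t : Fin 5 → ℂ) : Prop where
  norm_q : ‖q‖ < 1
  norm_p : ‖p‖ < 1
  q_ne_zero : q ≠ 0
  p_ne_zero : p ≠ 0
  ne_zero : ∀ m, t m ≠ 0
  nonRes : ∀ n : Fin 5 → ℤ, n ≠ 0 → NonRes q p (mono t n)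

namespace Generic

variable {q p : ℂ} {t : Fin 5 → ℂ}

lemma symm (h : Generic q p t) : Generic p q t :=
  ⟨h.norm_p, h.norm_q, h.p_ne_zero, h.q_ne_zero, h.ne_zero, fun n hn => (h.nonRes n hn).symm⟩

lemma semigeneric (h : Generic q p t) : Semigeneric q p t where
  __ := h
  nonRes n hn := h.nonRes n fun e => hn (by simp [e])

/-- The parameters at which `t₁ t₂ = 1`, where the contour is pinched. -/
lemma semigeneric_update (h : Generic q p t) :
    Semigeneric q p (Function.update t 0 (t 1)⁻¹) where
  __ := h
  ne_zero m := by
    by_cases hm : m = 0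
    · rw [hm, Function.update_self]; exact inv_ne_zero (h.ne_zero 1)
    · rw [Function.update_of_ne hm]; exact h.ne_zero m
  nonRes n hn := by
    have e : mono (Function.update t 0 (t 1)⁻¹) n = mono t ![0, n 1 - n 0, n 2, n 3, n 4] := by
      rw [mono_update, mono, Fin.prod_univ_five]
      simp only [Matrix.cons_val, zpow_zero, zpow_sub₀ (h.ne_zero 1), inv_zpow]
      ring
    rw [e]
    refine h.nonRes _ fun h0 => hn ?_
    have h1 := congrFun h0 1
    have h2 := congrFun h0 2
    have h3 := congrFun h0 3
    have h4 := congrFun h0 4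
    simp only [Matrix.cons_val, Pi.zero_apply] at h1 h2 h3 h4
    omega

lemma shift (h : Generic q p t) (a b : ℤ) : Generic q p (shift (q ^ a * p ^ b) t) where
  __ := h
  ne_zero m := by
    by_cases hm : m = 0
    · rw [hm, shift_zero]
      exact mul_ne_zero (mul_ne_zero (zpow_ne_zero _ h.q_ne_zero) (zpow_ne_zero _ h.p_ne_zero))
        (h.ne_zero 0)
    · rw [shift_of_ne _ _ hm]; exact h.ne_zero m
  nonRes n hn := by
    have e : mono (EllipticBeta.shift (q ^ a * p ^ b) t) n =
        mono t n * q ^ (a * n 0) * p ^ (b * n 0) := by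
      rw [EllipticBeta.shift, mono_update, mono, Fin.prod_univ_five]
      simp only [mul_zpow, zpow_mul]
      ring
    rw [e]
    exact (h.nonRes n hn).mul_zpow h.q_ne_zero h.p_ne_zero _ _

end Generic

namespace Semigeneric

variable {q p : ℂ} {t : Fin 5 → ℂ}

lemma pair (h : Semigeneric q p t) {m s : Fin 5} (h1 : ¬(m = 0 ∧ s = 1)) (h2 : ¬(m = 1 ∧ s = 0)) :
    NonRes q p (t m * t s) := by
  have := h.nonRes (Pi.single m 1 + Pi.single s 1) (by revert m s; decide)
  rwa [mono_add h.ne_zero, mono_single, mono_single] at this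

lemma quot (h : Semigeneric q p t) {m s : Fin 5} (hms : m ≠ s) : NonRes q p (t m * (t s)⁻¹) := by
  have := h.nonRes (Pi.single m 1 - Pi.single s 1) (by revert m s; decide)
  rwa [mono_sub h.ne_zero, mono_single, mono_single] at this

lemma bigA_mul (h : Semigeneric q p t) (m : Fin 5) : NonRes q p (bigA t * t m) := by
  have := h.nonRes (1 + Pi.single m 1) (by revert m; decide)
  rwa [mono_add h.ne_zero, mono_single, mono_one] at this

lemma bigA_quot (h : Semigeneric q p t) (m : Fin 5) : NonRes q p (bigA t * (t m)⁻¹) := by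
  have := h.nonRes (1 - Pi.single m 1) (by revert m; decide)
  rwa [mono_sub h.ne_zero, mono_single, mono_one] at this

lemma bigA_sq (h : Semigeneric q p t) : NonRes q p (bigA t * bigA t) := by
  have := h.nonRes (1 + 1) (by decide)
  rwa [mono_add h.ne_zero, mono_one] at this

lemma node_mul_node (h : Semigeneric q p t) (m s : Option (Fin 5))
    (h1 : ¬(m = some 0 ∧ s = some 1)) (h2 : ¬(m = some 1 ∧ s = some 0)) :
    NonRes q p (node q p t m * node q p t s) := by
  have hz {x : ℂ} (hx : NonRes q p x) := hx.mul_zpow h.q_ne_zero h.p_ne_zero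
  rcases m with _ | m <;> rcases s with _ | s
  · convert hz h.bigA_sq.inv 2 2 using 1
    simp only [node, mul_inv]; norm_cast; ring
  · convert hz (h.bigA_quot s).inv 1 1 using 1
    simp only [node, mul_inv, inv_inv, zpow_one]; ring
  · convert hz (h.bigA_quot m).inv 1 1 using 1
    simp only [node, mul_inv, inv_inv, zpow_one]; ring
  · exact h.pair (by simpa using h1) (by simpa using h2)

/-- Two points of `poleSet` are not inverse to each other, unless one is a multiple of `t₁` and
the other one of `t₂`. -/
lemma polePt_mul_polePt_ne_one (h : Semigeneric q p t)
    {i i' : Option (Fin 5) × ℕ × ℕ} (h1 : ¬(i.1 = some 0 ∧ i'.1 = some 1))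
    (h2 : ¬(i.1 = some 1 ∧ i'.1 = some 0)) : polePt q p t i * polePt q p t i' ≠ 1 := by
  have := h.node_mul_node i.1 i'.1 h1 h2 (i.2.1 + i'.2.1 : ℕ) (i.2.2 + i'.2.2 : ℕ)
  rw [zpow_natCast, zpow_natCast] at this
  intro e
  rw [← e] at this
  exact this (by simp only [polePt]; ring)

lemma node_ne_zero (h : Semigeneric q p t) (m : Option (Fin 5)) : node q p t m ≠ 0 := by
  cases m with
  | none =>
    exact mul_ne_zero (mul_ne_zero (inv_ne_zero (bigA_ne_zero h.ne_zero)) h.q_ne_zero) h.p_ne_zero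
  | some m => exact h.ne_zero m

lemma polePt_ne_zero (h : Semigeneric q p t) (i : Option (Fin 5) × ℕ × ℕ) :
    polePt q p t i ≠ 0 :=
  mul_ne_zero (mul_ne_zero (h.node_ne_zero _) (pow_ne_zero _ h.q_ne_zero))
    (pow_ne_zero _ h.p_ne_zero)

/-- The exceptional factor `Γ(t₁ t₂)` may be at the point `t₁ t₂ = 1`. -/
lemma admissible (h : Semigeneric q p t) (h01 : dPoch q p (q * p * (t 0 * t 1)⁻¹) ≠ 0) :
    Admissible q p t where
  norm_q := h.norm_q
  norm_p := h.norm_p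
  ne_zero := h.ne_zero
  num m := (h.bigA_quot m).dPoch_ne_zero h.norm_q h.norm_p
  den m s hms := by
    by_cases e : m = 0 ∧ s = 1
    · rw [e.1, e.2]; exact h01
    · exact (h.pair e (by rintro ⟨rfl, rfl⟩; exact absurd hms (by decide))).dPoch_mul_inv_ne_zero
        h.norm_q h.norm_p h.q_ne_zero h.p_ne_zero

end Semigeneric

namespace Generic

variable {q p : ℂ} {t : Fin 5 → ℂ}

lemma pair (h : Generic q p t) (m s : Fin 5) : NonRes q p (t m * t s) := by
  have := h.nonRes (Pi.single m 1 + Pi.single s 1) (by revert m s; decide)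
  rwa [mono_add h.ne_zero, mono_single, mono_single] at this

lemma admissible (h : Generic q p t) : Admissible q p t :=
  h.semigeneric.admissible ((h.pair 0 1).dPoch_mul_inv_ne_zero h.norm_q h.norm_p h.q_ne_zero
    h.p_ne_zero)

lemma node_mul_node (h : Generic q p t) (m s : Option (Fin 5)) :
    NonRes q p (node q p t m * node q p t s) := by
  by_cases h1 : m = some 0 ∧ s = some 1
  · rw [h1.1, h1.2]; exact h.pair 0 1
  by_cases h2 : m = some 1 ∧ s = some 0
  · rw [h2.1, h2.2]; exact h.pair 1 0
  exact h.semigeneric.node_mul_node m s h1 h2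

end Generic

/-! ### Existence of separating cycles -/

lemma finite_polePt {q p : ℂ} (hq : ‖q‖ < 1) (hp : ‖p‖ < 1) (t : Fin 5 → ℂ) {ε : ℝ} (hε : 0 < ε) :
    {w ∈ poleSet q p t | ε ≤ ‖w‖}.Finite := by
  have hlim (m : Option (Fin 5)) : ∃ J : ℕ, ∀ j k : ℕ, ε ≤ ‖polePt q p t (m, j, k)‖ →
      j < J ∧ k < J := by
    have l (r : ℂ) (hr : ‖r‖ < 1) : ∃ J, ∀ j ≥ J, ‖node q p t m‖ * ‖r‖ ^ j < ε := by
      have : Tendsto (fun J : ℕ => ‖node q p t m‖ * ‖r‖ ^ J) atTop (𝓝 (‖node q p t m‖ * 0)) :=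
        (tendsto_pow_atTop_nhds_zero_of_lt_one (norm_nonneg _) hr).const_mul _
      rw [mul_zero] at this
      exact eventually_atTop.1 (this.eventually_lt_const hε)
    obtain ⟨J₁, h1⟩ := l q hq
    obtain ⟨J₂, h2⟩ := l p hp
    refine ⟨max J₁ J₂, fun j k h => ⟨?_, ?_⟩⟩ <;> by_contra! hJ
    · refine absurd h (not_le.2 (lt_of_le_of_lt ?_ (h1 j ((le_max_left _ _).trans hJ))))
      simp only [polePt, norm_mul, norm_pow]
      exact mul_le_of_le_one_right (by positivity) (pow_le_one₀ (norm_nonneg _) hp.le)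
    · refine absurd h (not_le.2 (lt_of_le_of_lt ?_ (h2 k ((le_max_right _ _).trans hJ))))
      simp only [polePt, norm_mul, norm_pow]
      rw [mul_right_comm]
      exact mul_le_of_le_one_right (by positivity) (pow_le_one₀ (norm_nonneg _) hq.le)
  choose J hJ using hlim
  have : (⋃ m, (fun jk : ℕ × ℕ => polePt q p t (m, jk)) ''
      (Iio (J m) ×ˢ Iio (J m))).Finite :=
    finite_iUnion fun m => ((finite_Iio _).prod (finite_Iio _)).image _
  refine this.subset ?_
  rw [poleSet_eq_range]
  rintro _ ⟨⟨⟨m, j, k⟩, rfl⟩, hw⟩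
  exact mem_iUnion.2 ⟨m, (j, k), hJ m j k hw, rfl⟩

lemma exists_isSeparatingCycle {A : Set ℂ} (hA : ∀ ε > 0, {w ∈ A | ε ≤ ‖w‖}.Finite)
    (h0 : ∀ w ∈ A, w ≠ 0) (h1 : ∀ w ∈ A, ∀ w' ∈ A, w * w' ≠ 1) :
    ∃ K Λ, IsSeparatingCycle A K Λ := by
  have hB (R : ℝ) : {w ∈ Inv.inv '' A | ‖w‖ ≤ R}.Finite := by
    refine ((hA (max R 1)⁻¹ (by positivity)).image Inv.inv).subset ?_
    rintro _ ⟨⟨w, hw, rfl⟩, hR⟩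
    refine ⟨w, ⟨hw, ?_⟩, rfl⟩
    rw [norm_inv] at hR
    exact (inv_le_comm₀ (by positivity) (norm_pos_iff.2 (h0 w hw))).2 (hR.trans (le_max_left _ _))
  obtain ⟨K, Λ, hΛ, hz, hAΛ, hBΛ⟩ := exists_separating_cycle hA hB
    (by rintro ⟨w, hw, e⟩; exact h0 w hw (inv_eq_zero.1 e))
    (disjoint_left.2 (by
      rintro _ hw ⟨w', hw', rfl⟩
      exact h1 _ hw _ hw' (inv_mul_cancel₀ (h0 _ hw'))))
  exact ⟨K, Λ, hΛ, ⟨hz.1, hz.2, fun h => absurd rfl h⟩, fun w hw =>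
    ⟨(hAΛ w hw).1, (hAΛ w hw).2, fun _ => hBΛ _ ⟨w, hw, rfl⟩⟩⟩

lemma Generic.exists_isSeparatingCycle_shift {q p : ℂ} {t : Fin 5 → ℂ} (h : Generic q p t) :
    ∃ K Λ, IsSeparatingCycle (poleSet q p t ∪ poleSet q p (EllipticBeta.shift q t)) K Λ := by
  have hs : ∀ w ∈ poleSet q p t ∪ poleSet q p (EllipticBeta.shift q t),
      ∃ m, ∃ a b : ℤ, w = node q p t m * q ^ a * p ^ b := by
    have hq0 := h.q_ne_zero
    have hA := bigA_ne_zero h.ne_zero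
    rintro _ ((⟨m, j, k, rfl⟩ | ⟨j, k, rfl⟩) | (⟨m, j, k, rfl⟩ | ⟨j, k, rfl⟩))
    · exact ⟨some m, j, k, by simp [node]⟩
    · exact ⟨none, j, k, by simp only [node, zpow_natCast]; ring⟩
    · by_cases hm : m = 0
      · refine ⟨some 0, (j + 1 : ℕ), k, ?_⟩
        rw [hm, shift_zero, node, zpow_natCast, zpow_natCast]; ring
      · exact ⟨some m, j, k, by simp [node, shift_of_ne _ _ hm]⟩
    · refine ⟨none, (j : ℤ) - 1, k, ?_⟩
      rw [bigA_shift, node, zpow_sub₀ hq0, zpow_natCast, zpow_natCast, zpow_one]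
      field_simp
      ring
  refine exists_isSeparatingCycle (fun ε hε => ?_) (fun w hw => ?_) fun w hw w' hw' e => ?_
  · refine ((finite_polePt h.norm_q h.norm_p t hε).union
      (finite_polePt h.norm_q h.norm_p (EllipticBeta.shift q t) hε)).subset ?_
    rintro w ⟨hw | hw, h1⟩
    exacts [Or.inl ⟨hw, h1⟩, Or.inr ⟨hw, h1⟩]
  · obtain ⟨m, a, b, rfl⟩ := hs w hw
    exact mul_ne_zero (mul_ne_zero (h.semigeneric.node_ne_zero m) (zpow_ne_zero _ h.q_ne_zero))
      (zpow_ne_zero _ h.p_ne_zero)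
  · obtain ⟨m, a, b, rfl⟩ := hs w hw
    obtain ⟨m', a', b', rfl⟩ := hs w' hw'
    refine h.node_mul_node m m' (a + a') (b + b') ?_
    rw [zpow_add₀ h.q_ne_zero, zpow_add₀ h.p_ne_zero, ← e]
    ring

/-! ### Invariance of the integral under shifts of a parameter -/

open Classical in
/-- The integral of the kernel over some separating cycle (zero if there is none). -/
noncomputable def ellInt (q p : ℂ) (t : Fin 5 → ℂ) : ℂ :=
  if h : ∃ K Λ, IsSeparatingCycle (poleSet q p t) K Λ then
    h.choose_spec.choose fun z => regKernel q p t z / z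
  else 0

lemma IsSeparatingCycle.eq_ellInt {K : Set ℂ} {Λ : (ℂ → ℂ) → ℂ} {q p : ℂ} {t : Fin 5 → ℂ}
    (h : IsSeparatingCycle (poleSet q p t) K Λ) (ha : Admissible q p t) :
    (Λ fun z => regKernel q p t z / z) = ellInt q p t := by
  have hex : ∃ K Λ, IsSeparatingCycle (poleSet q p t) K Λ := ⟨K, Λ, h⟩
  rw [ellInt, dif_pos hex]
  exact h.integral_eq hex.choose_spec.choose_spec ha

namespace Generic

variable {q p : ℂ} {t : Fin 5 → ℂ}

lemma exists_cycle (h : Generic q p t) : ∃ K Λ, IsSeparatingCycle (poleSet q p t) K Λ := by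
  obtain ⟨K, Λ, hΛ⟩ := h.exists_isSeparatingCycle_shift
  exact ⟨K, Λ, hΛ.mono subset_union_left⟩

lemma ellInt_comm (h : Generic q p t) : ellInt q p t = ellInt p q t := by
  obtain ⟨K, Λ, hΛ⟩ := h.exists_cycle
  have hΛ' : IsSeparatingCycle (poleSet p q t) K Λ := by rwa [poleSet_comm]
  rw [← hΛ.eq_ellInt h.admissible, ← hΛ'.eq_ellInt h.admissible.symm]
  have hK := hΛ.subset_regSet Subset.rfl h.norm_q h.norm_p
  refine hΛ.isCycle.congr ((differentiableOn_regKernel h.admissible).continuousOn.mono hK)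
    fun z hz => ?_
  simp only [regKernel_comm h.norm_q h.norm_p t (hK hz).1]

lemma ellInt_shift_q (h : Generic q p t) : ellInt q p (EllipticBeta.shift q t) = ellInt q p t := by
  obtain ⟨K, Λ, hΛ⟩ := h.exists_isSeparatingCycle_shift
  have h' : Generic q p (EllipticBeta.shift q t) := by simpa using h.shift 1 0
  have hne (m s : Fin 5) : theta p (t m * t s) ≠ 0 :=
    (h.pair m s).theta_ne_zero h.norm_p (mul_ne_zero (h.ne_zero m) (h.ne_zero s))
  rw [← (hΛ.mono subset_union_left).eq_ellInt h.admissible,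
    ← (hΛ.mono subset_union_right).eq_ellInt h'.admissible]
  exact hΛ.integral_shift h.q_ne_zero h.p_ne_zero h.admissible h'.admissible
    (fun m _ => hne 0 m) (hne 1 4)

lemma ellInt_shift_p (h : Generic q p t) : ellInt q p (EllipticBeta.shift p t) = ellInt q p t := by
  have h' : Generic q p (EllipticBeta.shift p t) := by simpa using h.shift 0 1
  rw [h'.ellInt_comm, h.ellInt_comm, h.symm.ellInt_shift_q]

lemma ellInt_shift (h : Generic q p t) (a b : ℤ) :
    ellInt q p (EllipticBeta.shift (q ^ a * p ^ b) t) = ellInt q p t := by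
  have hss (c d : ℂ) :
      EllipticBeta.shift c (EllipticBeta.shift d t) = EllipticBeta.shift (c * d) t := by
    rw [EllipticBeta.shift, shift_zero, EllipticBeta.shift, EllipticBeta.shift,
      Function.update_idem, mul_assoc]
  have hq (a b : ℤ) : ellInt q p (EllipticBeta.shift (q ^ (a + 1) * p ^ b) t) =
      ellInt q p (EllipticBeta.shift (q ^ a * p ^ b) t) := by
    rw [← (h.shift a b).ellInt_shift_q, hss, zpow_add_one₀ h.q_ne_zero]
    ring_nf
  have hp (a b : ℤ) : ellInt q p (EllipticBeta.shift (q ^ a * p ^ (b + 1)) t) =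
      ellInt q p (EllipticBeta.shift (q ^ a * p ^ b) t) := by
    rw [← (h.shift a b).ellInt_shift_p, hss, zpow_add_one₀ h.p_ne_zero]
    ring_nf
  have hconst (f : ℤ → ℂ) (hf : ∀ a, f (a + 1) = f a) (a : ℤ) : f a = f 0 := by
    induction a using Int.induction_on with
    | zero => rfl
    | succ i ih => rw [hf, ih]
    | pred i ih => rw [← hf, sub_add_cancel, ih]
  rw [hconst (fun a => ellInt q p (EllipticBeta.shift (q ^ a * p ^ b) t)) fun a => hq a b,
    hconst (fun b => ellInt q p (EllipticBeta.shift (q ^ (0 : ℤ) * p ^ b) t)) (hp 0)]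
  simp [EllipticBeta.shift]

end Generic

/-! ### The residue of the kernel at a parameter -/

lemma qPoch_self_ne_zero {q : ℂ} (hq : ‖q‖ < 1) : qPoch q q ≠ 0 :=
  qPoch_ne_zero hq fun j h => by
    have h1 : ‖q ^ (j + 1)‖ < 1 := by
      rw [norm_pow]; exact pow_lt_one₀ (norm_nonneg _) hq (by omega)
    rw [pow_succ', h, norm_one] at h1
    exact lt_irrefl _ h1

lemma dPoch_mul_self_ne_zero {q p : ℂ} (hq : ‖q‖ < 1) (hp : ‖p‖ < 1) : dPoch q p (q * p) ≠ 0 :=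
  dPoch_ne_zero hq hp fun j k h => by
    have h1 : ‖q ^ (j + 1)‖ * ‖p ^ (k + 1)‖ < 1 := by
      rw [norm_pow, norm_pow]
      exact mul_lt_one_of_nonneg_of_lt_one_left (by positivity)
        (pow_lt_one₀ (norm_nonneg _) hq (by omega)) (pow_le_one₀ (norm_nonneg _) hp.le)
    rw [← norm_mul, show q ^ (j + 1) * p ^ (k + 1) = 1 by rw [← h]; ring, norm_one] at h1
    exact lt_irrefl _ h1

/-- The double product `dPoch q p x` without its factor `1 - x`. -/
noncomputable def dPochTail (q p x : ℂ) : ℂ := qPoch (p * x) p * dPoch q p (q * x)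

lemma dPoch_eq_one_sub_mul {q p : ℂ} (hq : ‖q‖ < 1) (hp : ‖p‖ < 1) (x : ℂ) :
    dPoch q p x = (1 - x) * dPochTail q p x := by
  rw [dPoch_eq_qPoch_mul hq hp, qPoch_eq_mul hp, dPochTail, mul_assoc]

lemma dPoch_one {q p : ℂ} (hq : ‖q‖ < 1) (hp : ‖p‖ < 1) : dPoch q p 1 = 0 := by
  rw [dPoch_eq_one_sub_mul hq hp, sub_self, zero_mul]

lemma dPochTail_one {q p : ℂ} (hq : ‖q‖ < 1) (hp : ‖p‖ < 1) :
    dPochTail q p 1 = qPoch q q * qPoch p p * dPoch q p (q * p) := by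
  rw [dPochTail, mul_one, mul_one, dPoch_eq_qPoch_mul' hq hp q, mul_comm p q]
  ring

lemma differentiable_dPochTail {q p : ℂ} (hq : ‖q‖ < 1) (hp : ‖p‖ < 1) :
    Differentiable ℂ (dPochTail q p) :=
  ((differentiable_qPoch hp).comp (by fun_prop : Differentiable ℂ fun x => p * x)).mul
    ((differentiable_dPoch hq hp).comp (by fun_prop : Differentiable ℂ fun x => q * x))

lemma prod_Ioi_zero (f : Fin 5 → ℂ) :
    ∏ m ∈ Finset.Ioi (0 : Fin 5), f m = f 1 * f 2 * f 3 * f 4 := by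
  rw [show Finset.Ioi (0 : Fin 5) = {1, 2, 3, 4} by decide]
  simp
  ring

/-- The product of `z - t₁` and of the integrand `ρ(z) / z`, without the removable singularity
at `t₁`. -/
noncomputable def regPart (q p : ℂ) (t : Fin 5 → ℂ) (z : ℂ) : ℂ :=
  theta p (z ^ 2) * theta q (z ^ 2)⁻¹ *
    (ellGamma q p (t 0 * z) * (dPoch q p (q * p * (t 0 * z⁻¹)⁻¹) / dPochTail q p (t 0 * z⁻¹)) *
      ellGamma q p (bigA t * (t 0)⁻¹) *
      ∏ m ∈ Finset.Ioi 0, (ellGamma q p (t m * z) * ellGamma q p (t m * z⁻¹) *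
        ellGamma q p (bigA t * (t m)⁻¹))) *
    ((ellGamma q p (bigA t * z))⁻¹ * (ellGamma q p (bigA t * z⁻¹))⁻¹ *
      ∏ m, ∏ s ∈ Finset.Ioi m, (ellGamma q p (t m * t s))⁻¹)

lemma regKernel_div_eq {q p : ℂ} (hq : ‖q‖ < 1) (hp : ‖p‖ < 1) (t : Fin 5 → ℂ) {z : ℂ}
    (hz : z ≠ 0) : regKernel q p t z / z = regPart q p t z * (z - t 0)⁻¹ := by
  have e : ellGamma q p (t 0 * z⁻¹) / z =
      dPoch q p (q * p * (t 0 * z⁻¹)⁻¹) / dPochTail q p (t 0 * z⁻¹) * (z - t 0)⁻¹ := by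
    have h2 : z - t 0 = (1 - t 0 * z⁻¹) * z := by field_simp
    rw [ellGamma_eq, dPoch_eq_one_sub_mul hq hp (t 0 * z⁻¹), h2]
    generalize dPoch q p (q * p * (t 0 * z⁻¹)⁻¹) = D, dPochTail q p (t 0 * z⁻¹) = E,
      1 - t 0 * z⁻¹ = u
    ring
  rw [regKernel, regPart, ← Finset.mul_prod_erase Finset.univ _ (Finset.mem_univ (0 : Fin 5)),
    show Finset.univ.erase (0 : Fin 5) = Finset.Ioi 0 by decide]
  generalize (∏ m ∈ Finset.Ioi (0 : Fin 5), (ellGamma q p (t m * z) * ellGamma q p (t m * z⁻¹) *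
        ellGamma q p (bigA t * (t m)⁻¹))) = B
  generalize ((ellGamma q p (bigA t * z))⁻¹ * (ellGamma q p (bigA t * z⁻¹))⁻¹ *
      ∏ m, ∏ s ∈ Finset.Ioi m, (ellGamma q p (t m * t s))⁻¹) = C
  generalize theta p (z ^ 2) * theta q (z ^ 2)⁻¹ = T
  linear_combination (T * (ellGamma q p (t 0 * z) * ellGamma q p (bigA t * (t 0)⁻¹) * B) * C) * e

/-- The set of `z ≠ 0` at which no denominator of `regPart` vanishes. -/
def nearSet (q p : ℂ) (t : Fin 5 → ℂ) : Set ℂ :=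
  {z | z ≠ 0 ∧ dPochTail q p (t 0 * z⁻¹) ≠ 0 ∧ ∀ m, dPoch q p (node q p t m * z) ≠ 0 ∧
    (m ≠ some 0 → dPoch q p (node q p t m * z⁻¹) ≠ 0)}

lemma isOpen_nearSet {q p : ℂ} (hq : ‖q‖ < 1) (hp : ‖p‖ < 1) (t : Fin 5 → ℂ) :
    IsOpen (nearSet q p t) := by
  have hc := (differentiable_dPoch hq hp).continuous
  have hc' := (differentiable_dPochTail hq hp).continuous
  rw [isOpen_iff_mem_nhds]
  rintro z ⟨hz, h0, h⟩
  have h1 : ∀ᶠ y in 𝓝 z, ∀ m, dPoch q p (node q p t m * y) ≠ 0 ∧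
      (m ≠ some 0 → dPoch q p (node q p t m * y⁻¹) ≠ 0) := by
    rw [eventually_all]
    intro m
    have c1 : ContinuousAt (fun y => dPoch q p (node q p t m * y)) z :=
      (hc.comp (continuous_const.mul continuous_id)).continuousAt
    have c2 : ContinuousAt (fun y => dPoch q p (node q p t m * y⁻¹)) z :=
      ContinuousAt.comp' hc.continuousAt (continuousAt_const.mul (continuousAt_inv₀ hz))
    refine (c1.eventually_ne (h m).1).and ?_
    by_cases hm : m = some 0
    · exact Eventually.of_forall fun y hy => absurd hm hy
    · filter_upwards [c2.eventually_ne ((h m).2 hm)] with y hy _ using hy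
  have c3 : ContinuousAt (fun y => dPochTail q p (t 0 * y⁻¹)) z :=
    ContinuousAt.comp' hc'.continuousAt (continuousAt_const.mul (continuousAt_inv₀ hz))
  filter_upwards [h1, isOpen_ne.mem_nhds hz, c3.eventually_ne h0] with y hy hy0 hy1
    using ⟨hy0, hy1, hy⟩

lemma nearSet_sdiff_subset {q p : ℂ} (hq : ‖q‖ < 1) (hp : ‖p‖ < 1) (t : Fin 5 → ℂ) :
    nearSet q p t \ {t 0} ⊆ regSet q p t := by
  rintro z ⟨⟨hz, h0, h⟩, hzt⟩
  refine ⟨hz, fun m => ⟨(h m).1, ?_⟩⟩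
  by_cases hm : m = some 0
  · rw [hm, node, dPoch_eq_one_sub_mul hq hp]
    refine mul_ne_zero (fun e => hzt ?_) h0
    exact ((mul_inv_eq_one₀ hz).1 (sub_eq_zero.1 e).symm).symm
  · exact (h m).2 hm

lemma differentiableOn_regPart {q p : ℂ} {t : Fin 5 → ℂ} (h : Admissible q p t) :
    DifferentiableOn ℂ (regPart q p t) (nearSet q p t) := by
  rintro z ⟨hz, h0, hreg⟩
  refine DifferentiableAt.differentiableWithinAt ?_
  have hq := h.norm_q
  have hp := h.norm_p
  have hA := bigA_ne_zero h.ne_zero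
  have hz2 : z ^ 2 ≠ 0 := pow_ne_zero 2 hz
  have hpow : DifferentiableAt ℂ (fun z : ℂ => z ^ 2) z := by fun_prop
  have hinv : DifferentiableAt ℂ (fun z : ℂ => z⁻¹) z := differentiableAt_inv hz
  have d1 : DifferentiableAt ℂ (fun z => theta p (z ^ 2)) z :=
    (differentiableAt_theta hp hz2).fun_comp' z hpow
  have d2 : DifferentiableAt ℂ (fun z => theta q (z ^ 2)⁻¹) z :=
    (differentiableAt_theta hq (inv_ne_zero hz2)).fun_comp' z (hpow.inv hz2)
  have l1 (c : ℂ) : DifferentiableAt ℂ (fun z => c * z) z := by fun_prop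
  have l2 (c : ℂ) : DifferentiableAt ℂ (fun z => c * z⁻¹) z := hinv.const_mul c
  have d3 (m : Fin 5) (hm : m ∈ Finset.Ioi (0 : Fin 5)) :
      DifferentiableAt ℂ (fun z => ellGamma q p (t m * z) *
      ellGamma q p (t m * z⁻¹) * ellGamma q p (bigA t * (t m)⁻¹)) z :=
    ((differentiableAt_ellGamma_comp hq hp (h := fun z => t m * z) (l1 _)
      (mul_ne_zero (h.ne_zero m) hz) (hreg (some m)).1).fun_mul
      (differentiableAt_ellGamma_comp hq hp (h := fun z => t m * z⁻¹) (l2 _)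
      (mul_ne_zero (h.ne_zero m) (inv_ne_zero hz)) ((hreg (some m)).2
        fun e => (Finset.mem_Ioi.1 hm).ne' (Option.some.inj e)))).mul_const _
  have d4 : DifferentiableAt ℂ (fun z => (ellGamma q p (bigA t * z))⁻¹) z :=
    differentiableAt_ellGamma_inv_comp hq hp (h := fun z => bigA t * z) (l1 _)
      (mul_ne_zero hA hz) (by
        have := (hreg none).2 (by simp)
        rwa [node_none_mul, inv_inv] at this)
  have d5 : DifferentiableAt ℂ (fun z => (ellGamma q p (bigA t * z⁻¹))⁻¹) z :=
    differentiableAt_ellGamma_inv_comp hq hp (h := fun z => bigA t * z⁻¹) (l2 _)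
      (mul_ne_zero hA (inv_ne_zero hz)) (by
        have := (hreg none).1
        rwa [node_none_mul] at this)
  have d6 : DifferentiableAt ℂ (fun z => ellGamma q p (t 0 * z)) z :=
    differentiableAt_ellGamma_comp hq hp (h := fun z => t 0 * z) (l1 _)
      (mul_ne_zero (h.ne_zero 0) hz) (hreg (some 0)).1
  have d7 : DifferentiableAt ℂ
      (fun z => dPoch q p (q * p * (t 0 * z⁻¹)⁻¹) / dPochTail q p (t 0 * z⁻¹)) z :=
    ((differentiable_dPoch hq hp _).fun_comp' z
      (((l2 (t 0)).fun_inv (mul_ne_zero (h.ne_zero 0) (inv_ne_zero hz))).const_mul _)).fun_div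
      ((differentiable_dPochTail hq hp _).fun_comp' z (l2 (t 0))) h0
  have d3' := DifferentiableAt.fun_finsetProd (u := Finset.Ioi (0 : Fin 5)) d3
  exact ((d1.fun_mul d2).fun_mul (((d6.fun_mul d7).mul_const _).fun_mul d3')).fun_mul
    ((d4.fun_mul d5).mul_const _)

/-- The residue of `ρ(z) / z` at `z = t₁` for generic parameters: the factors `Γ(t₁²)`,
`Γ(t₁ tₘ)` and `Γ(A / t₁)` cancel against their inverses. -/
noncomputable def resid (q p : ℂ) (t : Fin 5 → ℂ) : ℂ :=
  (qPoch q q * qPoch p p)⁻¹ *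
    ((∏ m ∈ Finset.Ioi (0 : Fin 5), (ellGamma q p (t m * (t 0)⁻¹) *
        ellGamma q p (bigA t * (t m)⁻¹))) *
      ((ellGamma q p (t 0 * t 0)⁻¹)⁻¹ * (ellGamma q p (bigA t * t 0))⁻¹ *
        ∏ m ∈ Finset.Ioi (0 : Fin 5), ∏ s ∈ Finset.Ioi m, (ellGamma q p (t m * t s))⁻¹))

lemma prod_pairs_Ioi (f : Fin 5 → Fin 5 → ℂ) :
    ∏ m ∈ Finset.Ioi (0 : Fin 5), ∏ s ∈ Finset.Ioi m, f m s =
      f 1 2 * f 1 3 * f 1 4 * (f 2 3 * f 2 4 * f 3 4) := by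
  have e1 : Finset.Ioi (1 : Fin 5) = {2, 3, 4} := by decide
  have e2 : Finset.Ioi (2 : Fin 5) = {3, 4} := by decide
  have e3 : Finset.Ioi (3 : Fin 5) = {4} := by decide
  have e4 : Finset.Ioi (4 : Fin 5) = ∅ := by decide
  rw [prod_Ioi_zero, e1, e2, e3, e4]
  simp
  ring

lemma regPart_apply {q p : ℂ} {t : Fin 5 → ℂ} (h : Generic q p t) :
    regPart q p t (t 0) = resid q p t := by
  have hq := h.norm_q
  have hp := h.norm_p
  have ht := h.ne_zero 0
  have e0 : theta p (t 0 ^ 2) * theta q (t 0 ^ 2)⁻¹ * ellGamma q p (t 0 * t 0) =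
      (ellGamma q p (t 0 * t 0)⁻¹)⁻¹ := by
    have h1 := dPoch_mul_dPoch_inv hq hp (t 0 * t 0)
    have h2 := (h.pair 0 0).dPoch_ne_zero hq hp
    have h3 := (h.pair 0 0).inv.dPoch_mul_inv_ne_zero hq hp h.q_ne_zero h.p_ne_zero
    rw [inv_inv] at h3
    rw [sq, ellGamma_eq, ellGamma_inv_eq, inv_inv, mul_div_assoc', div_eq_div_iff h2 h3,
      mul_comm (dPoch q p _) (dPoch q p (t 0 * t 0)), h1]
    ring
  have e1 : ellGamma q p (bigA t * (t 0)⁻¹) * (ellGamma q p (bigA t * (t 0)⁻¹))⁻¹ = 1 :=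
    mul_inv_cancel₀ ((h.semigeneric.bigA_quot 0).ellGamma_ne_zero hq hp h.q_ne_zero h.p_ne_zero)
  have e2 (m : Fin 5) : ellGamma q p (t m * t 0) * (ellGamma q p (t 0 * t m))⁻¹ = 1 := by
    rw [mul_comm (t 0)]
    exact mul_inv_cancel₀ ((h.pair m 0).ellGamma_ne_zero hq hp h.q_ne_zero h.p_ne_zero)
  have e3 : dPoch q p (q * p * (t 0 * (t 0)⁻¹)⁻¹) / dPochTail q p (t 0 * (t 0)⁻¹) =
      (qPoch q q * qPoch p p)⁻¹ := by
    rw [mul_inv_cancel₀ ht, inv_one, mul_one, dPochTail_one hq hp,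
      div_mul_cancel_right₀ (dPoch_mul_self_ne_zero hq hp)]
  rw [regPart, resid, e3, prod_pairs, prod_pairs_Ioi, prod_Ioi_zero, prod_Ioi_zero, ← e0]
  have f1 := e2 1
  have f2 := e2 2
  have f3 := e2 3
  have f4 := e2 4
  generalize theta p (t 0 ^ 2) * theta q (t 0 ^ 2)⁻¹ = T at *
  generalize (ellGamma q p (t 0 * t 1))⁻¹ = G1, (ellGamma q p (t 0 * t 2))⁻¹ = G2,
    (ellGamma q p (t 0 * t 3))⁻¹ = G3, (ellGamma q p (t 0 * t 4))⁻¹ = G4,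
    ellGamma q p (t 1 * t 0) = H1, ellGamma q p (t 2 * t 0) = H2,
    ellGamma q p (t 3 * t 0) = H3, ellGamma q p (t 4 * t 0) = H4,
    ellGamma q p (bigA t * (t 0)⁻¹) = A,
    (qPoch q q * qPoch p p)⁻¹ = c, ellGamma q p (t 0 * t 0) = E,
    (ellGamma q p (t 1 * t 2))⁻¹ * (ellGamma q p (t 1 * t 3))⁻¹ * (ellGamma q p (t 1 * t 4))⁻¹ *
      ((ellGamma q p (t 2 * t 3))⁻¹ * (ellGamma q p (t 2 * t 4))⁻¹ *
        (ellGamma q p (t 3 * t 4))⁻¹) = F,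
    (ellGamma q p (bigA t * t 0))⁻¹ = A0 at *
  clear e0 e2 e3
  trans c * (ellGamma q p (t 1 * (t 0)⁻¹) * ellGamma q p (bigA t * (t 1)⁻¹) *
    (ellGamma q p (t 2 * (t 0)⁻¹) * ellGamma q p (bigA t * (t 2)⁻¹)) *
    (ellGamma q p (t 3 * (t 0)⁻¹) * ellGamma q p (bigA t * (t 3)⁻¹)) *
    (ellGamma q p (t 4 * (t 0)⁻¹) * ellGamma q p (bigA t * (t 4)⁻¹)) * (T * E * A0 * F)) *
    ((A * A⁻¹) * (H1 * G1) * (H2 * G2) * (H3 * G3) * (H4 * G4))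
  · ring
  · rw [e1, f1, f2, f3, f4]
    ring

/-- The residue at the point where the contour is pinched. -/
lemma resid_of_mul_eq_one {q p : ℂ} {t : Fin 5 → ℂ} (h : Semigeneric q p t)
    (h01 : t 0 * t 1 = 1) : resid q p t = (qPoch q q * qPoch p p)⁻¹ := by
  have hq := h.norm_q
  have hp := h.norm_p
  have ht := h.ne_zero
  have ne0 (x : ℂ) (hx : NonRes q p x) : ellGamma q p x ≠ 0 :=
    hx.ellGamma_ne_zero hq hp h.q_ne_zero h.p_ne_zero
  have h0i : (t 0)⁻¹ = t 1 := inv_eq_of_mul_eq_one_right h01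
  have hA : bigA t = t 2 * t 3 * t 4 := by
    rw [bigA, Fin.prod_univ_five, h01, one_mul]
  have a1 : bigA t * (t 1)⁻¹ = bigA t * t 0 := by rw [← h0i, inv_inv]
  have a2 : bigA t * (t 2)⁻¹ = t 3 * t 4 := by rw [hA]; field_simp [ht 2]
  have a3 : bigA t * (t 3)⁻¹ = t 2 * t 4 := by rw [hA]; field_simp [ht 3]
  have a4 : bigA t * (t 4)⁻¹ = t 2 * t 3 := by rw [hA]; field_simp [ht 4]
  have b1 : (t 0 * t 0)⁻¹ = t 1 * t 1 := by rw [mul_inv, h0i]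
  have n1 := ne0 _ (h.bigA_quot 1)
  have n2 := ne0 _ (h.bigA_quot 2)
  have n3 := ne0 _ (h.bigA_quot 3)
  have n4 := ne0 _ (h.bigA_quot 4)
  have m1 := ne0 _ (h.pair (m := 1) (s := 1) (by decide) (by decide))
  have m2 := ne0 _ (h.pair (m := 1) (s := 2) (by decide) (by decide))
  have m3 := ne0 _ (h.pair (m := 1) (s := 3) (by decide) (by decide))
  have m4 := ne0 _ (h.pair (m := 1) (s := 4) (by decide) (by decide))
  rw [resid, prod_Ioi_zero, prod_pairs_Ioi, b1, h0i, ← a1, a2, a3, a4, mul_comm (t 2) (t 1),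
    mul_comm (t 3) (t 1), mul_comm (t 4) (t 1)]
  rw [a2] at n2
  rw [a3] at n3
  rw [a4] at n4
  generalize ellGamma q p (bigA t * (t 1)⁻¹) = N1, ellGamma q p (t 3 * t 4) = N2,
    ellGamma q p (t 2 * t 4) = N3, ellGamma q p (t 2 * t 3) = N4, ellGamma q p (t 1 * t 1) = M1,
    ellGamma q p (t 1 * t 2) = M2, ellGamma q p (t 1 * t 3) = M3,
    ellGamma q p (t 1 * t 4) = M4 at *
  generalize (qPoch q q * qPoch p p)⁻¹ = c
  field_simp

lemma continuousAt_resid {x : Param} (h : Semigeneric x.1 x.2.1 x.2.2) :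
    ContinuousAt (fun y : Param => resid y.1 y.2.1 y.2.2) x := by
  have hq := h.norm_q
  have hp := h.norm_p
  have ht := h.ne_zero
  have hA := bigA_ne_zero ht
  have cq : ContinuousAt (fun y : Param => y.1) x := by fun_prop
  have cp : ContinuousAt (fun y : Param => y.2.1) x := by fun_prop
  have ct (m : Fin 5) : ContinuousAt (fun y : Param => y.2.2 m) x := by fun_prop
  have cA : ContinuousAt (fun y : Param => bigA y.2.2) x :=
    (continuous_bigA.comp (by fun_prop : Continuous fun y : Param => y.2.2)).continuousAt
  have dinv {u : ℂ} (hu : NonRes x.1 x.2.1 u) : dPoch x.1 x.2.1 (x.1 * x.2.1 * u⁻¹) ≠ 0 :=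
    hu.dPoch_mul_inv_ne_zero hq hp h.q_ne_zero h.p_ne_zero
  have d1 : ContinuousAt (fun y : Param => (qPoch y.1 y.1 * qPoch y.2.1 y.2.1)⁻¹) x :=
    ((continuousAt_qPoch_comp cq cq hq).fun_mul (continuousAt_qPoch_comp cp cp hp)).inv₀
      (mul_ne_zero (qPoch_self_ne_zero hq) (qPoch_self_ne_zero hp))
  have d2 : ContinuousAt (fun y : Param => ∏ m ∈ Finset.Ioi (0 : Fin 5),
      (ellGamma y.1 y.2.1 (y.2.2 m * (y.2.2 0)⁻¹) *
        ellGamma y.1 y.2.1 (bigA y.2.2 * (y.2.2 m)⁻¹))) x := by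
    refine tendsto_finsetProd _ fun m hm => ?_
    exact (continuousAt_ellGamma cq cp ((ct m).fun_mul ((ct 0).inv₀ (ht 0))) hq hp
      (mul_ne_zero (ht m) (inv_ne_zero (ht 0)))
      ((h.quot (Finset.mem_Ioi.1 hm).ne').dPoch_ne_zero hq hp)).mul
      (continuousAt_ellGamma cq cp (cA.fun_mul ((ct m).inv₀ (ht m))) hq hp
      (mul_ne_zero hA (inv_ne_zero (ht m))) ((h.bigA_quot m).dPoch_ne_zero hq hp))
  have d3 : ContinuousAt (fun y : Param => (ellGamma y.1 y.2.1 (y.2.2 0 * y.2.2 0)⁻¹)⁻¹) x :=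
    continuousAt_ellGamma_inv cq cp (((ct 0).fun_mul (ct 0)).inv₀ (mul_ne_zero (ht 0) (ht 0))) hq hp
      (inv_ne_zero (mul_ne_zero (ht 0) (ht 0)))
      (dinv (h.pair (m := 0) (s := 0) (by decide) (by decide)).inv)
  have d4 : ContinuousAt (fun y : Param => (ellGamma y.1 y.2.1 (bigA y.2.2 * y.2.2 0))⁻¹) x :=
    continuousAt_ellGamma_inv cq cp (cA.fun_mul (ct 0)) hq hp (mul_ne_zero hA (ht 0))
      (dinv (h.bigA_mul 0))
  have d5 : ContinuousAt (fun y : Param => ∏ m ∈ Finset.Ioi (0 : Fin 5), ∏ s ∈ Finset.Ioi m,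
      (ellGamma y.1 y.2.1 (y.2.2 m * y.2.2 s))⁻¹) x := by
    refine tendsto_finsetProd _ fun m hm => tendsto_finsetProd _ fun s hs => ?_
    have hm' := (Finset.mem_Ioi.1 hm).ne'
    have hs' := ((Finset.mem_Ioi.1 hm).trans (Finset.mem_Ioi.1 hs)).ne'
    exact continuousAt_ellGamma_inv cq cp ((ct m).mul (ct s)) hq hp
      (mul_ne_zero (h.ne_zero m) (h.ne_zero s)) (dinv (h.pair (by simp [hm']) (by simp [hs'])))
  exact d1.mul (d2.mul ((d3.mul d4).mul d5))

/-- Small circles around `t₁` enclose no other pole, and pick up the residue there. -/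
lemma Generic.eventually_circleIntegral {q p : ℂ} {t : Fin 5 → ℂ} (h : Generic q p t) :
    ∀ᶠ r : ℝ in 𝓝[>] 0, Metric.closedBall (t 0) r \ {t 0} ⊆ regSet q p t ∧
      (∮ z in C(t 0, r), regKernel q p t z / z) =
        2 * Real.pi * Complex.I * resid q p t := by
  have hq := h.norm_q
  have hp := h.norm_p
  have ht := h.ne_zero 0
  have hmem : t 0 ∈ nearSet q p t := by
    refine ⟨ht, ?_, fun m => ⟨?_, fun hm => ?_⟩⟩
    · rw [mul_inv_cancel₀ ht, dPochTail_one hq hp]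
      exact mul_ne_zero (mul_ne_zero (qPoch_self_ne_zero hq) (qPoch_self_ne_zero hp))
        (dPoch_mul_self_ne_zero hq hp)
    · exact (h.node_mul_node m (some 0)).dPoch_ne_zero hq hp
    · rcases m with _ | m
      · refine NonRes.dPoch_ne_zero ?_ hq hp
        convert (h.semigeneric.bigA_mul 0).inv.mul_zpow h.q_ne_zero h.p_ne_zero 1 1 using 1
        rw [node, zpow_one, zpow_one, mul_inv]; ring
      · exact (h.semigeneric.quot fun e => hm (by rw [e])).dPoch_ne_zero hq hp
  obtain ⟨R, hR, hRU⟩ := Metric.isOpen_iff.1 (isOpen_nearSet hq hp t) _ hmem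
  filter_upwards [Ioo_mem_nhdsGT hR] with r hr
  have hball : Metric.closedBall (t 0) r ⊆ nearSet q p t :=
    (Metric.closedBall_subset_ball hr.2).trans hRU
  refine ⟨(sdiff_subset_sdiff_left hball).trans (nearSet_sdiff_subset hq hp t), ?_⟩
  have hc := isCycle_circle (t 0) hr.1
  have hsph := Metric.sphere_subset_closedBall.trans hball
  have hne : t 0 ∉ Metric.sphere (t 0) r := by simp [hr.1.ne]
  have h1 := hc.map_mul_inv_sub (isOpen_nearSet hq hp t) hsph
    (differentiableOn_regPart h.admissible) (fun w hw => wind_circle_of_notMem hr.1 (by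
      by_contra! hle
      exact hw (hball (mem_closedBall_iff_norm.2 hle)))) hmem hne
  rw [wind_circle_of_mem (Metric.mem_ball_self hr.1), mul_one, regPart_apply h] at h1
  rw [← h1]
  refine circleIntegral.integral_congr hr.1.le fun z hz => ?_
  exact regKernel_div_eq hq hp t (hsph hz).1

/-! ### The limit in which the contour is pinched -/

/-- The parameters with `t₁` and `t₂` exchanged. -/
def swap01 (t : Fin 5 → ℂ) : Fin 5 → ℂ := t ∘ Equiv.swap 0 1

section Swap

variable {q p : ℂ} {t : Fin 5 → ℂ}

lemma bigA_swap01 (t : Fin 5 → ℂ) : bigA (swap01 t) = bigA t :=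
  Equiv.prod_comp (Equiv.swap 0 1) t

lemma mono_swap01 (t : Fin 5 → ℂ) (n : Fin 5 → ℤ) :
    mono (swap01 t) n = mono t (n ∘ Equiv.swap 0 1) := by
  rw [mono, mono, ← Equiv.prod_comp (Equiv.swap 0 1)]
  simp [swap01]

lemma Generic.swap01 (h : Generic q p t) : Generic q p (swap01 t) where
  __ := h
  ne_zero m := h.ne_zero _
  nonRes n hn := by
    rw [mono_swap01]
    refine h.nonRes _ fun e => hn (funext fun m => ?_)
    have := congrFun e (Equiv.swap 0 1 m)
    simpa using this

lemma Semigeneric.swap01 (h : Semigeneric q p t) : Semigeneric q p (swap01 t) where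
  __ := h
  ne_zero m := h.ne_zero _
  nonRes n hn := by
    rw [mono_swap01]
    refine h.nonRes _ fun e => hn ⟨e.1.symm, e.2⟩

lemma regKernel_swap01 (q p : ℂ) (t : Fin 5 → ℂ) (z : ℂ) :
    regKernel q p (swap01 t) z = regKernel q p t z := by
  have s0 : swap01 t 0 = t 1 := rfl
  have s1 : swap01 t 1 = t 0 := rfl
  have s2 : swap01 t 2 = t 2 := rfl
  have s3 : swap01 t 3 = t 3 := rfl
  have s4 : swap01 t 4 = t 4 := rfl
  simp only [regKernel, prod_pairs]
  simp only [bigA_swap01, Fin.prod_univ_five, s0, s1, s2, s3, s4]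
  rw [mul_comm (t 1) (t 0)]
  ring

lemma regSet_swap01 (q p : ℂ) (t : Fin 5 → ℂ) : regSet q p (swap01 t) = regSet q p t := by
  have h0 : node q p (swap01 t) none = node q p t none := by rw [node, node, bigA_swap01]
  ext z
  refine and_congr_right fun _ => ?_
  rw [Option.forall, Option.forall, h0]
  exact and_congr_right fun _ => (Equiv.forall_congr_right (Equiv.swap (0 : Fin 5) 1)
    (q := fun m => dPoch q p (t m * z) ≠ 0 ∧ dPoch q p (t m * z⁻¹) ≠ 0))

end Swap

/-- The indices of all points of `poleSet` except `t₁` and `t₂`. -/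
def restIdx : Set (Option (Fin 5) × ℕ × ℕ) := {i | i ≠ (some 0, 0, 0) ∧ i ≠ (some 1, 0, 0)}

/-- A cycle that separates the points of `poleSet` from their inverses, except that
`t₁` and `t₂` lie outside it. -/
structure IsPinchedCycle (q p : ℂ) (t : Fin 5 → ℂ) (K : Set ℂ) (Λ : (ℂ → ℂ) → ℂ) : Prop where
  isCycle : IsCycle K Λ
  zero_mem : (0 : ℂ) ∈ sepSet K Λ
  rest : ∀ i ∈ restIdx, polePt q p t i ∈ sepSet K Λ
  outside : ∀ m : Fin 5, m = 0 ∨ m = 1 →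
    (t m ∉ K ∧ wind Λ (t m) = 0) ∧ (t m)⁻¹ ∉ K ∧ wind Λ (t m)⁻¹ = 0

lemma polePt_of_notMem_restIdx (q p : ℂ) (t : Fin 5 → ℂ) {i : Option (Fin 5) × ℕ × ℕ}
    (hi : i ∉ restIdx) : ∃ m : Fin 5, (m = 0 ∨ m = 1) ∧ polePt q p t i = t m := by
  simp only [restIdx, mem_ofPred_eq, not_and_or, not_not] at hi
  rcases hi with rfl | rfl
  · exact ⟨0, Or.inl rfl, by simp [polePt, node]⟩
  · exact ⟨1, Or.inr rfl, by simp [polePt, node]⟩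

namespace IsPinchedCycle

variable {q p : ℂ} {t : Fin 5 → ℂ} {K : Set ℂ} {Λ : (ℂ → ℂ) → ℂ}

lemma subset_regSet (h : IsPinchedCycle q p t K Λ) (hq : ‖q‖ < 1) (hp : ‖p‖ < 1) :
    K ⊆ regSet q p t := by
  intro z hz
  have hz0 : z ≠ 0 := by rintro rfl; exact h.zero_mem.1 hz
  refine mem_regSet hq hp hz0 (fun hzP => ?_) fun hzP => ?_ <;> rw [poleSet_eq_range] at hzP <;>
    obtain ⟨i, hi⟩ := hzP <;> by_cases hr : i ∈ restIdx
  · exact (h.rest i hr).1 (hi ▸ hz)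
  · obtain ⟨m, hm, e⟩ := polePt_of_notMem_restIdx q p t hr
    exact (h.outside m hm).1.1 (by rwa [← e, hi])
  · have := (h.rest i hr).2.2 (by rw [hi]; exact inv_ne_zero hz0)
    rw [hi, inv_inv] at this
    exact this.1 hz
  · obtain ⟨m, hm, e⟩ := polePt_of_notMem_restIdx q p t hr
    exact (h.outside m hm).2.1 (by rwa [← e, hi, inv_inv])

lemma eventually {x : Param} (h : IsPinchedCycle x.1 x.2.1 x.2.2 K Λ) (hq : ‖x.1‖ < 1)
    (hp : ‖x.2.1‖ < 1) (ht : ∀ m, x.2.2 m ≠ 0) :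
    ∀ᶠ y : Param in 𝓝 x, IsPinchedCycle y.1 y.2.1 y.2.2 K Λ := by
  have ct (m : Fin 5) : ContinuousAt (fun y : Param => y.2.2 m) x := by fun_prop
  have h1 : ∀ᶠ y : Param in 𝓝 x, ∀ m : Fin 5, m = 0 ∨ m = 1 →
      (y.2.2 m ∉ K ∧ wind Λ (y.2.2 m) = 0) ∧ (y.2.2 m)⁻¹ ∉ K ∧ wind Λ (y.2.2 m)⁻¹ = 0 := by
    refine eventually_all.2 fun m => ?_
    by_cases hm : m = 0 ∨ m = 1
    · have h2 := h.outside m hm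
      filter_upwards [(ct m).eventually (h.isCycle.eventually_wind_eq h2.1.1),
        ((ct m).inv₀ (ht m)).eventually (h.isCycle.eventually_wind_eq h2.2.1)] with y h3 h4 _
      exact ⟨⟨h3.1, h3.2.trans h2.1.2⟩, h4.1, h4.2.trans h2.2.2⟩
    · exact Eventually.of_forall fun y hy => absurd hy hm
  filter_upwards [h1, eventually_polePt_mem hq hp ht h.isCycle.isOpen_sepSet h.zero_mem h.rest]
    with y h2 h3 using ⟨h.isCycle, h.zero_mem, h3, h2⟩

/-- A separating cycle is homologous to a pinched one together with two small circles about
`t₁` and `t₂`. -/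
lemma integral_eq (h : IsPinchedCycle q p t K Λ) (hg : Generic q p t) :
    ellInt q p t = (Λ fun z => regKernel q p t z / z) +
      2 * Real.pi * Complex.I * (resid q p t + resid q p (swap01 t)) := by
  have hq := hg.norm_q
  have hp := hg.norm_p
  obtain ⟨L, M, hM⟩ := hg.exists_cycle
  rw [← hM.eq_ellInt hg.admissible]
  obtain ⟨r, ⟨h0, h0'⟩, hr⟩ :=
    (hg.eventually_circleIntegral.and eventually_mem_nhdsWithin).exists
  obtain ⟨s, ⟨h1, h1'⟩, hs⟩ :=
    (hg.swap01.eventually_circleIntegral.and eventually_mem_nhdsWithin).exists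
  rw [mem_Ioi] at hr hs
  have e1 : swap01 t 0 = t 1 := rfl
  rw [regSet_swap01, e1] at h1
  simp only [regKernel_swap01, e1] at h1'
  have hnot (m : Fin 5) : t m ∉ regSet q p t := fun hm => by
    have := (hm.2 (some m)).2
    rw [node, mul_inv_cancel₀ (hg.ne_zero m), dPoch_one hq hp] at this
    exact this rfl
  have hne : t 0 ≠ t 1 := fun e => by
    have := hg.semigeneric.quot (m := 0) (s := 1) (by decide) 0 0
    rw [e, mul_inv_cancel₀ (hg.ne_zero 1)] at this
    simp at this
  have hsph {c : ℂ} {R : ℝ} (hR : 0 < R) (hc : Metric.closedBall c R \ {c} ⊆ regSet q p t) :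
      Metric.sphere c R ⊆ regSet q p t := fun z hz =>
    hc ⟨Metric.sphere_subset_closedBall hz, fun e => by
      rw [mem_singleton_iff.1 e] at hz
      simp [hR.ne] at hz⟩
  have hw {c w : ℂ} {R : ℝ} (hR : 0 < R) (hc : Metric.closedBall c R \ {c} ⊆ regSet q p t)
      (hwr : w ∉ regSet q p t) (hwc : w ≠ c) : wind (fun f => ∮ z in C(c, R), f z) w = 0 :=
    wind_circle_of_notMem hR (by
      by_contra! hle
      exact hwr (hc ⟨mem_closedBall_iff_norm.2 hle, hwc⟩))
  have hcyc := (h.isCycle.add_smul (isCycle_circle (t 0) hr) 1).add_smul (isCycle_circle (t 1) hs) 1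
  have hreg := hM.subset_regSet Subset.rfl hq hp
  have key := hM.isCycle.eq_of_wind_eq hcyc (isOpen_regSet hq hp t) hreg
    (union_subset (union_subset (h.subset_regSet hq hp) (hsph hr h0)) (hsph hs h1))
    (differentiableOn_regKernel hg.admissible) (by
      intro w hwr
      rw [IsCycle.wind_add_smul (Λ := fun f => Λ f + 1 * ∮ z in C(t 0, r), f z),
        IsCycle.wind_add_smul (Λ := Λ), one_mul, one_mul]
      have hpole (m : Fin 5) : t m ∈ poleSet q p t := Or.inl ⟨m, 0, 0, by simp⟩
      by_cases hw0 : w = t 0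
      · rw [hw hs h1 hwr (hw0 ▸ hne), hw0, wind_circle_of_mem (Metric.mem_ball_self hr),
          (h.outside 0 (Or.inl rfl)).1.2, (hM.subset (hpole 0)).2.1]
        ring
      by_cases hw1 : w = t 1
      · rw [hw hr h0 hwr hw0, hw1, wind_circle_of_mem (Metric.mem_ball_self hs),
          (h.outside 1 (Or.inr rfl)).1.2, (hM.subset (hpole 1)).2.1]
        ring
      rw [hw hr h0 hwr hw0, hw hs h1 hwr hw1, add_zero, add_zero]
      by_cases hz : w = 0
      · rw [hz, hM.zero_mem.2.1, h.zero_mem.2.1]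
      by_contra hne'
      refine hwr (mem_regSet hq hp hz (fun hzP => hne' ?_) fun hzP => hne' ?_) <;>
        have hsep := hM.subset hzP <;> rw [poleSet_eq_range] at hzP <;>
        obtain ⟨i, hi⟩ := hzP <;> by_cases hri : i ∈ restIdx
      · rw [hsep.2.1, ← hi, (h.rest i hri).2.1]
      · obtain ⟨m, rfl | rfl, e⟩ := polePt_of_notMem_restIdx q p t hri
        · exact absurd (hi.symm.trans e) hw0
        · exact absurd (hi.symm.trans e) hw1
      · have e2 := (hsep.2.2 (inv_ne_zero hz)).2
        have e3 := ((h.rest i hri).2.2 (by rw [hi]; exact inv_ne_zero hz)).2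
        rw [hi, inv_inv] at e3
        rw [inv_inv] at e2
        rw [e2, e3]
      · have e2 := (hsep.2.2 (inv_ne_zero hz)).2
        obtain ⟨m, hm, e⟩ := polePt_of_notMem_restIdx q p t hri
        have e3 := (h.outside m hm).2.2
        rw [← e, hi, inv_inv] at e3
        rw [inv_inv] at e2
        rw [e2, e3])
  rw [key, h0', h1']
  ring

end IsPinchedCycle

lemma Semigeneric.exists_isPinchedCycle {q p : ℂ} {t : Fin 5 → ℂ} (h : Semigeneric q p t)
    (h01 : t 0 * t 1 = 1) : ∃ K Λ, IsPinchedCycle q p t K Λ := by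
  have hq := h.norm_q
  have hp := h.norm_p
  have hA (ε : ℝ) (hε : ε > 0) : {w ∈ polePt q p t '' restIdx | ε ≤ ‖w‖}.Finite := by
    refine (finite_polePt hq hp t hε).subset fun w hw => ⟨?_, hw.2⟩
    rw [poleSet_eq_range]
    exact image_subset_range _ _ hw.1
  have hP0 : ∀ w ∈ poleSet q p t, w ≠ 0 := by
    rw [poleSet_eq_range]
    rintro _ ⟨i, rfl⟩
    exact h.polePt_ne_zero i
  have hB (R : ℝ) : {w ∈ Inv.inv '' poleSet q p t | ‖w‖ ≤ R}.Finite := by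
    refine ((finite_polePt hq hp t (ε := (max R 1)⁻¹) (by positivity)).image Inv.inv).subset ?_
    rintro _ ⟨⟨w, hw, rfl⟩, hR⟩
    refine ⟨w, ⟨hw, ?_⟩, rfl⟩
    rw [norm_inv] at hR
    exact (inv_le_comm₀ (by positivity) (norm_pos_iff.2 (hP0 w hw))).2 (hR.trans (le_max_left _ _))
  have hpow {a b : ℕ} (hab : a ≠ 0 ∨ b ≠ 0) : q ^ a * p ^ b ≠ 1 := fun e => by
    have h1 : ‖q‖ ^ a * ‖p‖ ^ b = 1 := by rw [← norm_pow, ← norm_pow, ← norm_mul, e, norm_one]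
    have h2 := pow_le_one₀ (n := a) (norm_nonneg q) hq.le
    have h3 := pow_le_one₀ (n := b) (norm_nonneg p) hp.le
    refine absurd h1 (ne_of_lt ?_)
    rcases hab with ha | hb
    · exact mul_lt_one_of_nonneg_of_lt_one_left (by positivity)
        (pow_lt_one₀ (norm_nonneg q) hq ha) h3
    · exact mul_lt_one_of_nonneg_of_lt_one_right h2 (by positivity)
        (pow_lt_one₀ (norm_nonneg p) hp hb)
  have hdisj : Disjoint (polePt q p t '' restIdx) (Inv.inv '' poleSet q p t) := by
    rw [disjoint_left, poleSet_eq_range]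
    rintro _ ⟨⟨m, j, k⟩, hi, rfl⟩ ⟨_, ⟨⟨m', j', k'⟩, rfl⟩, e⟩
    have e1 : polePt q p t (m, j, k) * polePt q p t (m', j', k') = 1 := by
      rw [← e, inv_mul_cancel₀ (h.polePt_ne_zero _)]
    have e2 (hjk : j ≠ 0 ∨ k ≠ 0) : q ^ (j + j') * p ^ (k + k') ≠ 1 :=
      hpow (hjk.imp (by omega) (by omega))
    by_cases h1 : m = some 0 ∧ m' = some 1
    · obtain ⟨rfl, rfl⟩ := h1
      refine e2 ?_ (by rw [← e1, ← one_mul (q ^ _), ← h01]; simp only [polePt, node]; ring)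
      by_contra! hjk
      exact hi.1 (by rw [hjk.1, hjk.2])
    by_cases h2 : m = some 1 ∧ m' = some 0
    · obtain ⟨rfl, rfl⟩ := h2
      refine e2 ?_ (by rw [← e1, ← one_mul (q ^ _), ← h01]; simp only [polePt, node]; ring)
      by_contra! hjk
      exact hi.2 (by rw [hjk.1, hjk.2])
    exact h.polePt_mul_polePt_ne_one (i := (m, j, k)) (i' := (m', j', k')) h1 h2 e1
  obtain ⟨K, Λ, hΛ, hz, hAΛ, hBΛ⟩ := exists_separating_cycle hA hB
    (by rintro ⟨w, hw, e⟩; exact hP0 w hw (inv_eq_zero.1 e)) hdisj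
  have hpole (m : Fin 5) : t m ∈ poleSet q p t := Or.inl ⟨m, 0, 0, by simp⟩
  refine ⟨K, Λ, hΛ, ⟨hz.1, hz.2, fun h => absurd rfl h⟩, fun i hi => ?_, ?_⟩
  · have hi' := hAΛ _ (mem_image_of_mem _ hi)
    refine ⟨hi'.1, hi'.2, fun _ => hBΛ _ ⟨_, ?_, rfl⟩⟩
    rw [poleSet_eq_range]
    exact mem_range_self i
  · have e0 : t 0 = (t 1)⁻¹ := eq_inv_of_mul_eq_one_left h01
    have e1 : t 1 = (t 0)⁻¹ := by rw [e0, inv_inv]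
    rintro m (rfl | rfl)
    · exact ⟨hBΛ _ ⟨_, hpole 1, e0.symm⟩, hBΛ _ ⟨_, hpole 0, rfl⟩⟩
    · exact ⟨hBΛ _ ⟨_, hpole 0, e1.symm⟩, hBΛ _ ⟨_, hpole 1, rfl⟩⟩

/-- When `t₁ t₂ → 1`, the kernel tends to zero away from `t₁` and `t₂`, and the integral tends to
the contribution of the residues at `t₁` and `t₂`. -/
lemma tendsto_ellInt_of_mul_eq_one {x : Param} (h : Semigeneric x.1 x.2.1 x.2.2)
    (h01 : x.2.2 0 * x.2.2 1 = 1) :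
    Tendsto (fun y : Param => ellInt y.1 y.2.1 y.2.2) (𝓝[{y | Generic y.1 y.2.1 y.2.2}] x)
      (𝓝 (4 * Real.pi * Complex.I / (qPoch x.1 x.1 * qPoch x.2.1 x.2.1))) := by
  have hq := h.norm_q
  have hp := h.norm_p
  have hadm : Admissible x.1 x.2.1 x.2.2 := h.admissible (by
    rw [h01, inv_one, mul_one]; exact dPoch_mul_self_ne_zero hq hp)
  obtain ⟨K, Λ, hΛ⟩ := h.exists_isPinchedCycle h01
  have c1 : ContinuousAt (fun y : Param => Λ fun z => regKernel y.1 y.2.1 y.2.2 z / z) x := by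
    refine hΛ.isCycle.continuousAt_map
      (F := fun (y : Param) z => regKernel y.1 y.2.1 y.2.2 z / z)
      (fun z hz => continuousAt_regKernel hadm (hΛ.subset_regSet hq hp hz)) ?_
    filter_upwards [hΛ.eventually hq hp h.ne_zero, hadm.eventually] with y hy hya
    exact (differentiableOn_regKernel hya).continuousOn.mono
      (hy.subset_regSet hya.norm_q hya.norm_p)
  have c2 := continuousAt_resid h
  have c3 : ContinuousAt (fun y : Param => resid y.1 y.2.1 (swap01 y.2.2)) x := by
    have := continuousAt_resid (x := (x.1, x.2.1, swap01 x.2.2)) h.swap01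
    refine ContinuousAt.comp (f := fun y : Param => ((y.1, y.2.1, swap01 y.2.2) : Param))
      (g := fun y : Param => resid y.1 y.2.1 y.2.2) this ?_
    have : Continuous swap01 := continuous_pi fun m => continuous_apply (Equiv.swap 0 1 m)
    fun_prop
  have hzero : (Λ fun z => regKernel x.1 x.2.1 x.2.2 z / z) = 0 := by
    have e (z : ℂ) : regKernel x.1 x.2.1 x.2.2 z / z = 0 := by
      rw [regKernel, prod_pairs, h01, ellGamma_inv_eq _ _ 1, dPoch_one hq hp]
      simp
    simp only [e]
    simpa using hΛ.isCycle.map_smul 0 (fun _ => 0) continuousOn_const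
  have c4 := c1.add ((c2.add c3).const_mul (2 * Real.pi * Complex.I))
  have hval : 4 * Real.pi * Complex.I / (qPoch x.1 x.1 * qPoch x.2.1 x.2.1) =
      (Λ fun z => regKernel x.1 x.2.1 x.2.2 z / z) + 2 * Real.pi * Complex.I *
        (resid x.1 x.2.1 x.2.2 + resid x.1 x.2.1 (swap01 x.2.2)) := by
    have h10 : swap01 x.2.2 0 * swap01 x.2.2 1 = 1 := by
      rw [mul_comm]; exact h01
    rw [hzero, resid_of_mul_eq_one h h01, resid_of_mul_eq_one h.swap01 h10]
    ring
  rw [hval]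
  refine (c4.tendsto.mono_left nhdsWithin_le_nhds).congr' ?_
  filter_upwards [eventually_mem_nhdsWithin, nhdsWithin_le_nhds (hΛ.eventually hq hp h.ne_zero)]
    with y hy hyΛ
  exact (hyΛ.integral_eq hy).symm

/-! ### Evaluation for generic parameters -/

lemma countable_zpow_eq {b : ℤ} (hb : b ≠ 0) (c : ℂ) : {z : ℂ | z ^ b = c}.Countable := by
  have hnat {n : ℕ} (hn : 0 < n) (c : ℂ) : {z : ℂ | z ^ n = c}.Countable := by
    refine ((Polynomial.nthRoots n c).toFinset.finite_toSet.subset fun z hz => ?_).countable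
    simpa [Polynomial.mem_nthRoots hn] using hz
  obtain ⟨n, rfl | rfl⟩ := Int.eq_nat_or_neg b
  · simpa using hnat (n := n) (by omega) c
  · refine (hnat (n := n) (by omega) c⁻¹).mono fun z (hz : z ^ (-(n : ℤ)) = c) => ?_
    rw [zpow_neg, zpow_natCast] at hz
    exact (inv_eq_iff_eq_inv.1 hz)

lemma Generic.countable_not_generic {q p : ℂ} {t : Fin 5 → ℂ} (h : Generic q p t) :
    {p' : ℂ | ‖p'‖ < 1 ∧ p' ≠ 0 ∧ ¬Generic q p' t}.Countable := by
  have : (⋃ i : (Fin 5 → ℤ) × ℤ × {b : ℤ // b ≠ 0},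
      {p' : ℂ | p' ^ (i.2.2 : ℤ) = (mono t i.1 * q ^ i.2.1)⁻¹}).Countable :=
    countable_iUnion fun i => countable_zpow_eq i.2.2.2 _
  refine this.mono fun p' ⟨h1, h0, hp'⟩ => ?_
  by_contra hne
  refine hp' ⟨h.norm_q, h1, h.q_ne_zero, h0, h.ne_zero, fun n hn a b e => ?_⟩
  by_cases hb : b = 0
  · exact h.nonRes n hn a 0 (by rw [← e, hb, zpow_zero, zpow_zero])
  · exact hne (mem_iUnion.2 ⟨(n, a, ⟨b, hb⟩), eq_inv_of_mul_eq_one_right e⟩)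

/-- Arbitrarily close to `p` there is `p'` such that `t₁ t₂` is close to a monomial in `q`
and `p'`. -/
lemma Generic.exists_near {q p : ℂ} {t : Fin 5 → ℂ} (h : Generic q p t) {ε : ℝ} (hε : 0 < ε) :
    ∃ p' : ℂ, ∃ a b : ℤ, Generic q p' t ∧ ‖p' - p‖ < ε ∧
      ‖t 0 * t 1 * (q ^ a * p' ^ b) - 1‖ < ε := by
  have hq0 := norm_pos_iff.2 h.q_ne_zero
  have hs : t 0 * t 1 ≠ 0 := mul_ne_zero (h.ne_zero 0) (h.ne_zero 1)
  -- A power of `q` moves `t₁ t₂ pⁿ` into a fixed annulus, where the logarithm is bounded.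
  have hc (n : ℕ) : ∃ a : ℤ, ‖q‖ < ‖t 0 * t 1 * (q ^ a * p ^ n)‖ ∧
      ‖t 0 * t 1 * (q ^ a * p ^ n)‖ ≤ 1 := by
    have hx : 0 < ‖t 0 * t 1 * p ^ n‖ :=
      norm_pos_iff.2 (mul_ne_zero hs (pow_ne_zero n h.p_ne_zero))
    obtain ⟨m, hm1, hm2⟩ := exists_mem_Ioc_zpow hx ((one_lt_inv₀ hq0).2 h.norm_q)
    refine ⟨m + 1, ?_⟩
    have e : ‖t 0 * t 1 * (q ^ (m + 1) * p ^ n)‖ = ‖t 0 * t 1 * p ^ n‖ * ‖q‖ ^ (m + 1) := by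
      rw [← norm_zpow, ← norm_mul]; congr 1; ring
    rw [inv_zpow'] at hm1 hm2
    have hpos := zpow_pos hq0 (m + 1)
    rw [e]
    constructor
    · calc ‖q‖ = ‖q‖ ^ (-m) * ‖q‖ ^ (m + 1) := by
            rw [← zpow_add₀ hq0.ne']; simp
        _ < _ := by gcongr
    · calc _ ≤ ‖q‖ ^ (-(m + 1)) * ‖q‖ ^ (m + 1) := by gcongr
        _ = 1 := by rw [← zpow_add₀ hq0.ne']; simp
  choose a ha1 ha2 using hc
  set c : ℕ → ℂ := fun n => t 0 * t 1 * (q ^ a n * p ^ n) with hcdef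
  have hc0 (n : ℕ) : c n ≠ 0 := norm_pos_iff.1 (hq0.trans (ha1 n))
  have hlog (n : ℕ) : ‖Complex.log (c n)‖ ≤ -Real.log ‖q‖ + Real.pi := by
    refine (Complex.norm_le_abs_re_add_abs_im _).trans (add_le_add ?_ ?_)
    · rw [Complex.log_re, abs_of_nonpos (Real.log_nonpos (norm_nonneg _) (ha2 n))]
      exact neg_le_neg (Real.log_le_log hq0 (ha1 n).le)
    · rw [Complex.log_im]
      exact Complex.abs_arg_le_pi _
  have hlim : Tendsto (fun n : ℕ => p * Complex.exp (-Complex.log (c n) / n)) atTop (𝓝 p) := by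
    have h1 : Tendsto (fun n : ℕ => -Complex.log (c n) / n) atTop (𝓝 0) := by
      refine squeeze_zero_norm (a := fun n : ℕ => (-Real.log ‖q‖ + Real.pi) / n) (fun n => ?_)
        (tendsto_const_div_atTop_nhds_zero_nat _)
      rw [norm_div, norm_neg, Complex.norm_natCast]
      gcongr
      exact hlog n
    have h2 := ((Complex.continuous_exp.tendsto 0).comp h1).const_mul p
    simpa using h2
  have hopen : {p' : ℂ | ‖p' - p‖ < ε ∧ ‖p'‖ < 1 ∧ p' ≠ 0} ∈ 𝓝 p := by
    have h1 : ∀ᶠ p' : ℂ in 𝓝 p, ‖p' - p‖ < ε :=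
      (by fun_prop : ContinuousAt (fun p' : ℂ => ‖p' - p‖) p).eventually_lt_const (by simpa)
    have h2 : ∀ᶠ p' : ℂ in 𝓝 p, ‖p'‖ < 1 := continuousAt_id.norm.eventually_lt_const h.norm_p
    exact h1.and (h2.and (isOpen_ne.mem_nhds h.p_ne_zero))
  obtain ⟨n, hn, hn0⟩ := ((hlim.eventually (eventually_mem_nhds_iff.2 hopen)).and
    (eventually_gt_atTop 0)).exists
  -- This choice makes `t₁ t₂ q ^ a n * p₁ ^ n = 1`.
  set p₁ := p * Complex.exp (-Complex.log (c n) / n) with hp₁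
  have hval : t 0 * t 1 * (q ^ a n * p₁ ^ (n : ℤ)) = 1 := by
    have hn' : (n : ℂ) ≠ 0 := Nat.cast_ne_zero.2 hn0.ne'
    have e : Complex.exp (-Complex.log (c n) / n) ^ n = (c n)⁻¹ := by
      rw [← Complex.exp_nat_mul, mul_div_cancel₀ _ hn', Complex.exp_neg, Complex.exp_log (hc0 n)]
    rw [zpow_natCast, hp₁, mul_pow, e, ← mul_inv_cancel₀ (hc0 n)]
    simp only [hcdef]
    ring
  have hcont : ContinuousAt (fun p' : ℂ => ‖t 0 * t 1 * (q ^ a n * p' ^ (n : ℤ)) - 1‖) p₁ := by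
    simp only [zpow_natCast]; fun_prop
  have hnear : ∀ᶠ p' in 𝓝 p₁, ‖t 0 * t 1 * (q ^ a n * p' ^ (n : ℤ)) - 1‖ < ε :=
    hcont.eventually_lt_const (by simpa only [hval, sub_self, norm_zero])
  obtain ⟨p', hp', hp'1, hp'2⟩ := (h.countable_not_generic.dense_compl ℂ).inter_nhds_nonempty
    (Filter.inter_mem hn hnear)
  refine ⟨p', a n, n, ?_, hp'1.1, hp'2⟩
  by_contra hng
  exact hp' ⟨hp'1.2.1, hp'1.2.2, hng⟩

lemma IsSeparatingCycle.continuousAt_ellInt {K : Set ℂ} {Λ : (ℂ → ℂ) → ℂ} {x : Param}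
    (h : IsSeparatingCycle (poleSet x.1 x.2.1 x.2.2) K Λ) (ha : Admissible x.1 x.2.1 x.2.2) :
    ContinuousAt (fun y : Param => ellInt y.1 y.2.1 y.2.2) x := by
  refine (h.continuousAt_regKernel ha).congr ?_
  filter_upwards [h.eventually ha.norm_q ha.norm_p ha.ne_zero, ha.eventually] with y hy hya
  exact hy.eq_ellInt hya

/-- The evaluation for generic parameters: the integral is unchanged when `t₁` is replaced by
`t₁ q^a p^b`, and, up to a small change of `p`, such a multiple of `t₁` can be brought close to
`1 / t₂`, where the integral is computed by residues. -/
lemma Generic.ellInt_eq {q p : ℂ} {t : Fin 5 → ℂ} (h : Generic q p t) :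
    ellInt q p t = 4 * Real.pi * Complex.I / (qPoch q q * qPoch p p) := by
  have hex (k : ℕ) := h.exists_near (ε := 1 / ((k : ℝ) + 1)) (by positivity)
  choose p' a b hg hp' hab using hex
  have hlim := tendsto_one_div_add_atTop_nhds_zero_nat (𝕜 := ℝ)
  have l1 : Tendsto p' atTop (𝓝 p) :=
    tendsto_iff_norm_sub_tendsto_zero.2 (squeeze_zero (fun _ => norm_nonneg _)
      (fun k => (hp' k).le) hlim)
  have l2 : Tendsto (fun k => t 0 * t 1 * (q ^ a k * p' k ^ b k)) atTop (𝓝 1) :=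
    tendsto_iff_norm_sub_tendsto_zero.2 (squeeze_zero (fun _ => norm_nonneg _)
      (fun k => (hab k).le) hlim)
  obtain ⟨K, Λ, hΛ⟩ := h.exists_cycle
  have c1 := hΛ.continuousAt_ellInt (x := (q, p, t)) h.admissible
  have t1 : Tendsto (fun k => ellInt q (p' k) t) atTop (𝓝 (ellInt q p t)) :=
    c1.tendsto.comp (f := fun k => ((q, p' k, t) : Param))
      (tendsto_const_nhds.prodMk_nhds (l1.prodMk_nhds tendsto_const_nhds))
  have l3 : Tendsto (fun k => EllipticBeta.shift (q ^ a k * p' k ^ b k) t) atTop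
      (𝓝 (Function.update t 0 (t 1)⁻¹)) := by
    refine tendsto_const_nhds.update 0 ?_
    have := l2.mul_const (t 1)⁻¹
    rw [one_mul] at this
    refine this.congr fun k => ?_
    field_simp [h.ne_zero 1]
  have t2 := tendsto_ellInt_of_mul_eq_one (x := (q, p, Function.update t 0 (t 1)⁻¹))
    h.semigeneric_update (by
      change Function.update t 0 (t 1)⁻¹ 0 * Function.update t 0 (t 1)⁻¹ 1 = 1
      rw [Function.update_self, Function.update_of_ne (by decide), inv_mul_cancel₀ (h.ne_zero 1)])
  have l4 : Tendsto (fun k => ((q, p' k, EllipticBeta.shift (q ^ a k * p' k ^ b k) t) : Param))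
      atTop (𝓝[{y | Generic y.1 y.2.1 y.2.2}] (q, p, Function.update t 0 (t 1)⁻¹)) :=
    tendsto_nhdsWithin_iff.2 ⟨tendsto_const_nhds.prodMk_nhds (l1.prodMk_nhds l3),
      Eventually.of_forall fun k => (hg k).shift _ _⟩
  refine tendsto_nhds_unique t1 ((t2.comp l4).congr fun k => ?_)
  exact (hg k).ellInt_shift _ _

/-! ### Density of generic parameters -/

/-- The set of `s` at which the parameters `tₘ exp (s ^ m)` are not generic is countable. -/
lemma countable_not_generic_exp {q p : ℂ} {t : Fin 5 → ℂ} (hq : ‖q‖ < 1) (hp : ‖p‖ < 1)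
    (hq0 : q ≠ 0) (hp0 : p ≠ 0) (ht : ∀ m, t m ≠ 0) :
    {s : ℂ | ¬Generic q p fun m => t m * Complex.exp (s ^ ((m : ℕ) + 1))}.Countable := by
  set P : (Fin 5 → ℤ) → Polynomial ℂ :=
    fun n => ∑ m, Polynomial.C (n m : ℂ) * Polynomial.X ^ ((m : ℕ) + 1) with hP
  have hmono (n : Fin 5 → ℤ) (s : ℂ) : mono (fun m => t m * Complex.exp (s ^ ((m : ℕ) + 1))) n =
      mono t n * Complex.exp ((P n).eval s) := by
    simp only [mono, mul_zpow, Finset.prod_mul_distrib, hP, Polynomial.eval_finsetSum,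
      Polynomial.eval_mul, Polynomial.eval_C, Polynomial.eval_pow, Polynomial.eval_X,
      Complex.exp_sum, Complex.exp_int_mul]
  have hcoeff (n : Fin 5 → ℤ) (m : Fin 5) : (P n).coeff ((m : ℕ) + 1) = n m := by
    simp only [hP, Polynomial.finsetSum_coeff, Polynomial.coeff_C_mul_X_pow]
    rw [Finset.sum_eq_single m (fun s _ hs => if_neg fun e => hs (Fin.ext (by omega)))
      (by simp), if_pos rfl]
  have hroot (n : Fin 5 → ℤ) (hn : n ≠ 0) (c : ℂ) : {s : ℂ | (P n).eval s = c}.Countable := by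
    obtain ⟨m, hm⟩ := Function.ne_iff.1 hn
    have hne : P n - Polynomial.C c ≠ 0 := fun e => hm (by
      have := congrArg (fun Q => Polynomial.coeff Q ((m : ℕ) + 1)) e
      simp only [Polynomial.coeff_sub, hcoeff, Polynomial.coeff_C_succ, sub_zero,
        Polynomial.coeff_zero] at this
      exact_mod_cast this)
    refine ((Polynomial.finite_setOfPred_isRoot hne).subset fun s hs => ?_).countable
    simpa [sub_eq_zero] using hs
  have : (⋃ i : {n : Fin 5 → ℤ // n ≠ 0} × ℤ × ℤ × ℤ, {s : ℂ | (P i.1).eval s =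
      Complex.log (mono t i.1 * q ^ i.2.1 * p ^ i.2.2.1)⁻¹ +
        i.2.2.2 * (2 * Real.pi * Complex.I)}).Countable :=
    countable_iUnion fun i => hroot i.1 i.1.2 _
  refine this.mono fun s hs => ?_
  by_contra hne
  refine hs ⟨hq, hp, hq0, hp0, fun m => mul_ne_zero (ht m) (Complex.exp_ne_zero _),
    fun n hn a b e => hne ?_⟩
  have h0 : mono t n * q ^ a * p ^ b ≠ 0 :=
    mul_ne_zero (mul_ne_zero (mono_ne_zero ht n) (zpow_ne_zero a hq0)) (zpow_ne_zero b hp0)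
  rw [hmono] at e
  have e1 : Complex.exp ((P n).eval s) = (mono t n * q ^ a * p ^ b)⁻¹ :=
    eq_inv_of_mul_eq_one_left (by rw [← e]; ring)
  rw [← Complex.exp_log (inv_ne_zero h0)] at e1
  obtain ⟨k, hk⟩ := Complex.exp_eq_exp_iff_exists_int.1 e1
  exact mem_iUnion.2 ⟨(⟨n, hn⟩, a, b, k), hk⟩

lemma mem_closure_generic {x : Param} (hq : ‖x.1‖ < 1) (hp : ‖x.2.1‖ < 1)
    (ht : ∀ m, x.2.2 m ≠ 0) : x ∈ closure {y : Param | Generic y.1 y.2.1 y.2.2} := by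
  have h1 (q p : ℂ) (hq : ‖q‖ < 1) (hp : ‖p‖ < 1) (hq0 : q ≠ 0) (hp0 : p ≠ 0) :
      ((q, p, x.2.2) : Param) ∈ closure {y : Param | Generic y.1 y.2.1 y.2.2} := by
    have hd := (countable_not_generic_exp hq hp hq0 hp0 ht).dense_compl ℂ
    have hf := mem_closure_iff_frequently.1 (hd 0)
    refine mem_closure_of_frequently_of_tendsto (b := 𝓝 (0 : ℂ))
      (f := fun s => ((q, p, fun m => x.2.2 m * Complex.exp (s ^ ((m : ℕ) + 1))) : Param))
      (hf.mono fun s hs => not_not.1 hs) ?_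
    have hc : Continuous fun s : ℂ =>
        ((q, p, fun m => x.2.2 m * Complex.exp (s ^ ((m : ℕ) + 1))) : Param) := by
      fun_prop
    simpa using hc.tendsto 0
  rw [← closure_closure]
  refine mem_closure_of_frequently_of_tendsto (b := 𝓝[≠] (0 : ℂ))
    (f := fun s => ((x.1 + s, x.2.1 + s, x.2.2) : Param)) (Eventually.frequently ?_) ?_
  · have c (w : ℂ) : ContinuousAt (fun s : ℂ => ‖w + s‖) 0 := by fun_prop
    have e (w : ℂ) : ∀ᶠ s : ℂ in 𝓝[≠] 0, w + s ≠ 0 := by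
      by_cases hw : w = 0
      · filter_upwards [eventually_mem_nhdsWithin] with s hs
        simpa [hw] using hs
      · refine nhdsWithin_le_nhds (ContinuousAt.eventually_ne (by fun_prop) ?_)
        simpa using hw
    filter_upwards [e x.1, e x.2.1,
      nhdsWithin_le_nhds ((c x.1).eventually_lt_const (by simpa using hq)),
      nhdsWithin_le_nhds ((c x.2.1).eventually_lt_const (by simpa using hp))] with s h2 h3 h4 h5
    exact h1 _ _ h4 h5 h2 h3
  · have hc : Continuous fun s : ℂ => ((x.1 + s, x.2.1 + s, x.2.2) : Param) := by fun_prop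
    have := (hc.tendsto 0).mono_left (nhdsWithin_le_nhds (s := {0}ᶜ))
    simpa using this

lemma IsSeparatingCycle.integral_regKernel {K : Set ℂ} {Λ : (ℂ → ℂ) → ℂ} {q p : ℂ}
    {t : Fin 5 → ℂ} (h : IsSeparatingCycle (poleSet q p t) K Λ) (ha : Admissible q p t) :
    (Λ fun z => regKernel q p t z / z) =
      4 * Real.pi * Complex.I / (qPoch q q * qPoch p p) := by
  have hcl := mem_closure_generic (x := (q, p, t)) ha.norm_q ha.norm_p ha.ne_zero
  rw [mem_closure_iff_nhdsWithin_neBot] at hcl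
  have c1 := (h.continuousAt_ellInt (x := (q, p, t)) ha).tendsto.mono_left
    (nhdsWithin_le_nhds (s := {y : Param | Generic y.1 y.2.1 y.2.2}))
  have c2 : ContinuousAt (fun y : Param =>
      4 * Real.pi * Complex.I / (qPoch y.1 y.1 * qPoch y.2.1 y.2.1)) (q, p, t) := by
    have cq : ContinuousAt (fun y : Param => y.1) (q, p, t) := by fun_prop
    have cp : ContinuousAt (fun y : Param => y.2.1) (q, p, t) := by fun_prop
    exact continuousAt_const.div ((continuousAt_qPoch_comp cq cq ha.norm_q).fun_mul
      (continuousAt_qPoch_comp cp cp ha.norm_p))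
      (mul_ne_zero (qPoch_self_ne_zero ha.norm_q) (qPoch_self_ne_zero ha.norm_p))
  rw [h.eq_ellInt ha]
  refine tendsto_nhds_unique c1 ((c2.tendsto.mono_left nhdsWithin_le_nhds).congr' ?_)
  filter_upwards [eventually_mem_nhdsWithin] with y hy using (Generic.ellInt_eq hy).symm

/-! ### Contours -/

lemma IsSeparatingContour.isSeparatingCycle {P : Set ℂ} {γ : ℝ → ℂ} {a b : ℝ}
    (h : IsSeparatingContour P γ a b) :
    IsSeparatingCycle P (γ '' Icc a b) fun f => contourIntegral f γ a b :=
  ⟨h.loop.isCycle, ⟨h.encircles_zero.1, h.encircles_zero.2, fun h0 => absurd rfl h0⟩,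
    fun w hw => ⟨(h.encircles w hw).1, (h.encircles w hw).2, h.excludes w hw⟩⟩

end EllipticBeta

open EllipticBeta in
/-- The univariate elliptic beta integral. The hypotheses `hnum` and `hden` say that the factors
`Γ(A tₘ⁻¹)` and `1 / Γ(tₘ tₛ)` of the kernel, which do not depend on `z`, are finite. -/
theorem theorem1 (q p : ℂ) (hq : ‖q‖ < 1) (hp : ‖p‖ < 1)
    (t : Fin 5 → ℂ) (ht : ∀ m, t m ≠ 0)
    (hnum : ∀ (m : Fin 5) (j k : ℕ), bigA t * (t m)⁻¹ * q ^ j * p ^ k ≠ 1)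
    (hden : ∀ m s : Fin 5, m < s → ∀ j k : ℕ, t m * t s ≠ q ^ (j + 1) * p ^ (k + 1))
    (γ : ℝ → ℂ) (a b : ℝ) (hγ : IsSeparatingContour (poleSet q p t) γ a b) :
    IntervalIntegrable (fun x => deriv γ x * (kernel q p t (γ x) / γ x)) MeasureTheory.volume a b ∧
    contourIntegral (fun z => kernel q p t z / z) γ a b =
      4 * Real.pi * Complex.I / (qPoch q q * qPoch p p) := by
  have ha : Admissible q p t :=
    ⟨hq, hp, ht, fun m => dPoch_ne_zero hq hp (hnum m), fun m s hms =>
      dPoch_ne_zero hq hp fun j k e => hden m s hms j k <|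
        ((mul_inv_eq_one₀ (mul_ne_zero (ht m) (ht s))).1 (by rw [← e]; ring)).symm⟩
  have hΛ := hγ.isSeparatingCycle
  have hae : ∀ᵐ x, deriv γ x * (regKernel q p t (γ x) / γ x) =
      deriv γ x * (kernel q p t (γ x) / γ x) := by
    filter_upwards [ae_deriv_eq_zero_of_mem_countable γ (countable_exceptional q p hq hp)] with x hx
    by_cases hS : dPoch q p (q * p * γ x ^ 2) = 0 ∨ dPoch q p (q * p * (γ x ^ 2)⁻¹) = 0
    · rw [hx hS, zero_mul, zero_mul]
    · rw [not_or] at hS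
      rw [kernel_eq_regKernel hq hp t hS.1 hS.2]
  have hint := hγ.loop.intervalIntegrable_mul ((differentiableOn_regKernel ha).continuousOn.mono
    (hΛ.subset_regSet Subset.rfl hq hp))
  refine ⟨hint.congr_ae (MeasureTheory.ae_restrict_of_ae hae), ?_⟩
  rw [← hΛ.integral_regKernel ha]
  refine intervalIntegral.integral_congr_ae ?_
  filter_upwards [hae] with x hx _ using hx.symm
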